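/- Let $\Sigma$ be a totally ordered alphabet. Two strings $x,y\in\Sigma^*$ are order-isomorphic, $x\approx y$, if $|x|=|y|$ and $x[i]\le x[j]\iff y[i]\le y[j]$ for all positions $i,j$. The order-preserving pattern matching problem on trees is: given a non-empty pattern string $p\in\Sigma^*$ of length $m$ and a rooted tree $T$ with $N$ nodes whose edges are labelled by characters of $\Sigma$, report the final node of every path in $T$ (leading from a node down to a descendant) whose label $x$ satisfies $p\approx x$, each such node once. The model of computation is the word RAM with words of $\Theta(\log(m+N))$ or more bits, whose unit-cost operations include the comparison of two characters; $T$ is given by parent pointers and edge labels. Then the following hold. (1) The problem can be solved in $O(\mathrm{sort}(p)+N)$ time, where $\mathrm{sort}(p)$ is the time to sort the characters of $p$: for every sorting program $A$ there are a program $B$ and a constant $C$ such that, for every ordered alphabet $\Sigma$, every $p$ and every $T$, if $A$ arranges the positions of $p$ in nondecreasing order of their characters in $t$ steps, then $B$ solves the problem for $p$ and $T$ in at most $C(t+N)$ steps. (2) For general ordered alphabets, where characters can only be copied and compared, the problem can be solved in $O(m\log m+N)$ time. (3) For integer alphabets of polynomial size, i.e. when for a constant $c$ the characters of $p$ are integers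 in $\{0,\dots,(m+N)^c-1\}$, the problem can be solved in $O(m+N)$ time. -/

import Mathlib

universe u

namespace OPTree

/-! Strings, edge-labelled trees and the order-preserving matching problem -/

/-- Two strings over an ordered alphabet are order-isomorphic: equal length and
`x[i] ≤ x[j] ↔ y[i] ≤ y[j]` for all positions `i`, `j`. -/
def OrderIsomorphic {α : Type u} [LinearOrder α] (x y : List α) : Prop :=
  x.length = y.length ∧
    ∀ (i j : ℕ) (hi : i < x.length) (hj : j < x.length) (hi' : i < y.length) (hj' : j < y.length),
      x[i] ≤ x[j] ↔ y[i] ≤ y[j]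

/-- Downward paths in a parent-pointer structure on the nodes `0, …, n - 1`, where
`edge v = some (u, c)` says that `v` is a child of `u` by an edge labelled `c`.
`DownPath edge a x v`: there is a path from `a` down to `v` whose label is the string `x`. -/
inductive DownPath {α : Type u} {n : ℕ} (edge : Fin n → Option (Fin n × α)) :
    Fin n → List α → Fin n → Prop
  | nil (a : Fin n) : DownPath edge a [] a
  | snoc {a u v : Fin n} {x : List α} {c : α} :
      DownPath edge a x u → edge v = some (u, c) → DownPath edge a (x ++ [c]) v

/-- A finite rooted tree with edges labelled by characters. The nodes are numbered
`0, …, size - 1` in an arbitrary way; `size` is the number of nodes. Only the root has no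
incoming edge, since every node is reachable from the root. -/
structure LabelledTree (α : Type u) where
  size : ℕ
  root : Fin size
  edge : Fin size → Option (Fin size × α)
  edge_root : edge root = none
  reachable : ∀ v, ∃ x, DownPath edge root x v

/-- `v` is the final node of a path of `T` whose label is order-isomorphic to `p`. -/
def IsMatchEnd {α : Type u} [LinearOrder α] (p : List α) (T : LabelledTree α)
    (v : Fin T.size) : Prop :=
  ∃ (a : Fin T.size) (x : List α), DownPath T.edge a x v ∧ OrderIsomorphic p x

/-! The machine: a word RAM with `w`-bit words, in structured form.

A store has word registers, word arrays and character arrays (registers and arrays are named by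
natural numbers fixed in the program; indices into arrays are words computed at run time).
Characters are atomic: a program can copy them, compare two of them, and, only if the alphabet
is an integer alphabet, read a character as a word. -/

/-- The store of the machine. -/
structure Store (α : Type u) where
  reg : ℕ → ℕ
  mem : ℕ → ℕ → ℕ
  chr : ℕ → ℕ → Option α

/-- Assign to a register. -/
def Store.setReg {α : Type u} (s : Store α) (x v : ℕ) : Store α :=
  { s with reg := Function.update s.reg x v }

/-- Assign to cell `i` of the word array `a`. -/
def Store.setMem {α : Type u} (s : Store α) (a i v : ℕ) : Store α :=
  { s with mem := Function.update s.mem a (Function.update (s.mem a) i v) }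

/-- Assign to cell `i` of the character array `a`. -/
def Store.setChr {α : Type u} (s : Store α) (a i : ℕ) (c : α) : Store α :=
  { s with chr := Function.update s.chr a (Function.update (s.chr a) i (some c)) }

/-- Word operations. -/
inductive BinOp
  | add | sub | mul | div | mod | land | lor | xor | shl | shr

/-- The value of a word operation (subtraction is truncated at `0`; `x / 0 = 0`). -/
def BinOp.eval : BinOp → ℕ → ℕ → ℕ
  | .add, x, y => x + y
  | .sub, x, y => x - y
  | .mul, x, y => x * y
  | .div, x, y => x / y
  | .mod, x, y => x % y
  | .land, x, y => x &&& y
  | .lor, x, y => x ||| y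
  | .xor, x, y => x ^^^ y
  | .shl, x, y => x <<< y
  | .shr, x, y => x >>> y

/-- Word expressions: constants, registers, operations, reading `mem a [e]`, and reading the
character `chr a [e]` as an integer. -/
inductive Expr
  | const (c : ℕ)
  | reg (x : ℕ)
  | bin (o : BinOp) (e f : Expr)
  | load (a : ℕ) (e : Expr)
  | code (a : ℕ) (e : Expr)

/-- Every constant, register access, operation and memory access costs one step. -/
def Expr.cost : Expr → ℕ
  | .const _ => 1
  | .reg _ => 1
  | .bin _ e f => e.cost + f.cost + 1
  | .load _ e => e.cost + 1
  | .code _ e => e.cost + 1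

/-- A number is a `w`-bit word, or else the computation fails. -/
def word (w v : ℕ) : Option ℕ := if v < 2 ^ w then some v else none

/-- Value of an expression; `none` means failure (overflow of the word size, reading a blank
character cell, or reading a character that has no integer value). The map `code` gives the
integer value of those characters that the machine can read as integers. -/
def Expr.eval {α : Type u} (w : ℕ) (code : α → Option ℕ) (s : Store α) : Expr → Option ℕ
  | .const c => word w c
  | .reg x => some (s.reg x)
  | .bin o e f =>
      (e.eval w code s).bind fun x => (f.eval w code s).bind fun y => word w (o.eval x y)
  | .load a e => (e.eval w code s).map fun i => s.mem a i
  | .code a e =>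
      (e.eval w code s).bind fun i => (s.chr a i).bind fun c => (code c).bind fun v => word w v

/-- Tests: comparison of words, comparison `chr a [e] ≤ chr b [f]` of characters, and Boolean
combinations. -/
inductive Test
  | lt (e f : Expr)
  | eq (e f : Expr)
  | chrLe (a : ℕ) (e : Expr) (b : ℕ) (f : Expr)
  | not (t : Test)
  | and (t t' : Test)

/-- The number of steps of a test. -/
def Test.cost : Test → ℕ
  | .lt e f => e.cost + f.cost + 1
  | .eq e f => e.cost + f.cost + 1
  | .chrLe _ e _ f => e.cost + f.cost + 1
  | .not t => t.cost + 1
  | .and t t' => t.cost + t'.cost + 1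

/-- Value of a test; `none` means failure. -/
def Test.eval {α : Type u} [LinearOrder α] (w : ℕ) (code : α → Option ℕ) (s : Store α) :
    Test → Option Bool
  | .lt e f => (e.eval w code s).bind fun x => (f.eval w code s).map fun y => decide (x < y)
  | .eq e f => (e.eval w code s).bind fun x => (f.eval w code s).map fun y => decide (x = y)
  | .chrLe a e b f =>
      (e.eval w code s).bind fun i => (f.eval w code s).bind fun j =>
        (s.chr a i).bind fun c => (s.chr b j).map fun d => decide (c ≤ d)
  | .not t => (t.eval w code s).map fun x => !x
  | .and t t' => (t.eval w code s).bind fun x => (t'.eval w code s).map fun y => x && y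

/-- Programs. -/
inductive Program
  | skip
  | setReg (x : ℕ) (e : Expr)
  | setMem (a : ℕ) (e f : Expr)
  | copyChr (a : ℕ) (e : Expr) (b : ℕ) (f : Expr)
  | seq (P Q : Program)
  | ite (t : Test) (P Q : Program)
  | loop (t : Test) (P : Program)

/-- `Run w code P s s' k`: on `w`-bit words, the program `P` started in the store `s` halts
without failure in the store `s'` after exactly `k` steps. -/
inductive Run {α : Type u} [LinearOrder α] (w : ℕ) (code : α → Option ℕ) :
    Program → Store α → Store α → ℕ → Prop
  | skip (s : Store α) : Run w code .skip s s 1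
  | setReg {s : Store α} {x : ℕ} {e : Expr} {v : ℕ} :
      e.eval w code s = some v →
      Run w code (.setReg x e) s (s.setReg x v) (e.cost + 1)
  | setMem {s : Store α} {a : ℕ} {e f : Expr} {i v : ℕ} :
      e.eval w code s = some i → f.eval w code s = some v →
      Run w code (.setMem a e f) s (s.setMem a i v) (e.cost + f.cost + 1)
  | copyChr {s : Store α} {a b : ℕ} {e f : Expr} {i j : ℕ} {c : α} :
      e.eval w code s = some i → f.eval w code s = some j → s.chr b j = some c →
      Run w code (.copyChr a e b f) s (s.setChr a i c) (e.cost + f.cost + 1)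
  | seq {s s' s'' : Store α} {P Q : Program} {k l : ℕ} :
      Run w code P s s' k → Run w code Q s' s'' l →
      Run w code (.seq P Q) s s'' (k + l)
  | ite_true {s s' : Store α} {t : Test} {P Q : Program} {k : ℕ} :
      t.eval w code s = some true → Run w code P s s' k →
      Run w code (.ite t P Q) s s' (t.cost + k)
  | ite_false {s s' : Store α} {t : Test} {P Q : Program} {k : ℕ} :
      t.eval w code s = some false → Run w code Q s s' k →
      Run w code (.ite t P Q) s s' (t.cost + k)
  | loop_true {s s' s'' : Store α} {t : Test} {P : Program} {k l : ℕ} :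
      t.eval w code s = some true → Run w code P s s' k →
      Run w code (.loop t P) s' s'' l →
      Run w code (.loop t P) s s'' (t.cost + k + l)
  | loop_false {s : Store α} {t : Test} {P : Program} :
      t.eval w code s = some false → Run w code (.loop t P) s s t.cost

/-! Input and output conventions -/

/-- Input of the sorting problem: the length of `p` in register `0`, the string `p` in the
character array `0`, everything else blank. -/
def sortInput {α : Type u} (p : List α) : Store α where
  reg x := if x = 0 then p.length else 0
  mem _ _ := 0
  chr a i := if a = 0 then p[i]? else none

/-- Output of the sorting problem: the cells `0, …, |p| - 1` of the word array `0` hold the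
positions of `p` in an order in which the characters at these positions are nondecreasing. -/
def IsSortOutput {α : Type u} [LinearOrder α] (p : List α) (s : Store α) : Prop :=
  ∃ σ : Equiv.Perm (Fin p.length),
    (∀ i : Fin p.length, s.mem 0 i = σ i) ∧ Monotone fun i => p.get (σ i)

/-- The program `A` sorts the string `p` in exactly `t` steps. -/
def SortsIn {α : Type u} [LinearOrder α] (w : ℕ) (code : α → Option ℕ) (A : Program)
    (p : List α) (t : ℕ) : Prop :=
  ∃ s, Run w code A (sortInput p) s t ∧ IsSortOutput p s

/-- Input of the matching problem on trees: the registers `0`, `1`, `2` hold the length of the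
pattern, the number of nodes and the number of the root; the character array `0` holds the
pattern; for each node `v` other than the root, cell `v` of the word array `0` holds the parent
of `v`, and cell `v` of the character array `1` holds the label of the edge from the parent to
`v`; at the root these cells hold the root itself and a blank. Everything else is blank. -/
def matchInput {α : Type u} (p : List α) (T : LabelledTree α) : Store α where
  reg x := if x = 0 then p.length else if x = 1 then T.size else if x = 2 then T.root else 0
  mem a i :=
    if a = 0 then
      if h : i < T.size then
        match T.edge ⟨i, h⟩ with
        | some (u, _) => u
        | none => i
      else 0
    else 0
  chr a i :=
    if a = 0 then p[i]?
    else if a = 1 then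
      if h : i < T.size then (T.edge ⟨i, h⟩).map Prod.snd else none
    else none

/-- Output of the matching problem: register `0` holds the number of reported nodes, the word
array `0` holds the list of these nodes from cell `0` on; each final node of a path whose label
is order-isomorphic to `p` is reported exactly once, and no other node is reported. -/
def IsMatchOutput {α : Type u} [LinearOrder α] (p : List α) (T : LabelledTree α)
    (s : Store α) : Prop :=
  ((List.range (s.reg 0)).map (s.mem 0)).Nodup ∧
    ∀ k : ℕ, k ∈ (List.range (s.reg 0)).map (s.mem 0) ↔
      ∃ v : Fin T.size, (v : ℕ) = k ∧ IsMatchEnd p T v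

/-- The program `B` solves the matching problem for `p` and `T` in at most `t` steps. -/
def SolvesWithin {α : Type u} [LinearOrder α] (w : ℕ) (code : α → Option ℕ) (B : Program)
    (p : List α) (T : LabelledTree α) (t : ℕ) : Prop :=
  ∃ (s : Store α) (k : ℕ), Run w code B (matchInput p T) s k ∧ k ≤ t ∧ IsMatchOutput p T s

end OPTree

namespace OPTree

/-! ### A verification calculus for the machine -/

section Calculus

/-! The algorithm is Knuth–Morris–Pratt for order isomorphism, carried down the tree. Order
isomorphism passes to factors and is transitive, so borders behave as for equality (`OI.border`,
`OI.trans_border`) and a failure function makes sense. Extending an order-isomorphic prefix by one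
character needs only comparisons with its two order neighbours among the earlier characters of the
pattern (`OI.succ_iff`). These neighbours come from the sorted pattern by deleting positions from
the last to the first in a doubly linked list (`wp_neighbourPhase`). This is the only place where
sorting is needed.

On a single text the failure steps are paid for by the growth of the state. On a tree this breaks
down, since all children of a node would spend the same potential. The remedy uses heights: at a
node of height `h`, a prefix of length `k` with `k + h < m` cannot grow to a full match below that
node, so the failure chain is abandoned and the state restarts from `0`. No match is lost
(`IsState.eq_iff`), and the useful potential of a node is the truncated difference `state + height -
m`, which is at most the height.

Let `F v` be the number of failure steps at `v`. Then `F v` plus the potential of `v` is at most the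
potential of the parent plus one, and also at most the height of `v` plus one (`wp_chain`). Choose
for every inner node one child of maximal height. Along the chosen edges the costs telescope; at the
other nodes the height bound applies, and their heights sum up to at most the number of chosen
nodes. Hence the total is at most `3 * N` (`IsHeight.sum_le`), and the matching loop is linear
(`wp_matchPhase`).

Parent pointers alone give a preorder in linear time: climb from each node to the first listed
ancestor and splice the climbed branch in behind it (`wp_orderPhase`). In preorder, one character
array indexed by depth holds the text of the current node, and the heights come from the reverse
order.

A sorting program is run under renumbered registers and arrays, so that it cannot disturb the input
(`Run.shift`). Its output has at least `m - 1` nonzero cells in a memory that starts at zero, so it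
takes at least `m - 1` steps (`SortsIn.length_le`), which absorbs the linear terms in `m`. Merge
sort and radix sort on the pattern give the other two bounds.

All running times are proved by a weakest-precondition calculus in which loop invariants speak of
the store and of the number of steps made so far (`wp_loop`). -/

/-- The number of words of `w` bits. -/
def wordBound (w : ℕ) : ℕ := 2 ^ w

/-- The value of an expression when no failure occurs. -/
def Expr.val {α : Type u} (code : α → Option ℕ) (s : Store α) : Expr → ℕ
  | .const c => c
  | .reg x => s.reg x
  | .bin o e f => o.eval (e.val code s) (f.val code s)
  | .load a e => s.mem a (e.val code s)
  | .code a e => ((s.chr a (e.val code s)).bind code).getD 0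

/-- The evaluation of an expression does not fail. -/
def Expr.ok {α : Type u} (w : ℕ) (code : α → Option ℕ) (s : Store α) : Expr → Prop
  | .const c => c < wordBound w
  | .reg _ => True
  | .bin o e f => e.ok w code s ∧ f.ok w code s ∧
      o.eval (e.val code s) (f.val code s) < wordBound w
  | .load _ e => e.ok w code s
  | .code a e => e.ok w code s ∧ ∃ c v, s.chr a (e.val code s) = some c ∧ code c = some v ∧
      v < wordBound w

theorem word_eq_some {w v r : ℕ} : word w v = some r ↔ v < wordBound w ∧ v = r := by
  unfold word wordBound
  split <;> simp_all

/-- Splits partial evaluation into a total value and a no-failure side condition, so that running a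
program turns into arithmetic about values and word bounds. -/
theorem Expr.eval_eq_some {α : Type u} {w : ℕ} {code : α → Option ℕ} {s : Store α} (e : Expr) :
    ∀ {v : ℕ}, e.eval w code s = some v ↔ e.ok w code s ∧ e.val code s = v := by
  induction e with
  | const c => simp [Expr.eval, Expr.ok, Expr.val, word_eq_some]
  | reg x => simp [Expr.eval, Expr.ok, Expr.val]
  | bin o e f he hf =>
    intro v
    simp only [Expr.eval, Expr.ok, Expr.val, Option.bind_eq_some_iff, he, hf, word_eq_some]
    grind
  | load a e he =>
    intro v
    simp only [Expr.eval, Expr.ok, Expr.val, Option.map_eq_some_iff, he]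
    grind
  | code a e he =>
    intro v
    simp only [Expr.eval, Expr.ok, Expr.val, Option.bind_eq_some_iff, he, word_eq_some]
    constructor
    · rintro ⟨i, ⟨h1, rfl⟩, c, h2, x, h3, h4, rfl⟩
      exact ⟨⟨h1, c, x, h2, h3, h4⟩, by simp [h2, h3]⟩
    · rintro ⟨⟨h1, c, x, h2, h3, h4⟩, h5⟩
      refine ⟨_, ⟨h1, rfl⟩, c, h2, x, h3, h4, ?_⟩
      simpa [h2, h3] using h5

/-- The evaluation of a test does not fail. -/
def Test.ok {α : Type u} (w : ℕ) (code : α → Option ℕ) (s : Store α) : Test → Prop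
  | .lt e f => e.ok w code s ∧ f.ok w code s
  | .eq e f => e.ok w code s ∧ f.ok w code s
  | .chrLe a e b f => e.ok w code s ∧ f.ok w code s ∧ (∃ c, s.chr a (e.val code s) = some c) ∧
      ∃ d, s.chr b (f.val code s) = some d
  | .not t => t.ok w code s
  | .and t t' => t.ok w code s ∧ t'.ok w code s

/-- The truth of a test when no failure occurs. -/
def Test.holds {α : Type u} [LinearOrder α] (code : α → Option ℕ) (s : Store α) : Test → Prop
  | .lt e f => e.val code s < f.val code s
  | .eq e f => e.val code s = f.val code s
  | .chrLe a e b f => ∃ c d, s.chr a (e.val code s) = some c ∧ s.chr b (f.val code s) = some d ∧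
      c ≤ d
  | .not t => ¬ t.holds code s
  | .and t t' => t.holds code s ∧ t'.holds code s

theorem Test.eval_eq_some {α : Type u} [LinearOrder α] {w : ℕ} {code : α → Option ℕ}
    {s : Store α} (t : Test) :
    ∀ {b : Bool}, t.eval w code s = some b ↔ t.ok w code s ∧ (b = true ↔ t.holds code s) := by
  induction t with
  | lt e f =>
    intro b
    simp only [Test.eval, Test.ok, Test.holds, Option.bind_eq_some_iff, Option.map_eq_some_iff,
      Expr.eval_eq_some]
    constructor
    · rintro ⟨_, ⟨h1, rfl⟩, _, ⟨h2, rfl⟩, rfl⟩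
      simp [h1, h2]
    · rintro ⟨⟨h1, h2⟩, h⟩
      exact ⟨_, ⟨h1, rfl⟩, _, ⟨h2, rfl⟩, by cases b <;> simp_all⟩
  | eq e f =>
    intro b
    simp only [Test.eval, Test.ok, Test.holds, Option.bind_eq_some_iff, Option.map_eq_some_iff,
      Expr.eval_eq_some]
    constructor
    · rintro ⟨_, ⟨h1, rfl⟩, _, ⟨h2, rfl⟩, rfl⟩
      simp [h1, h2]
    · rintro ⟨⟨h1, h2⟩, h⟩
      exact ⟨_, ⟨h1, rfl⟩, _, ⟨h2, rfl⟩, by cases b <;> simp_all⟩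
  | chrLe a e c f =>
    intro b
    simp only [Test.eval, Test.ok, Test.holds, Option.bind_eq_some_iff, Option.map_eq_some_iff,
      Expr.eval_eq_some]
    constructor
    · rintro ⟨i, ⟨h1, rfl⟩, j, ⟨h2, rfl⟩, x, hx, y, hy, rfl⟩
      simp [h1, h2, hx, hy]
    · rintro ⟨⟨h1, h2, ⟨x, hx⟩, y, hy⟩, h⟩
      refine ⟨_, ⟨h1, rfl⟩, _, ⟨h2, rfl⟩, x, hx, y, hy, ?_⟩
      simp only [hx, hy] at h
      cases b <;> simp_all
  | not t ht =>
    intro b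
    simp only [Test.eval, Test.ok, Test.holds, Option.map_eq_some_iff, ht]
    cases b <;> simp
  | and t t' ht ht' =>
    intro b
    simp only [Test.eval, Test.ok, Test.holds, Option.bind_eq_some_iff, Option.map_eq_some_iff,
      ht, ht']
    cases b <;> by_cases h : t.holds code s <;> by_cases h' : t'.holds code s <;> simp [h, h']

/-- `WP w code P s Q`: started in `s`, the program `P` halts in some store after some number of
steps such that `Q` holds of the two. -/
def WP {α : Type u} [LinearOrder α] (w : ℕ) (code : α → Option ℕ) (P : Program) (s : Store α)
    (Q : Store α → ℕ → Prop) : Prop :=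
  ∃ s' k, Run w code P s s' k ∧ Q s' k

/-- Sequential composition of a list of programs. -/
def block : List Program → Program
  | [] => .skip
  | P :: l => .seq P (block l)

/-- The registers that a program may change. -/
def Program.wReg : Program → ℕ → Bool
  | .setReg x _, r => r == x
  | .seq P Q, r => P.wReg r || Q.wReg r
  | .ite _ P Q, r => P.wReg r || Q.wReg r
  | .loop _ P, r => P.wReg r
  | _, _ => false

/-- The word arrays that a program may change. -/
def Program.wMem : Program → ℕ → Bool
  | .setMem a _ _, r => r == a
  | .seq P Q, r => P.wMem r || Q.wMem r
  | .ite _ P Q, r => P.wMem r || Q.wMem r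
  | .loop _ P, r => P.wMem r
  | _, _ => false

/-- The character arrays that a program may change. -/
def Program.wChr : Program → ℕ → Bool
  | .copyChr a _ _ _, r => r == a
  | .seq P Q, r => P.wChr r || Q.wChr r
  | .ite _ P Q, r => P.wChr r || Q.wChr r
  | .loop _ P, r => P.wChr r
  | _, _ => false

/-- Two stores agree on everything that the program cannot change. -/
structure Frame {α : Type u} (P : Program) (s s' : Store α) : Prop where
  reg : ∀ r, P.wReg r = false → s'.reg r = s.reg r
  mem : ∀ a, P.wMem a = false → s'.mem a = s.mem a
  chr : ∀ a, P.wChr a = false → s'.chr a = s.chr a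

theorem Frame.rfl' {α : Type u} {P : Program} {s : Store α} : Frame P s s :=
  ⟨fun _ _ => rfl, fun _ _ => rfl, fun _ _ => rfl⟩

theorem Frame.trans {α : Type u} {P : Program} {s s' s'' : Store α} (h : Frame P s s')
    (h' : Frame P s' s'') : Frame P s s'' :=
  ⟨fun r hr => (h'.reg r hr).trans (h.reg r hr), fun r hr => (h'.mem r hr).trans (h.mem r hr),
    fun r hr => (h'.chr r hr).trans (h.chr r hr)⟩

/-- The write sets are computed from the syntax. For a concrete program the hypotheses of `Frame`
therefore hold by `rfl`, and invariants need not mention what stays fixed. -/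
theorem Run.frame {α : Type u} [LinearOrder α] {w : ℕ} {code : α → Option ℕ} {P : Program}
    {s s' : Store α} {k : ℕ} (h : Run w code P s s' k) : Frame P s s' := by
  induction h with
  | skip s => exact Frame.rfl'
  | setReg _ =>
    refine ⟨fun r hr => ?_, fun _ _ => rfl, fun _ _ => rfl⟩
    simp only [Program.wReg, beq_eq_false_iff_ne] at hr
    simp [Store.setReg, hr]
  | setMem _ _ =>
    refine ⟨fun _ _ => rfl, fun r hr => ?_, fun _ _ => rfl⟩
    simp only [Program.wMem, beq_eq_false_iff_ne] at hr
    simp [Store.setMem, hr]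
  | copyChr _ _ _ =>
    refine ⟨fun _ _ => rfl, fun _ _ => rfl, fun r hr => ?_⟩
    simp only [Program.wChr, beq_eq_false_iff_ne] at hr
    simp [Store.setChr, hr]
  | seq _ _ h h' =>
    constructor <;> intro r hr <;>
      simp only [Program.wReg, Program.wMem, Program.wChr, Bool.or_eq_false_iff] at hr
    · exact (h'.reg r hr.2).trans (h.reg r hr.1)
    · exact (h'.mem r hr.2).trans (h.mem r hr.1)
    · exact (h'.chr r hr.2).trans (h.chr r hr.1)
  | ite_true _ _ h =>
    constructor <;> intro r hr <;>
      simp only [Program.wReg, Program.wMem, Program.wChr, Bool.or_eq_false_iff] at hr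
    · exact h.reg r hr.1
    · exact h.mem r hr.1
    · exact h.chr r hr.1
  | ite_false _ _ h =>
    constructor <;> intro r hr <;>
      simp only [Program.wReg, Program.wMem, Program.wChr, Bool.or_eq_false_iff] at hr
    · exact h.reg r hr.2
    · exact h.mem r hr.2
    · exact h.chr r hr.2
  | loop_true _ _ _ h h' => exact Frame.trans ⟨h.reg, h.mem, h.chr⟩ h'
  | loop_false _ => exact Frame.rfl'

variable {α : Type u} [LinearOrder α] {w : ℕ} {code : α → Option ℕ} {s : Store α}
  {Q : Store α → ℕ → Prop}

/-- The consequence rule also hands over the frame condition of the run, so specifications of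
subprograms can omit it. -/
theorem WP.mono {P : Program} {Q' : Store α → ℕ → Prop} (h : WP w code P s Q')
    (hQ : ∀ s' k, Frame P s s' → Q' s' k → Q s' k) : WP w code P s Q := by
  obtain ⟨s', k, h1, h2⟩ := h
  exact ⟨s', k, h1, hQ s' k h1.frame h2⟩

theorem wp_block_nil : WP w code (block []) s Q ↔ Q s 1 := by
  constructor
  · rintro ⟨s', k, h1, h2⟩
    cases h1
    exact h2
  · exact fun h => ⟨s, 1, Run.skip s, h⟩

theorem wp_skip : WP w code .skip s Q ↔ Q s 1 := wp_block_nil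

theorem wp_seq {P P' : Program} : WP w code (.seq P P') s Q ↔
    WP w code P s fun s' k => WP w code P' s' fun s'' l => Q s'' (k + l) := by
  constructor
  · rintro ⟨s', k, h1, h2⟩
    cases h1 with
    | seq h h' => exact ⟨_, _, h, _, _, h', h2⟩
  · rintro ⟨_, _, h, _, _, h', h2⟩
    exact ⟨_, _, Run.seq h h', h2⟩

theorem wp_block_cons {P : Program} {l : List Program} : WP w code (block (P :: l)) s Q ↔
    WP w code P s fun s' k => WP w code (block l) s' fun s'' l => Q s'' (k + l) := wp_seq

theorem wp_setReg {x : ℕ} {e : Expr} : WP w code (.setReg x e) s Q ↔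
    e.ok w code s ∧ Q (s.setReg x (e.val code s)) (e.cost + 1) := by
  constructor
  · rintro ⟨s', k, h1, h2⟩
    cases h1 with
    | setReg h =>
      obtain ⟨g, rfl⟩ := e.eval_eq_some.1 h
      exact ⟨g, h2⟩
  · rintro ⟨h, h2⟩
    exact ⟨_, _, Run.setReg (e.eval_eq_some.2 ⟨h, rfl⟩), h2⟩

theorem wp_setMem {a : ℕ} {e f : Expr} : WP w code (.setMem a e f) s Q ↔
    e.ok w code s ∧ f.ok w code s ∧
      Q (s.setMem a (e.val code s) (f.val code s)) (e.cost + f.cost + 1) := by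
  constructor
  · rintro ⟨s', k, h1, h2⟩
    cases h1 with
    | setMem h h' =>
      obtain ⟨g, rfl⟩ := e.eval_eq_some.1 h
      obtain ⟨g', rfl⟩ := f.eval_eq_some.1 h'
      exact ⟨g, g', h2⟩
  · rintro ⟨h, h', h2⟩
    exact ⟨_, _, Run.setMem (e.eval_eq_some.2 ⟨h, rfl⟩) (f.eval_eq_some.2 ⟨h', rfl⟩), h2⟩

theorem wp_copyChr {a b : ℕ} {e f : Expr} : WP w code (.copyChr a e b f) s Q ↔
    e.ok w code s ∧ f.ok w code s ∧ ∃ c, s.chr b (f.val code s) = some c ∧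
      Q (s.setChr a (e.val code s) c) (e.cost + f.cost + 1) := by
  constructor
  · rintro ⟨s', k, h1, h2⟩
    cases h1 with
    | copyChr h h' h'' =>
      obtain ⟨g, rfl⟩ := e.eval_eq_some.1 h
      obtain ⟨g', rfl⟩ := f.eval_eq_some.1 h'
      exact ⟨g, g', _, h'', h2⟩
  · rintro ⟨h, h', c, h'', h2⟩
    exact ⟨_, _, Run.copyChr (e.eval_eq_some.2 ⟨h, rfl⟩) (f.eval_eq_some.2 ⟨h', rfl⟩) h'', h2⟩

theorem wp_ite {t : Test} {P P' : Program} : WP w code (.ite t P P') s Q ↔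
    t.ok w code s ∧ (t.holds code s → WP w code P s fun s' k => Q s' (t.cost + k)) ∧
      (¬ t.holds code s → WP w code P' s fun s' k => Q s' (t.cost + k)) := by
  constructor
  · rintro ⟨s', k, h1, h2⟩
    cases h1 with
    | ite_true h h' =>
      have := t.eval_eq_some.1 h
      exact ⟨this.1, fun _ => ⟨_, _, h', h2⟩, fun h => absurd (this.2.1 rfl) h⟩
    | ite_false h h' =>
      have := t.eval_eq_some.1 h
      exact ⟨this.1, fun h => absurd (this.2.2 h) (by simp), fun _ => ⟨_, _, h', h2⟩⟩
  · rintro ⟨h, h1, h2⟩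
    by_cases ht : t.holds code s
    · obtain ⟨_, _, h3, h4⟩ := h1 ht
      exact ⟨_, _, Run.ite_true (t.eval_eq_some.2 ⟨h, by simp [ht]⟩) h3, h4⟩
    · obtain ⟨_, _, h3, h4⟩ := h2 ht
      exact ⟨_, _, Run.ite_false (t.eval_eq_some.2 ⟨h, by simp [ht]⟩) h3, h4⟩

/-- The rule for loops: `Inv s k` is an invariant of the store and the number of steps made so
far, `μ` decreases in every round. -/
theorem wp_loop {t : Test} {P : Program} (Inv : Store α → ℕ → Prop) (μ : Store α → ℕ)
    (h0 : Inv s 0)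
    (hs : ∀ s' k, Frame P s s' → Inv s' k → t.ok w code s' ∧
      (t.holds code s' →
        WP w code P s' fun s'' l => Inv s'' (k + (t.cost + l)) ∧ μ s'' < μ s') ∧
      (¬ t.holds code s' → Q s' (k + t.cost))) :
    WP w code (.loop t P) s Q := by
  suffices H : ∀ n s' k, μ s' = n → Frame P s s' → Inv s' k →
      ∃ s'' l, Run w code (.loop t P) s' s'' l ∧ Q s'' (k + l) by
    obtain ⟨s'', l, h1, h2⟩ := H _ s 0 rfl Frame.rfl' h0
    exact ⟨s'', l, h1, by simpa using h2⟩
  intro n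
  induction n using Nat.strong_induction_on with
  | _ n ih =>
    intro s' k hn hF hI
    obtain ⟨h1, h2, h3⟩ := hs s' k hF hI
    by_cases ht : t.holds code s'
    · obtain ⟨s1, l1, r1, i1, m1⟩ := h2 ht
      obtain ⟨s2, l2, r2, q2⟩ := ih (μ s1) (hn ▸ m1) s1 _ rfl (hF.trans r1.frame) i1
      refine ⟨s2, _, Run.loop_true (t.eval_eq_some.2 ⟨h1, by simp [ht]⟩) r1 r2, ?_⟩
      rwa [show k + (t.cost + l1 + l2) = k + (t.cost + l1) + l2 by ring]
    · exact ⟨s', _, Run.loop_false (t.eval_eq_some.2 ⟨h1, by simp [ht]⟩), h3 ht⟩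

end Calculus

/-! ### Reading a store after an assignment -/

section StoreLemmas

variable {α : Type u} (s : Store α)

theorem setReg_reg (x v y : ℕ) : (s.setReg x v).reg y = if y = x then v else s.reg y := by
  simp [Store.setReg, Function.update_apply]

theorem setReg_mem (x v : ℕ) : (s.setReg x v).mem = s.mem := rfl

theorem setReg_chr (x v : ℕ) : (s.setReg x v).chr = s.chr := rfl

theorem setMem_reg (a i v : ℕ) : (s.setMem a i v).reg = s.reg := rfl

theorem setMem_mem (a i v b : ℕ) : (s.setMem a i v).mem b =
    if b = a then Function.update (s.mem a) i v else s.mem b := by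
  simp [Store.setMem, Function.update_apply]

theorem setMem_chr (a i v : ℕ) : (s.setMem a i v).chr = s.chr := rfl

theorem setChr_reg (a i : ℕ) (c : α) : (s.setChr a i c).reg = s.reg := rfl

theorem setChr_mem (a i : ℕ) (c : α) : (s.setChr a i c).mem = s.mem := rfl

theorem setChr_chr (a i : ℕ) (c : α) (b : ℕ) : (s.setChr a i c).chr b =
    if b = a then Function.update (s.chr a) i (some c) else s.chr b := by
  simp [Store.setChr, Function.update_apply]

end StoreLemmas

attribute [simp] wp_block_nil wp_block_cons wp_skip wp_seq wp_setReg wp_setMem wp_copyChr wp_ite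
  setReg_reg setReg_mem setReg_chr setMem_reg setMem_mem setMem_chr setChr_reg setChr_mem setChr_chr
  Expr.ok Expr.val Expr.cost BinOp.eval Test.ok Test.holds Test.cost

/-! ### Order isomorphism of factors and the failure chain -/

section OrderIso

variable {α : Type u} [LinearOrder α] {p x y : ℕ → α} {b d j k m : ℕ} {pr su f : ℕ → ℕ}

/-- The prefix of length `k` of `p` is order-isomorphic to the factor of `x` of length `k` that
begins at position `b`. -/
def OI (p x : ℕ → α) (b k : ℕ) : Prop :=
  ∀ i < k, ∀ j < k, p i ≤ p j ↔ x (b + i) ≤ x (b + j)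

theorem OI.mono (h : OI p x b k) (hj : j ≤ k) : OI p x b j :=
  fun _ hi _ hi' => h _ (hi.trans_le hj) _ (hi'.trans_le hj)

theorem OI.zero : OI p x b 0 := fun _ hi => absurd hi (Nat.not_lt_zero _)

theorem OI.congr (h : OI p x b k) (hxy : ∀ i, b ≤ i → i < b + k → x i = y i) : OI p y b k := by
  intro i hi j hj
  rw [h i hi j hj, hxy _ (by omega) (by omega), hxy _ (by omega) (by omega)]

/-- The text is the intermediary: the shorter occurrence lies inside the longer one, so both
describe the same factor of `x`, and composing the two gives a relation inside `p`. -/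
theorem OI.border (h : OI p x b k) (h' : OI p x (b + d) j) (hd : d + j ≤ k) : OI p p d j := by
  intro i hi i' hi'
  rw [h' i hi i' hi', h (d + i) (by omega) (d + i') (by omega), Nat.add_assoc, Nat.add_assoc]

/-- The converse use of transitivity: falling back to a border keeps a valid occurrence in the text.
-/
theorem OI.trans_border (h : OI p x b k) (h' : OI p p d j) (hd : d + j ≤ k) :
    OI p x (b + d) j := by
  intro i hi i' hi'
  rw [h' i hi i' hi', h (d + i) (by omega) (d + i') (by omega), Nat.add_assoc, Nat.add_assoc]

/-- For every position `k < m`, `pr k` and `su k` are the positions before `k` of the order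
neighbours of the character of `p` at position `k`; the value `k` means that there is none. -/
def Neighbours (p : ℕ → α) (m : ℕ) (pr su : ℕ → ℕ) : Prop :=
  ∀ k < m, pr k ≤ k ∧ su k ≤ k ∧ p (pr k) ≤ p k ∧ p k ≤ p (su k) ∧
    ∀ q < k, (pr k < k ∧ p q ≤ p (pr k)) ∨ (su k < k ∧ p (su k) ≤ p q)

/-- The character of the text `x` at position `pos` has the same relations to the characters at
the places of the neighbours as the character of `p` at position `q`. -/
def Compat (p x : ℕ → α) (pr su : ℕ → ℕ) (q pos : ℕ) : Prop :=
  ((p (pr q) ≤ p q ↔ x (pos - q + pr q) ≤ x pos) ∧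
    (p q ≤ p (pr q) ↔ x pos ≤ x (pos - q + pr q))) ∧
  (p (su q) ≤ p q ↔ x (pos - q + su q) ≤ x pos) ∧
    (p q ≤ p (su q) ↔ x pos ≤ x (pos - q + su q))

/-- Every earlier character lies weakly below the predecessor or weakly above the successor, so its
relation to the new character follows from that of the neighbour by transitivity. Both directions of
`≤` are tested at each neighbour in order to detect ties. -/
theorem OI.succ_iff (hN : Neighbours p m pr su) (hk : k < m) (h : OI p x b k) :
    OI p x b (k + 1) ↔ Compat p x pr su k (b + k) := by
  obtain ⟨h1, h2, h3, h4, h5⟩ := hN k hk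
  unfold Compat
  rw [Nat.add_sub_cancel]
  constructor
  · intro g
    exact ⟨⟨g _ (by omega) _ (by omega), g _ (by omega) _ (by omega)⟩,
      g _ (by omega) _ (by omega), g _ (by omega) _ (by omega)⟩
  · rintro ⟨⟨c1, c2⟩, c3, c4⟩
    -- On the predecessor side the first equivalence has both sides true; the second can hold only
    -- if `q`, the predecessor and `k` carry equal characters, in pattern and text alike. The
    -- successor side is symmetric.
    have key : ∀ q < k, (p q ≤ p k ↔ x (b + q) ≤ x (b + k)) ∧
        (p k ≤ p q ↔ x (b + k) ≤ x (b + q)) := by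
      intro q hq
      rcases h5 q hq with ⟨g1, g2⟩ | ⟨g1, g2⟩
      · have e1 := h q hq _ g1
        have e2 := h _ g1 q hq
        rw [iff_true_left h3] at c1
        rw [iff_true_left g2] at e1
        refine ⟨iff_of_true (g2.trans h3) (e1.trans c1), ?_⟩
        constructor
        · intro g
          exact (c2.1 (g.trans g2)).trans (e2.1 (h3.trans g))
        · intro g
          exact (c2.2 (g.trans e1)).trans (e2.2 (c1.trans g))
      · have e1 := h q hq _ g1
        have e2 := h _ g1 q hq
        rw [iff_true_left h4] at c4
        rw [iff_true_left g2] at e2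
        refine ⟨?_, iff_of_true (h4.trans g2) (c4.trans e2)⟩
        constructor
        · intro g
          exact (e1.1 (g.trans h4)).trans (c3.1 (g2.trans g))
        · intro g
          exact (e1.2 (g.trans c4)).trans (c3.2 (e2.trans g))
    intro i hi j hj
    rcases Nat.lt_succ_iff_lt_or_eq.1 hi with hi | rfl <;>
      rcases Nat.lt_succ_iff_lt_or_eq.1 hj with hj | rfl
    · exact h i hi j hj
    · exact (key i hi).1
    · exact (key j hj).2
    · simp

/-- `f k` is the length of the longest proper border of the prefix of `p` of length `k`, for
`1 ≤ k ≤ m`. -/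
def IsFailure (p : ℕ → α) (f : ℕ → ℕ) (m : ℕ) : Prop :=
  ∀ k, 1 ≤ k → k ≤ m → f k < k ∧ OI p p (k - f k) (f k) ∧ ∀ j < k, OI p p (k - j) j → j ≤ f k

theorem IsFailure.mono (h : IsFailure p f m) (hj : j ≤ m) : IsFailure p f j :=
  fun k h1 h2 => h k h1 (h2.trans hj)

end OrderIso

/-! ### Following the failure function, with a cut by height -/

section Chain

/-- The test that two tests agree. -/
def Test.iff (t t' : Test) : Test := .and (.not (.and t (.not t'))) (.not (.and t' (.not t)))

/-- The test `Compat` for the text in the character array `a`; the pattern is in the character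
array `0`, the neighbours in the word arrays `11` and `12`, `q` and `pos` in the registers `3`
and `4`. -/
def compatTest (a : ℕ) : Test :=
  let text (b : ℕ) : Expr := .bin .add (.bin .sub (.reg 4) (.reg 3)) (.load b (.reg 3))
  let agree (b : ℕ) : Test := .and
    (.iff (.chrLe 0 (.load b (.reg 3)) 0 (.reg 3)) (.chrLe a (text b) a (.reg 4)))
    (.iff (.chrLe 0 (.reg 3) 0 (.load b (.reg 3))) (.chrLe a (.reg 4) a (text b)))
  .and (agree 11) (agree 12)

/-- Follow the failure function in the word array `13` from the state in register `3` until the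
text in the character array `a` can be extended by the position in register `4`; give up as soon
as the state plus register `5` is below the length of the pattern. -/
def chain (a : ℕ) : Program :=
  .loop (.not (compatTest a)) (block [
    .setReg 3 (.load 13 (.reg 3)),
    .ite (.lt (.bin .add (.bin .add (.reg 3) (.const 1)) (.reg 5)) (.reg 0))
      (.setReg 3 (.const 0)) .skip])

@[simp] theorem Test.ok_iff {α : Type u} {w : ℕ} {code : α → Option ℕ} {s : Store α}
    (t t' : Test) : (Test.iff t t').ok w code s ↔ t.ok w code s ∧ t'.ok w code s := by
  simp [Test.iff, and_comm]

variable {α : Type u} [LinearOrder α] {w : ℕ} {code : α → Option ℕ} {s : Store α}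

@[simp] theorem Test.holds_iff (t t' : Test) :
    (Test.iff t t').holds code s ↔ (t.holds code s ↔ t'.holds code s) := by
  simp [Test.iff, iff_def]

theorem compatTest_ok_holds {p x : ℕ → α} {a q pos m : ℕ} (hq : s.reg 3 = q) (hpos : s.reg 4 = pos)
    (hp : ∀ i < m, s.chr 0 i = some (p i)) (hx : ∀ i ≤ pos, s.chr a i = some (x i))
    (hqm : q < m) (hqp : q ≤ pos) (hN : Neighbours p m (s.mem 11) (s.mem 12))
    (hw : pos < wordBound w) :
    (compatTest a).ok w code s ∧
      ((compatTest a).holds code s ↔ Compat p x (s.mem 11) (s.mem 12) q pos) := by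
  obtain ⟨h1, h2, -⟩ := hN q hqm
  have e1 := hp q hqm
  have e2 := hp (s.mem 11 q) (by omega)
  have e3 := hp (s.mem 12 q) (by omega)
  have e4 := hx pos le_rfl
  have e5 := hx (pos - q + s.mem 11 q) (by omega)
  have e6 := hx (pos - q + s.mem 12 q) (by omega)
  constructor
  · simp [compatTest, hq, hpos, e1, e2, e3, e4, e5, e6]
    omega
  · simp [compatTest, hq, hpos, e1, e2, e3, e4, e5, e6, Compat]

/-- At position `0` both neighbours are `0` itself, so each condition compares a character with
itself. This makes state `0` always stop the failure chain. -/
theorem compat_zero {p x : ℕ → α} {pr su : ℕ → ℕ} {m pos : ℕ} (hN : Neighbours p m pr su)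
    (hm : 0 < m) : Compat p x pr su 0 pos := by
  obtain ⟨h1, h2, -⟩ := hN 0 hm
  simp [Compat, Nat.le_zero.1 h1, Nat.le_zero.1 h2]

/-- The number `F` of failure steps is paid for by the drop of `state + 1 + h - m`, plus one step
for a possible jump to `0`. Maximality is claimed only for lengths that can still reach `m` within
height `h`; `B` bounds the candidates, so that the same lemma serves the pattern as its own text. -/
theorem wp_chain {p x : ℕ → α} {a q pos m h B : ℕ} (hB : B ≤ pos) (hm : s.reg 0 = m) (hq : s.reg 3 = q)
    (hpos : s.reg 4 = pos) (hh : s.reg 5 = h)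
    (hp : ∀ i < m, s.chr 0 i = some (p i)) (hx : ∀ i ≤ pos, s.chr a i = some (x i))
    (hqm : q < m) (hqp : q ≤ pos) (hN : Neighbours p m (s.mem 11) (s.mem 12))
    (hF : IsFailure p (s.mem 13) q) (hoi : OI p x (pos - q) q)
    (hmax : ∀ k < m, k ≤ B → m ≤ k + 1 + h → OI p x (pos - k) (k + 1) → k ≤ q)
    (hw : pos + m + h + 1 < wordBound w) :
    WP w code (chain a) s fun s' l => s'.reg 3 ≤ q ∧ OI p x (pos - s'.reg 3) (s'.reg 3 + 1) ∧
      (∀ k < m, k ≤ B → m ≤ k + 1 + h → OI p x (pos - k) (k + 1) → k ≤ s'.reg 3) ∧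
      ∃ F, l ≤ 400 * F + 400 ∧ F + (s'.reg 3 + 1 + h - m) ≤ (q + 1 + h - m) + 1 := by
  -- The extra unit at state `0` pays for the cut, which may leave the truncated potential
  -- unchanged. It is spent at most once, because the chain stops at `0`.
  refine wp_loop (fun s' k => s'.reg 3 ≤ q ∧ OI p x (pos - s'.reg 3) (s'.reg 3) ∧
    (∀ k < m, k ≤ B → m ≤ k + 1 + h → OI p x (pos - k) (k + 1) → k ≤ s'.reg 3) ∧
    ∃ F, k ≤ 400 * F ∧ F + (s'.reg 3 + 1 + h - m) ≤
      (q + 1 + h - m) + if s'.reg 3 = 0 then 1 else 0) (fun s' => s'.reg 3)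
    ⟨hq.le, by rwa [hq], by rwa [hq], 0, by simp, by simp [hq]⟩ ?_
  rintro s' k hFr ⟨i1, i2, i3, F, i4, i5⟩
  have r0 : s'.reg 0 = m := (hFr.reg 0 rfl).trans hm
  have r4 : s'.reg 4 = pos := (hFr.reg 4 rfl).trans hpos
  have r5 : s'.reg 5 = h := (hFr.reg 5 rfl).trans hh
  have c0 : s'.chr = s.chr := funext fun b => hFr.chr b rfl
  have m0 : s'.mem = s.mem := funext fun b => hFr.mem b rfl
  obtain ⟨hok, hho⟩ := compatTest_ok_holds (w := w) (code := code) (s := s') (p := p) (x := x)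
    (a := a) (m := m) rfl r4 (by rwa [c0]) (by rwa [c0]) (by omega) (by omega) (by rwa [m0])
    (by omega)
  rw [m0] at hho
  have hsucc := OI.succ_iff hN (show s'.reg 3 < m by omega) i2
  rw [show pos - s'.reg 3 + s'.reg 3 = pos by omega, ← hho] at hsucc
  refine ⟨hok, fun hne => ?_, fun hcomp => ?_⟩
  · have hne' : ¬ Compat p x (s.mem 11) (s.mem 12) (s'.reg 3) pos := fun hc => hne (hho.2 hc)
    have h0 : s'.reg 3 ≠ 0 := by
      intro h0
      rw [h0] at hne'
      exact hne' (compat_zero hN (by omega))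
    obtain ⟨f1, f2, f3⟩ := hF (s'.reg 3) (by omega) i1
    have hcost : (compatTest a).cost ≤ 300 := by simp [compatTest, Test.iff]

    -- A candidate below the current state is a proper border of that prefix, hence at most its
    -- failure value; the state itself is excluded because the test has just failed.
    have hall : ∀ k < m, k ≤ B → m ≤ k + 1 + h → OI p x (pos - k) (k + 1) →
        k ≤ s.mem 13 (s'.reg 3) := by
      intro k hk hkp hkh hko
      have hk3 := i3 k hk hkp hkh hko
      rcases hk3.lt_or_eq with hlt | rfl
      · refine f3 k hlt (i2.border (d := s'.reg 3 - k) ?_ (by omega))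
        rw [show pos - s'.reg 3 + (s'.reg 3 - k) = pos - k by omega]
        exact hko.mono (Nat.le_succ k)
      · exact absurd (hsucc.1 hko) hne
    rw [if_neg h0] at i5
    simp only [wp_block_cons, wp_block_nil, wp_setReg, wp_ite, wp_skip, Expr.ok, Expr.val,
      Test.ok, Test.holds, BinOp.eval, setReg_reg, if_true, r0, r5, m0,
      Expr.cost, Test.cost]
    simp only [show (0 : ℕ) ≠ 3 by decide, show (5 : ℕ) ≠ 3 by decide, if_false]
    refine ⟨trivial, ⟨⟨⟨trivial, by omega, by omega⟩, trivial, by omega⟩, trivial⟩, ?_, ?_⟩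
    -- All candidates are at most the failure value, which is already too short to reach `m` within
    -- the remaining height. So none is left, and maximality at `0` is vacuous.
    · intro hcut
      refine ⟨by omega, ⟨by omega, OI.zero, ?_, F + 1, by omega, ?_⟩, by omega⟩
      · intro k hk hkp hkh hko
        have := hall k hk hkp hkh hko
        omega
      · omega
    · intro hcut
      refine ⟨⟨by omega, ?_, hall, F + 1, by omega, ?_⟩, f1⟩
      · have := i2.trans_border f2 (by omega)
        rwa [show pos - s'.reg 3 + (s'.reg 3 - s.mem 13 (s'.reg 3)) =
          pos - s.mem 13 (s'.reg 3) by omega] at this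
      · omega
  · refine ⟨i1, hsucc.2 (not_not.1 hcomp), i3, F, ?_, ?_⟩
    · have hcost : (compatTest a).cost ≤ 300 := by simp [compatTest, Test.iff]
      simp only [Test.cost]
      omega
    · split at i5 <;> omega

end Chain

/-! ### Failure function and order neighbours of the pattern -/

section Preprocessing

/-- Computation of the failure function of the pattern. -/
def failurePhase : Program :=
  block [
    .setMem 13 (.const 1) (.const 0),
    .setReg 6 (.const 1),
    .setReg 5 (.reg 0),
    .loop (.lt (.reg 6) (.reg 0)) (block [
      .setReg 3 (.load 13 (.reg 6)),
      .setReg 4 (.reg 6),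
      chain 0,
      .setReg 6 (.bin .add (.reg 6) (.const 1)),
      .setMem 13 (.reg 6) (.bin .add (.reg 3) (.const 1))])]

variable {α : Type u} [LinearOrder α] {w : ℕ} {code : α → Option ℕ} {s : Store α}

/-- The pattern is matched against itself. Register `5` is set to `m`, which is so large that the
cut never happens. The linear bound is the classical amortization with the current border length as
potential. -/
theorem wp_failurePhase {p : ℕ → α} {m : ℕ} (hm : s.reg 0 = m) (hm1 : 1 ≤ m)
    (hp : ∀ i < m, s.chr 0 i = some (p i)) (hN : Neighbours p m (s.mem 11) (s.mem 12))
    (hw : 3 * m + 1 < wordBound w) :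
    WP w code failurePhase s fun s' l => IsFailure p (s'.mem 13) m ∧ l ≤ 3000 * m := by
  simp only [failurePhase, wp_block_cons, wp_setMem, wp_setReg, Expr.ok, Expr.val, setMem_reg,
    setReg_reg, Expr.cost, wp_block_nil]
  refine ⟨by omega, by omega, by omega, trivial, wp_loop (fun s' k => s'.reg 5 = m ∧
    1 ≤ s'.reg 6 ∧ s'.reg 6 ≤ m ∧ IsFailure p (s'.mem 13) (s'.reg 6) ∧
    k + 400 * s'.mem 13 (s'.reg 6) ≤ 2000 * s'.reg 6) (fun s' => m - s'.reg 6) ?_ ?_⟩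
  · refine ⟨by simp [hm], by simp, by simpa, ?_, by simp⟩
    intro k h1 h2
    simp at h2
    obtain rfl : k = 1 := by omega
    refine ⟨by simp, by simpa using OI.zero, fun j hj _ => by simp; omega⟩
  · rintro s' k hFr ⟨i1, i2, i3, i4, i5⟩
    have r0 : s'.reg 0 = m := (hFr.reg 0 rfl).trans (by simp [hm])
    have c0 : s'.chr = s.chr := funext fun b => hFr.chr b rfl
    have m11 : s'.mem 11 = s.mem 11 := (hFr.mem 11 rfl).trans (by simp)
    have m12 : s'.mem 12 = s.mem 12 := (hFr.mem 12 rfl).trans (by simp)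
    refine ⟨by simp, ?_, ?_⟩
    · intro hlt
      simp only [Test.holds, Expr.val, r0] at hlt
      obtain ⟨f1, f2, f3⟩ := i4 _ i2 le_rfl
      simp only [wp_block_cons, wp_setMem, wp_setReg, Expr.ok, Expr.val, setMem_reg,
        setReg_reg, Expr.cost, wp_block_nil]
      refine ⟨trivial, trivial, (wp_chain (p := p) (x := p) (q := s'.mem 13 (s'.reg 6))
        (pos := s'.reg 6) (m := m) (h := m) (B := s'.reg 6 - 1) (by omega) ?_ ?_ ?_ ?_ ?_ ?_
          ?_ ?_ ?_ ?_ ?_ ?_ ?_).mono ?_⟩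
      · simp [r0]
      · simp
      · simp
      · simp [i1]
      · simpa [c0]
      · simpa [c0] using fun i hi => hp i (by omega)
      · omega
      · omega
      · simpa [m11, m12]
      · simpa using i4.mono f1.le
      · exact f2
      · intro k hk hkB _ hoi
        exact f3 k (by omega) (hoi.mono (Nat.le_succ k))
      · omega
      · rintro s2 l hFr2 ⟨g1, g2, g3, F, g4, g5⟩
        have e6 : s2.reg 6 = s'.reg 6 := (hFr2.reg 6 rfl).trans (by simp)
        have e5 : s2.reg 5 = m := (hFr2.reg 5 rfl).trans (by simp [i1])
        have e13 : s2.mem 13 = s'.mem 13 := (hFr2.mem 13 rfl).trans (by simp)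
        simp only [e6, if_true, BinOp.eval, setReg_mem, setMem_mem, e13, Function.update_self,
          show (5 : ℕ) ≠ 6 by decide, show (3 : ℕ) ≠ 6 by decide, if_false, e5, Test.cost,
          Expr.cost]
        refine ⟨⟨trivial, by omega, by omega⟩, trivial, ⟨trivial, by omega, by omega⟩,
          ⟨trivial, by omega, by omega, ?_, by omega⟩, by omega⟩
        intro j hj1 hj2
        rcases hj2.lt_or_eq with hlt' | rfl
        · rw [Function.update_of_ne hlt'.ne]
          exact i4 j hj1 (by omega)
        · rw [Function.update_self]
          refine ⟨by omega, by rwa [Nat.add_sub_add_right], fun j hj hjo => ?_⟩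
          rcases j with _ | j
          · omega
          · rw [Nat.add_sub_add_right] at hjo
            have := g3 j (by omega) (by omega) (by omega) hjo
            omega
    · intro hge
      simp only [Test.holds, Expr.val, r0, not_lt] at hge
      obtain rfl : m = s'.reg 6 := by omega
      refine ⟨i4, ?_⟩
      simp only [Test.cost, Expr.cost]
      omega

/-- The values of `ord` at `0, …, m - 1` are the positions `0, …, m - 1` in an order in which
the characters of `p` are nondecreasing. -/
structure IsSorting (p : ℕ → α) (m : ℕ) (ord : ℕ → ℕ) : Prop where
  lt : ∀ r < m, ord r < m
  inj : ∀ r < m, ∀ r' < m, ord r = ord r' → r = r'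
  surj : ∀ k < m, ∃ r < m, ord r = k
  mono : ∀ r r', r ≤ r' → r' < m → p (ord r) ≤ p (ord r')

/-- The links `L` and `R` join the ranks `r`, counted from `1`, of the positions below `k` into a
doubly linked list; `0` and `m + 1` are sentinels. -/
structure IsLinked (m : ℕ) (ord L R : ℕ → ℕ) (k : ℕ) : Prop where
  left : ∀ r, 1 ≤ r → r ≤ m → ord (r - 1) < k → L r < r ∧ (L r ≠ 0 → ord (L r - 1) < k) ∧
    ∀ x, L r < x → x < r → k ≤ ord (x - 1)
  right : ∀ r, 1 ≤ r → r ≤ m → ord (r - 1) < k → r < R r ∧ R r ≤ m + 1 ∧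
    (R r ≤ m → ord (R r - 1) < k) ∧ ∀ x, r < x → x < R r → k ≤ ord (x - 1)

/-- Between `L r` and `R r` every rank other than `r` belongs to a position already deleted, so
linking these two ranks to each other skips exactly the rank of `k`. -/
theorem IsLinked.delete {p : ℕ → α} {m k r : ℕ} {ord L R : ℕ → ℕ} (hs : IsSorting p m ord)
    (h : IsLinked m ord L R (k + 1)) (hr1 : 1 ≤ r) (hrm : r ≤ m) (hr : ord (r - 1) = k) :
    IsLinked m ord (Function.update L (R r) (L r)) (Function.update R (L r) (R r)) k := by
  obtain ⟨a1, a2, a3⟩ := h.left r hr1 hrm (by omega)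
  obtain ⟨b1, b2, b3, b4⟩ := h.right r hr1 hrm (by omega)
  have hne : ∀ x, 1 ≤ x → x ≤ m → x ≠ r → ord (x - 1) ≠ k := by
    intro x hx hxm hxr he
    have := hs.inj (x - 1) (by omega) (r - 1) (by omega) (he.trans hr.symm)
    omega
  constructor
  · intro x hx1 hxm hx
    have hxr : x ≠ r := by rintro rfl; omega
    obtain ⟨c1, c2, c3⟩ := h.left x hx1 hxm (by omega)
    by_cases hxR : x = R r
    · subst hxR
      rw [Function.update_self]
      refine ⟨by omega, fun h0 => ?_, fun y hy1 hy2 => ?_⟩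
      · have := a2 h0
        have := hne (L r) (by omega) (by omega) (by omega)
        omega
      · rcases lt_trichotomy y r with hy | rfl | hy
        · have := a3 y hy1 hy
          omega
        · omega
        · have := b4 y hy hy2
          omega
    · rw [Function.update_of_ne hxR]
      -- Only `R r` can point left to `r`: a rank strictly between `r` and `R r` is already deleted,
      -- and beyond `R r` the link would have to skip the live rank `R r`.
      have hLx : L x ≠ r := by
        intro hLx
        by_cases hlt : x < R r
        · have := b4 x (by omega) hlt
          omega
        · have := c3 (R r) (by omega) (by omega)
          have := b3 (by omega)
          omega
      refine ⟨c1, fun h0 => ?_, fun y hy1 hy2 => ?_⟩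
      · have := c2 h0
        have := hne (L x) (by omega) (by omega) hLx
        omega
      · have := c3 y hy1 hy2
        omega
  · intro x hx1 hxm hx
    have hxr : x ≠ r := by rintro rfl; omega
    obtain ⟨c1, c2, c3, c4⟩ := h.right x hx1 hxm (by omega)
    by_cases hxL : x = L r
    · subst hxL
      rw [Function.update_self]
      refine ⟨by omega, b2, fun h0 => ?_, fun y hy1 hy2 => ?_⟩
      · have := b3 h0
        have := hne (R r) (by omega) (by omega) (by omega)
        omega
      · rcases lt_trichotomy y r with hy | rfl | hy
        · have := a3 y hy1 hy
          omega
        · omega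
        · have := b4 y hy hy2
          omega
    · rw [Function.update_of_ne hxL]
      have hRx : R x ≠ r := by
        intro hRx
        by_cases hlt : L r < x
        · have := a3 x hlt (by omega)
          omega
        · have := c4 (L r) (by omega) (by omega)
          have := a2 (by omega)
          omega
      refine ⟨c1, c2, fun h0 => ?_, fun y hy1 hy2 => ?_⟩
      · have := c3 h0
        have := hne (R x) (by omega) (by omega) hRx
        omega
      · have := c4 y hy1 hy2
        omega

/-- The list then holds exactly the positions up to `k` in sorted order, so a position below `k` has
its rank at or before the left neighbour of `r`, or at or after the right one. Ties may fall on
either side, as only weak inequalities are required. -/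
theorem IsLinked.neighbours {p : ℕ → α} {m k r : ℕ} {ord L R : ℕ → ℕ} (hs : IsSorting p m ord)
    (h : IsLinked m ord L R (k + 1)) (hr1 : 1 ≤ r) (hrm : r ≤ m) (hr : ord (r - 1) = k)
    {a b : ℕ} (ha : (L r = 0 ∧ a = k) ∨ (L r ≠ 0 ∧ a = ord (L r - 1)))
    (hb : (R r = m + 1 ∧ b = k) ∨ (R r ≠ m + 1 ∧ b = ord (R r - 1))) :
    a ≤ k ∧ b ≤ k ∧ p a ≤ p k ∧ p k ≤ p b ∧
      ∀ q < k, (a < k ∧ p q ≤ p a) ∨ (b < k ∧ p b ≤ p q) := by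
  obtain ⟨a1, a2, a3⟩ := h.left r hr1 hrm (by omega)
  obtain ⟨b1, b2, b3, b4⟩ := h.right r hr1 hrm (by omega)
  have hne : ∀ x, 1 ≤ x → x ≤ m → x ≠ r → ord (x - 1) ≠ k := by
    intro x hx hxm hxr he
    have := hs.inj (x - 1) (by omega) (r - 1) (by omega) (he.trans hr.symm)
    omega
  refine ⟨?_, ?_, ?_, ?_, fun q hq => ?_⟩
  · omega
  · omega
  · rcases ha with ⟨-, rfl⟩ | ⟨h0, rfl⟩
    · exact le_rfl
    · rw [← hr]
      exact hs.mono _ _ (by omega) (by omega)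
  · rcases hb with ⟨-, rfl⟩ | ⟨h0, rfl⟩
    · exact le_rfl
    · rw [← hr]
      exact hs.mono _ _ (by omega) (by omega)
  · have hqm : q < m := by
      have := hs.lt (r - 1) (by omega)
      omega
    obtain ⟨y, hy, rfl⟩ := hs.surj q hqm
    have hyr : y + 1 ≠ r := by
      rintro rfl
      simp at hr
      omega
    rcases Nat.lt_or_ge (y + 1) r with hlt | hge
    · left
      have hyL : y + 1 ≤ L r := by
        by_contra hc
        have := a3 (y + 1) (by omega) hlt
        simp at this
        omega
      rcases ha with ⟨h0, -⟩ | ⟨h0, rfl⟩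
      · omega
      · have := a2 h0
        have := hne (L r) (by omega) (by omega) (by omega)
        exact ⟨by omega, hs.mono _ _ (by omega) (by omega)⟩
    · right
      have hyR : R r ≤ y + 1 := by
        by_contra hc
        have := b4 (y + 1) (by omega) (by omega)
        simp at this
        omega
      rcases hb with ⟨h0, -⟩ | ⟨h0, rfl⟩
      · omega
      · have := b3 (by omega)
        have := hne (R r) (by omega) (by omega) (by omega)
        exact ⟨by omega, hs.mono _ _ (by omega) (by omega)⟩

/-- Computation of the order neighbours from the sorted positions in the word array `100`. -/
def neighbourPhase : Program :=
  block [
    .setReg 3 (.const 0),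
    .loop (.lt (.reg 3) (.reg 0)) (block [
      .setReg 4 (.load 100 (.reg 3)),
      .setReg 3 (.bin .add (.reg 3) (.const 1)),
      .setMem 8 (.reg 4) (.reg 3),
      .setMem 9 (.reg 3) (.bin .sub (.reg 3) (.const 1)),
      .setMem 10 (.reg 3) (.bin .add (.reg 3) (.const 1))]),
    .loop (.lt (.const 0) (.reg 3)) (block [
      .setReg 3 (.bin .sub (.reg 3) (.const 1)),
      .setReg 4 (.load 8 (.reg 3)),
      .setReg 5 (.load 9 (.reg 4)),
      .setReg 6 (.load 10 (.reg 4)),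
      .ite (.eq (.reg 5) (.const 0)) (.setMem 11 (.reg 3) (.reg 3))
        (.setMem 11 (.reg 3) (.load 100 (.bin .sub (.reg 5) (.const 1)))),
      .ite (.eq (.reg 6) (.bin .add (.reg 0) (.const 1))) (.setMem 12 (.reg 3) (.reg 3))
        (.setMem 12 (.reg 3) (.load 100 (.bin .sub (.reg 6) (.const 1)))),
      .setMem 10 (.reg 5) (.reg 6),
      .setMem 9 (.reg 6) (.reg 5)])]

/-- Positions are deleted from the last to the first; when `k` is about to go, the list consists of
the positions up to `k` and shows the neighbours of `k` directly, without any search. -/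
theorem wp_neighbourPhase {p : ℕ → α} {m : ℕ} (hm : s.reg 0 = m)
    (hs : IsSorting p m (s.mem 100)) (hw : m + 2 < wordBound w) :
    WP w code neighbourPhase s fun s' l => Neighbours p m (s'.mem 11) (s'.mem 12) ∧
      l ≤ 200 * m + 200 := by
  simp only [neighbourPhase, wp_block_cons, wp_setReg, Expr.ok, Expr.val, Expr.cost]
  refine ⟨by omega, wp_loop (fun s' k => s'.reg 3 ≤ m ∧ k ≤ 50 * s'.reg 3 ∧
    (∀ r < s'.reg 3, s'.mem 8 (s.mem 100 r) = r + 1) ∧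
    (∀ r, 1 ≤ r → r ≤ s'.reg 3 → s'.mem 9 r = r - 1 ∧ s'.mem 10 r = r + 1))
    (fun s' => m - s'.reg 3) ?_ ?_⟩
  · simp
    omega
  rintro s1 k1 hFr1 ⟨i1, i2, i3, i4⟩
  have r0 : s1.reg 0 = m := (hFr1.reg 0 rfl).trans (by simp [hm])
  have m100 : s1.mem 100 = s.mem 100 := (hFr1.mem 100 rfl).trans (by simp)
  refine ⟨by simp, ?_, ?_⟩
  · intro hlt
    simp only [Test.holds, Expr.val, r0] at hlt
    simp only [wp_block_cons, wp_setReg, wp_setMem, wp_block_nil, Expr.ok, Expr.val, BinOp.eval,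
      setReg_reg, setReg_mem, setMem_reg, setMem_mem, m100, Expr.cost, Test.cost]
    simp
    refine ⟨⟨by omega, by omega⟩, by omega, ⟨by omega, by omega⟩, ⟨by omega, by omega, ?_, ?_⟩,
      by omega⟩
    · intro r hr
      rcases hr.lt_or_eq with hr | rfl
      · rw [Function.update_of_ne, i3 r hr]
        intro he
        have := hs.inj _ (by omega) _ (by omega) he
        omega
      · simp
    · intro r hr1 hr
      rcases hr.lt_or_eq with hr | rfl
      · rw [Function.update_of_ne (by omega), Function.update_of_ne (by omega)]
        exact i4 r hr1 (by omega)
      · simp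
  · intro hge
    simp only [Test.holds, Expr.val, r0, not_lt] at hge
    have h3 : s1.reg 3 = m := by omega
    rw [h3] at i2 i3 i4
    refine wp_loop (fun s' k => s'.reg 3 ≤ m ∧ k ≤ 80 * (m - s'.reg 3) ∧
      IsLinked m (s.mem 100) (s'.mem 9) (s'.mem 10) (s'.reg 3) ∧
      ∀ k < m, s'.reg 3 ≤ k → s'.mem 11 k ≤ k ∧ s'.mem 12 k ≤ k ∧ p (s'.mem 11 k) ≤ p k ∧
        p k ≤ p (s'.mem 12 k) ∧ ∀ q < k, (s'.mem 11 k < k ∧ p q ≤ p (s'.mem 11 k)) ∨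
          (s'.mem 12 k < k ∧ p (s'.mem 12 k) ≤ p q)) (fun s' => s'.reg 3) ?_ ?_
    · refine ⟨by omega, by omega, ?_, fun k hk hk' => by omega⟩
      rw [h3]
      constructor
      · intro r hr1 hrm hr
        rw [(i4 r hr1 hrm).1]
        exact ⟨by omega, fun h0 => hs.lt _ (by omega), fun x _ _ => by omega⟩
      · intro r hr1 hrm hr
        rw [(i4 r hr1 hrm).2]
        exact ⟨by omega, by omega, fun h0 => hs.lt _ (by omega), fun x _ _ => by omega⟩
    · rintro s2 k2 hFr2 ⟨j1, j2, j3, j4⟩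
      have r0 : s2.reg 0 = m := (hFr2.reg 0 rfl).trans r0
      have m100 : s2.mem 100 = s.mem 100 := (hFr2.mem 100 rfl).trans m100
      have m8 : s2.mem 8 = s1.mem 8 := (hFr2.mem 8 rfl)
      refine ⟨by simp; omega, ?_, ?_⟩
      · intro hlt
        simp only [Test.holds, Expr.val] at hlt
        obtain ⟨r, hr, hrk⟩ := hs.surj (s2.reg 3 - 1) (by omega)
        have hrank : s2.mem 8 (s2.reg 3 - 1) = r + 1 := by rw [m8, ← hrk, i3 r hr]
        have e3 : s2.reg 3 = s2.reg 3 - 1 + 1 := by omega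
        rw [e3] at j3
        have hdel := j3.delete hs (r := r + 1) (by omega) (by omega) hrk
        have hnb := fun a b => j3.neighbours hs (r := r + 1) (a := a) (b := b) (by omega)
          (by omega) hrk
        obtain ⟨b1, b2, -⟩ := j3.right (r + 1) (by omega) (by omega) (by simp [hrk])
        obtain ⟨a1, -⟩ := j3.left (r + 1) (by omega) (by omega) (by simp [hrk])
        -- Stated for arbitrary updated arrays, so that the four branches, with either neighbour
        -- present or absent, share one argument.
        have hspec : ∀ A B : ℕ → ℕ, (∀ k, k ≠ s2.reg 3 - 1 → A k = s2.mem 11 k) →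
            (∀ k, k ≠ s2.reg 3 - 1 → B k = s2.mem 12 k) →
            ((s2.mem 9 (r + 1) = 0 ∧ A (s2.reg 3 - 1) = s2.reg 3 - 1) ∨ (s2.mem 9 (r + 1) ≠ 0 ∧
              A (s2.reg 3 - 1) = s.mem 100 (s2.mem 9 (r + 1) - 1))) →
            ((s2.mem 10 (r + 1) = m + 1 ∧ B (s2.reg 3 - 1) = s2.reg 3 - 1) ∨
              (s2.mem 10 (r + 1) ≠ m + 1 ∧
              B (s2.reg 3 - 1) = s.mem 100 (s2.mem 10 (r + 1) - 1))) →
            ∀ k < m, s2.reg 3 ≤ k + 1 → A k ≤ k ∧ B k ≤ k ∧ p (A k) ≤ p k ∧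
              p k ≤ p (B k) ∧ ∀ q < k, (A k < k ∧ p q ≤ p (A k)) ∨
                (B k < k ∧ p (B k) ≤ p q) := by
          intro A B hA hB hA' hB' k hk hk'
          by_cases hkk : k = s2.reg 3 - 1
          · subst hkk
            exact hnb _ _ hA' hB'
          · rw [hA k hkk, hB k hkk]
            exact j4 k hk (by omega)
        simp [hrank, m100, r0]
        refine ⟨⟨by omega, by omega⟩, by omega, ?_, ?_⟩
        · intro h5
          refine ⟨by omega, ?_, ?_⟩
          · intro h6
            exact ⟨⟨by omega, by omega, hdel, hspec _ _
              (fun k hk => by simp [hk]) (fun k hk => by simp [hk]) (by simp [h5])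
              (by simp [h6])⟩, by omega⟩
          · intro h6
            exact ⟨⟨by omega, by omega⟩, ⟨by omega, by omega, hdel, hspec _ _
              (fun k hk => by simp [hk]) (fun k hk => by simp [hk]) (by simp [h5])
              (by simp [h6])⟩, by omega⟩
        · intro h5
          refine ⟨⟨by omega, by omega⟩, by omega, ?_, ?_⟩
          · intro h6
            exact ⟨⟨by omega, by omega, hdel, hspec _ _
              (fun k hk => by simp [hk]) (fun k hk => by simp [hk]) (by simp [h5])
              (by simp [h6])⟩, by omega⟩
          · intro h6
            exact ⟨⟨by omega, by omega⟩, ⟨by omega, by omega, hdel, hspec _ _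
              (fun k hk => by simp [hk]) (fun k hk => by simp [hk]) (by simp [h5])
              (by simp [h6])⟩, by omega⟩
      · intro hge
        simp only [Test.holds, Expr.val, not_lt] at hge
        rw [wp_block_nil]
        refine ⟨fun k hk => j4 k hk (by omega), ?_⟩
        simp only [Test.cost, Expr.cost]
        omega

end Preprocessing

/-! ### A preorder of the tree -/

section Shape

/-- A rooted tree on `0, …, N - 1` given by parent pointers and depths. -/
structure TreeShape (N root : ℕ) (par dep : ℕ → ℕ) : Prop where
  root_lt : root < N
  par_root : par root = root
  dep_root : dep root = 0
  par_lt : ∀ v < N, par v < N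
  dep_par : ∀ v < N, v ≠ root → dep v = dep (par v) + 1

/-- `a` is an ancestor of `v`, or `v` itself. -/
def Anc (par : ℕ → ℕ) (a v : ℕ) : Prop := ∃ j, par^[j] v = a

variable {N root : ℕ} {par dep : ℕ → ℕ}

theorem Anc.refl (v : ℕ) : Anc par v v := ⟨0, rfl⟩

theorem Anc.par_self (v : ℕ) : Anc par (par v) v := ⟨1, rfl⟩

theorem Anc.trans {a b c : ℕ} (h : Anc par a b) (h' : Anc par b c) : Anc par a c := by
  obtain ⟨i, rfl⟩ := h
  obtain ⟨j, rfl⟩ := h'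
  exact ⟨i + j, Function.iterate_add_apply ..⟩

theorem Anc.eq_or {a v : ℕ} (h : Anc par a v) : a = v ∨ Anc par a (par v) := by
  obtain ⟨j, rfl⟩ := h
  rcases j with _ | j
  · exact Or.inl rfl
  · exact Or.inr ⟨j, rfl⟩

/-- The list `l` leads from `a` to `b` in steps that satisfy `R`. -/
def Seg (R : ℕ → ℕ → Prop) : ℕ → List ℕ → ℕ → Prop
  | a, [], b => R a b
  | a, c :: l, b => R a c ∧ Seg R c l b

theorem Seg.append {R : ℕ → ℕ → Prop} {b c : ℕ} {l' : List ℕ} (h' : Seg R c l' b) :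
    ∀ {a : ℕ} {l : List ℕ}, Seg R a l c → Seg R a (l ++ c :: l') b
  | _, [], h => ⟨h, h'⟩
  | _, _ :: _, h => ⟨h.1, h'.append h.2⟩

theorem Seg.imp {R R' : ℕ → ℕ → Prop} {b : ℕ} : ∀ {a : ℕ} {l : List ℕ}, Seg R a l b →
    (∀ x ∈ a :: l, ∀ y, R x y → R' x y) → Seg R' a l b
  | a, [], h, hR => hR a (by simp) _ h
  | a, c :: l, h, hR => ⟨hR a (by simp) _ h.1, h.2.imp fun x hx => hR x (List.mem_cons_of_mem _ hx)⟩

theorem Seg.exists_fun {R : ℕ → ℕ → Prop} {b : ℕ} : ∀ {a : ℕ} {l : List ℕ}, Seg R a l b →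
    ∃ f : ℕ → ℕ, f 0 = a ∧ f (l.length + 1) = b ∧ (∀ i ≤ l.length, R (f i) (f (i + 1))) ∧
      (List.range (l.length + 1)).map f = a :: l
  | a, [], h => ⟨fun i => if i = 0 then a else b, by simp, by simp, by simp; exact h, by simp⟩
  | a, c :: l, h => by
    obtain ⟨f, h1, h2, h3, h4⟩ := h.2.exists_fun
    refine ⟨fun i => if i = 0 then a else f (i - 1), by simp, by simpa using h2, ?_, ?_⟩
    · rintro (_ | i) hi
      · simpa [h1] using h.1
      · simpa using h3 i (by simpa using hi)
    · rw [List.length_cons, List.range_succ_eq_map, List.map_cons, List.map_map]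
      simpa [Function.comp_def] using h4

/-- The relation between consecutive nodes of the list `nxt`, in which `N` marks the end. -/
def PreStep (N : ℕ) (par nxt : ℕ → ℕ) (x y : ℕ) : Prop :=
  nxt x = y ∧ (y = N ∨ Anc par (par y) x)

/-- Splices the nodes `C` in right after `x`. The hypothesis on `C` assumes only that the old
successor of `x` was admissible there, which is what the list itself supplies. -/
theorem Seg.insert {nxt g : ℕ → ℕ} {x : ℕ} {C : List ℕ}
    (hC : (nxt x = N ∨ Anc par (par (nxt x)) x) → Seg (PreStep N par g) x C (nxt x))
    (hg : ∀ z, z ≠ x → z ∉ C → g z = nxt z) :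
    ∀ {a : ℕ} {l : List ℕ}, Seg (PreStep N par nxt) a l N → x ∈ a :: l → (a :: l).Nodup →
      (∀ c ∈ C, c ∉ a :: l) →
      ∃ l', Seg (PreStep N par g) a l' N ∧ (a :: l').Perm ((a :: l) ++ C) := by
  intro a l
  induction l generalizing a with
  | nil =>
    intro h hx _ _
    obtain rfl : x = a := by simpa using hx
    refine ⟨C, ?_, by simp⟩
    have := hC (by rw [h.1]; exact h.2)
    rwa [h.1] at this
  | cons c l ih =>
    intro h hx hn hd
    by_cases hxa : x = a
    · subst hxa
      refine ⟨C ++ c :: l, Seg.append (h.2.imp ?_) ?_, ?_⟩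
      · rintro y hy z ⟨h1, h2⟩
        refine ⟨?_, h2⟩
        rw [hg y, h1]
        · rintro rfl
          exact (List.nodup_cons.1 hn).1 hy
        · exact fun hyC => hd y hyC (List.mem_cons_of_mem _ hy)
      · have := hC (by rw [h.1.1]; exact h.1.2)
        rwa [h.1.1] at this
      · exact (List.perm_append_comm (l₁ := C) (l₂ := c :: l)).cons x
    · obtain ⟨l', h1, h2⟩ := ih h.2 ((List.mem_cons.1 hx).resolve_left hxa)
        (List.nodup_cons.1 hn).2 fun y hy hy' => hd y hy (List.mem_cons_of_mem _ hy')
      refine ⟨c :: l', ⟨⟨?_, h.1.2⟩, h1⟩, h2.cons a⟩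
      rw [hg a (Ne.symm hxa) fun haC => hd a haC (by simp), h.1.1]

/-- `ord` lists the nodes such that the parent of every node is an ancestor of the node listed
before it, or that node itself. -/
structure IsPreorder (N root : ℕ) (par ord : ℕ → ℕ) : Prop where
  zero : ord 0 = root
  lt : ∀ i < N, ord i < N
  inj : ∀ i < N, ∀ j < N, ord i = ord j → i = j
  surj : ∀ v < N, ∃ i < N, ord i = v
  anc : ∀ i, i + 1 < N → Anc par (par (ord (i + 1))) (ord i)

/-- Ancestors come first: a proper ancestor of a listed node is an ancestor of its parent, hence of
the node listed just before, or that node itself, and induction applies. -/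
theorem IsPreorder.exists_of_anc {ord : ℕ → ℕ} (hT : TreeShape N root par dep)
    (h : IsPreorder N root par ord) {i a : ℕ} (hi : i < N) (ha : Anc par a (ord i)) :
    ∃ j ≤ i, ord j = a := by
  induction i generalizing a with
  | zero =>
    obtain ⟨k, rfl⟩ := ha
    rw [h.zero, Function.iterate_fixed hT.par_root]
    exact ⟨0, le_rfl, h.zero⟩
  | succ i ih =>
    rcases ha.eq_or with rfl | ha
    · exact ⟨i + 1, le_rfl, rfl⟩
    · obtain ⟨j, hj, rfl⟩ := ih (by omega) (ha.trans (h.anc i hi))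
      exact ⟨j, by omega, rfl⟩

theorem IsPreorder.ne_root {ord : ℕ → ℕ} (h : IsPreorder N root par ord) {i : ℕ}
    (hi : i + 1 < N) : ord (i + 1) ≠ root := by
  intro he
  have := h.inj (i + 1) hi 0 (by omega) (he.trans h.zero.symm)
  omega

theorem IsPreorder.exists_par {ord : ℕ → ℕ} (hT : TreeShape N root par dep)
    (h : IsPreorder N root par ord) {i : ℕ} (hi : i + 1 < N) :
    ∃ j ≤ i, ord j = par (ord (i + 1)) :=
  h.exists_of_anc hT (by omega) (h.anc i hi)

theorem isPreorder_of_seg {nxt ord : ℕ → ℕ} {l : List ℕ} (h : Seg (PreStep N par nxt) root l N)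
    (hn : (root :: l).Nodup) (hl : ∀ x, x ∈ root :: l ↔ x < N)
    (ho : ∀ i ≤ l.length, ord i = nxt^[i] root) : IsPreorder N root par ord := by
  obtain ⟨f, h1, h2, h3, h4⟩ := h.exists_fun
  have hlen : l.length + 1 = N := by
    have : (root :: l).Perm (List.range N) :=
      (List.perm_ext_iff_of_nodup hn List.nodup_range).2 fun x => by simp [hl x]
    simpa using this.length_eq
  have hof : ∀ i < N, ord i = f i := by
    intro i hi
    rw [ho i (by omega)]
    induction i with
    | zero => exact h1.symm
    | succ i ih => rw [Function.iterate_succ_apply', ih (by omega), (h3 i (by omega)).1]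
  rw [hlen] at h4
  have hmem : ∀ v, v < N ↔ ∃ i < N, f i = v := by
    intro v
    rw [← hl, ← h4]
    simp
  have hinj := List.inj_on_of_nodup_map (h4 ▸ hn)
  refine ⟨by rw [hof 0 (by omega), h1], fun i hi => ?_, fun i hi j hj hij => ?_, fun v hv => ?_,
    fun i hi => ?_⟩
  · rw [hof i hi]
    exact (hmem _).2 ⟨i, hi, rfl⟩
  · rw [hof i hi, hof j hj] at hij
    exact hinj (by simpa using hi) (by simpa using hj) hij
  · obtain ⟨i, hi, rfl⟩ := (hmem v).1 hv
    exact ⟨i, hi, hof i hi⟩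
  · rw [hof i (by omega), hof (i + 1) hi]
    refine (h3 i (by omega)).2.resolve_left ?_
    have := (hmem (f (i + 1))).2 ⟨i + 1, hi, rfl⟩
    omega

end Shape

/-! ### A linear-time preorder from parent pointers -/

section OrderPhase

/-- Computation of a preorder of the tree in the word array `5`. The nodes are inserted into a
linked list right after their parents; the parents are copied to the word array `1`, and the
word array `4` is cleared for the heights. -/
def orderPhase : Program :=
  block [
    .setReg 3 (.const 0),
    .loop (.lt (.reg 3) (.reg 1)) (block [
      .setMem 1 (.reg 3) (.load 0 (.reg 3)),
      .setMem 2 (.reg 3) (.reg 1),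
      .setMem 3 (.reg 3) (.const 0),
      .setMem 4 (.reg 3) (.const 0),
      .setReg 3 (.bin .add (.reg 3) (.const 1))]),
    .setMem 3 (.reg 2) (.const 1),
    .setReg 3 (.const 0),
    .loop (.lt (.reg 3) (.reg 1)) (block [
      .setReg 4 (.reg 3),
      .setReg 5 (.load 2 (.reg 4)),
      .loop (.eq (.load 3 (.reg 4)) (.const 0)) (block [
        .setMem 3 (.reg 4) (.const 1),
        .setReg 6 (.load 1 (.reg 4)),
        .setReg 5 (.load 2 (.reg 6)),
        .setMem 2 (.reg 6) (.reg 4),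
        .setReg 4 (.reg 6)]),
      .setMem 2 (.reg 3) (.reg 5),
      .setReg 3 (.bin .add (.reg 3) (.const 1))]),
    .setReg 3 (.const 0),
    .setReg 4 (.reg 2),
    .loop (.lt (.reg 4) (.reg 1)) (block [
      .setMem 5 (.reg 3) (.reg 4),
      .setReg 3 (.bin .add (.reg 3) (.const 1)),
      .setReg 4 (.load 2 (.reg 4))])]

variable {α : Type u} [LinearOrder α] {w : ℕ} {code : α → Option ℕ} {s : Store α}

/-- Each round of climbing marks a node that was not listed before, so all climbs together are
linear although a single one may be long. The old successor of the splice point stays admissible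
behind the branch, whose nodes all descend from that point. -/
theorem wp_orderPhase {N root : ℕ} {par dep : ℕ → ℕ} (hN : s.reg 1 = N) (hr : s.reg 2 = root)
    (hT : TreeShape N root par dep) (hpar : ∀ v < N, s.mem 0 v = par v)
    (hw : N + 2 < wordBound w) :
    WP w code orderPhase s fun s' l => IsPreorder N root par (s'.mem 5) ∧
      (∀ v < N, s'.mem 1 v = par v) ∧ (∀ v < N, s'.mem 4 v = 0) ∧ l ≤ 200 * N + 100 := by
  have hroot := hT.root_lt
  simp only [orderPhase, wp_block_cons, wp_setReg, Expr.ok, Expr.val, Expr.cost]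
  refine ⟨by omega, wp_loop (fun s' k => s'.reg 3 ≤ N ∧ k ≤ 50 * s'.reg 3 ∧
    ∀ v < s'.reg 3, s'.mem 1 v = par v ∧ s'.mem 2 v = N ∧ s'.mem 3 v = 0 ∧ s'.mem 4 v = 0)
    (fun s' => N - s'.reg 3) (by simp) ?_⟩
  rintro s1 k1 hFr1 ⟨i1, i2, i3⟩
  have r1 : s1.reg 1 = N := (hFr1.reg 1 rfl).trans (by simp [hN])
  have r2 : s1.reg 2 = root := (hFr1.reg 2 rfl).trans (by simp [hr])
  have m0 : s1.mem 0 = s.mem 0 := hFr1.mem 0 rfl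
  refine ⟨by simp, ?_, ?_⟩
  · intro hlt
    simp only [Test.holds, Expr.val, r1] at hlt
    simp [r1, m0, Test.cost]
    refine ⟨by omega, by omega, ⟨by omega, by omega, ?_⟩, by omega⟩
    intro v hv
    rcases hv.lt_or_eq with hv | rfl
    · simpa [Function.update_of_ne hv.ne] using i3 v hv
    · simpa using hpar _ hlt
  intro hge
  simp only [Test.holds, Expr.val, r1, not_lt] at hge
  have h3 : s1.reg 3 = N := by omega
  rw [h3] at i2 i3
  simp only [wp_setMem, Expr.ok, Expr.val, Expr.cost, r2]
  refine ⟨trivial, by omega, by omega, ?_⟩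
  -- Climbing is charged to the length of the list `L`, and the constant work per node to the
  -- counter in register `3`.
  refine wp_loop (fun s' k => s'.reg 3 ≤ N ∧ ∃ L : List ℕ,
    Seg (PreStep N par (s'.mem 2)) root L N ∧ (root :: L).Nodup ∧ (∀ x ∈ root :: L, x < N) ∧
    (∀ x < s'.reg 3, x ∈ root :: L) ∧
    (∀ x < N, s'.mem 3 x = 0 ↔ x ∉ root :: L) ∧
    k ≤ 40 * s'.reg 3 + 40 * L.length) (fun s' => N - s'.reg 3) ?_ ?_
  · refine ⟨by simp, [], ⟨?_, Or.inl rfl⟩, by simp, by simpa, by simp, ?_, by simp⟩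
    · simpa using (i3 root hroot).2.1
    · intro x hx
      by_cases hxr : x = root
      · simp [hxr]
      · simpa [hxr] using (i3 x hx).2.2.1
  rintro s2 k2 hFr2 ⟨j1, L, j2, j3, j4, j5, j6, j7⟩
  have r1' : s2.reg 1 = N := (hFr2.reg 1 rfl).trans (by simp [r1])
  have r2' : s2.reg 2 = root := (hFr2.reg 2 rfl).trans (by simp [r2])
  have m1 : ∀ v < N, s2.mem 1 v = par v := fun v hv => by
    rw [hFr2.mem 1 rfl]
    simpa using (i3 v hv).1
  have m4 : ∀ v < N, s2.mem 4 v = 0 := fun v hv => by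
    rw [hFr2.mem 4 rfl]
    simpa using (i3 v hv).2.2.2
  refine ⟨by simp, ?_, ?_⟩
  · intro hlt
    simp only [Test.holds, Expr.val, r1'] at hlt
    simp only [wp_block_cons, wp_setReg, Expr.ok, Expr.val, Expr.cost, setReg_reg, setReg_mem,
      if_true, Test.cost]
    refine ⟨trivial, trivial, ?_⟩
    -- `C` is the climbed branch below the current node. Its last link, from the starting node, is
    -- written only after the climb, so the segment is described for every admissible end `b`;
    -- register `5` remembers the old successor of the current node, which becomes `b`.
    refine wp_loop (fun s' k => s'.reg 4 < N ∧ Anc par (s'.reg 4) (s2.reg 3) ∧ ∃ C : List ℕ,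
      (∀ b, (b = N ∨ Anc par (par b) (s'.reg 4)) →
        Seg (PreStep N par (Function.update (s'.mem 2) (s2.reg 3) b)) (s'.reg 4) C b) ∧
      (∀ z, z ≠ s'.reg 4 → z ∉ C → s'.mem 2 z = s2.mem 2 z) ∧
      s'.reg 5 = s2.mem 2 (s'.reg 4) ∧ s2.reg 3 ∈ s'.reg 4 :: C ∧ C.Nodup ∧
      (∀ c ∈ C, c ∉ root :: L ∧ c < N ∧ dep (s'.reg 4) < dep c) ∧
      (∀ x < N, s'.mem 3 x = 0 ↔ x ∉ root :: L ∧ x ∉ C) ∧ k ≤ 40 * C.length)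
      (fun s' => dep (s'.reg 4)) ?_ ?_
    · refine ⟨by simpa, by simpa using Anc.refl _, [], ?_, by simp, by simp, by simp, by simp,
        by simp, ?_, by simp⟩
      · intro b hb
        simp only [setReg_reg] at hb ⊢
        exact ⟨by simp, hb⟩
      · intro x hx
        simpa using j6 x hx
    rintro s3 k3 hFr3 ⟨l1, l2, C, l3, l4, l5, l6, l7, l8, l9, l10⟩
    have e3 : s3.reg 3 = s2.reg 3 := (hFr3.reg 3 rfl).trans (by simp)
    have e1 : s3.mem 1 = s2.mem 1 := hFr3.mem 1 rfl
    refine ⟨by simp; omega, ?_, ?_⟩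
    · intro h0
      simp only [Test.holds, Expr.val] at h0
      obtain ⟨hL, hC⟩ := (l9 _ l1).1 h0
      have hxr : s3.reg 4 ≠ root := by
        intro he
        simp [he] at hL
      have hdep := hT.dep_par _ l1 hxr
      have hp4 : par (s3.reg 4) ≠ s3.reg 4 := by
        intro he
        rw [he] at hdep
        omega
      have hpC : par (s3.reg 4) ∉ C := by
        intro he
        have := (l8 _ he).2.2
        omega
      have hpv : par (s3.reg 4) ≠ s2.reg 3 := by
        intro he
        rw [← he] at l6
        rcases List.mem_cons.1 l6 with h | h
        · exact hp4 h
        · exact hpC h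
      have hseg : ∀ b, (b = N ∨ Anc par (par b) (par (s3.reg 4))) →
          Seg (PreStep N par (Function.update (Function.update (s3.mem 2) (par (s3.reg 4))
            (s3.reg 4)) (s2.reg 3) b)) (par (s3.reg 4)) (s3.reg 4 :: C) b := by
        intro b hb
        refine ⟨⟨by rw [Function.update_of_ne hpv, Function.update_self],
          Or.inr (Anc.refl _)⟩, ?_⟩
        refine (l3 b (hb.imp_right fun h => h.trans (Anc.par_self _))).imp ?_
        rintro x hx y ⟨g1, g2⟩
        refine ⟨?_, g2⟩
        have hxp : x ≠ par (s3.reg 4) := by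
          rintro rfl
          rcases List.mem_cons.1 hx with h | h
          · exact hp4 h
          · exact hpC h
        rw [← g1]
        by_cases hxv : x = s2.reg 3
        · simp [hxv]
        · rw [Function.update_of_ne hxv, Function.update_of_ne hxv, Function.update_of_ne hxp]
      simp [e1, m1 _ l1, Test.cost]
      refine ⟨by omega, ⟨hT.par_lt _ l1, (Anc.par_self _).trans l2, s3.reg 4 :: C, ?_, ?_, ?_, ?_,
        ?_, ?_, ?_, ?_⟩, by omega⟩
      · exact ⟨hseg N (Or.inl rfl), fun a ha => hseg a (Or.inr ha)⟩
      · intro z hz1 hz2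
        simp only [List.mem_cons, not_or] at hz2
        rw [Function.update_of_ne hz1]
        exact l4 z hz2.1 hz2.2
      · exact l4 _ hp4 hpC
      · exact Or.inr (by simpa using l6)
      · exact List.nodup_cons.2 ⟨hC, l7⟩
      · intro c hc
        rcases List.mem_cons.1 hc with rfl | hc
        · exact ⟨by simpa using hL, l1, by omega⟩
        · obtain ⟨q1, q2, q3⟩ := l8 c hc
          exact ⟨by simpa using q1, q2, by omega⟩
      · intro x hx
        by_cases hx4 : x = s3.reg 4
        · simp [hx4]
        · simpa [hx4] using l9 x hx
      · simp only [List.length_cons]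
        omega
    · intro h0
      simp only [Test.holds, Expr.val] at h0
      have hxC : s3.reg 4 ∉ C := fun hc => by
        have := (l8 _ hc).2.2
        omega
      have hxL : s3.reg 4 ∈ root :: L := by
        by_contra hc
        exact h0 ((l9 _ l1).2 ⟨hc, hxC⟩)
      obtain ⟨L', q1, q2⟩ := Seg.insert (N := N) (par := par) (nxt := s2.mem 2)
        (g := Function.update (s3.mem 2) (s2.reg 3) (s3.reg 5)) (x := s3.reg 4) (C := C)
        (by rw [l5]; exact l3 _) (by
          intro z hz1 hz2
          have hzv : z ≠ s2.reg 3 := by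
            rintro rfl
            exact (List.mem_cons.1 l6).elim hz1 hz2
          rw [Function.update_of_ne hzv]
          exact l4 z hz1 hz2) j2 hxL j3 (fun c hc => (l8 c hc).1)
      simp only [wp_setMem, wp_block_nil, Expr.ok, Expr.val, e3,
        setMem_reg, setMem_mem, setReg_mem, setReg_reg, if_true, BinOp.eval, Expr.cost, Test.cost]
      have hlen := q2.length_eq
      simp only [List.length_cons, List.length_append] at hlen
      refine ⟨trivial, trivial, ⟨trivial, by omega, by omega⟩, ⟨by omega, L', q1, ?_, ?_, ?_, ?_,
        by omega⟩, by omega⟩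
      · refine q2.nodup_iff.2 (List.nodup_append.2 ⟨j3, l7, ?_⟩)
        rintro a ha b hb rfl
        exact (l8 a hb).1 ha
      · intro x hx
        rcases List.mem_append.1 (q2.mem_iff.1 hx) with hx | hx
        · exact j4 x hx
        · exact (l8 x hx).2.1
      · intro x hx
        rw [q2.mem_iff, List.mem_append]
        rcases (Nat.le_of_lt_succ hx).lt_or_eq with hx | rfl
        · exact Or.inl (j5 x hx)
        · rcases List.mem_cons.1 l6 with h | h
          · exact Or.inl (h ▸ hxL)
          · exact Or.inr h
      · intro x hx
        rw [q2.mem_iff, List.mem_append, not_or]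
        simpa using l9 x hx
  · intro hge
    simp only [Test.holds, Expr.val, r1', not_lt] at hge
    have h3 : s2.reg 3 = N := by omega
    rw [h3] at j5 j7
    have hmem : ∀ x, x ∈ root :: L ↔ x < N := fun x => ⟨j4 x, j5 x⟩
    have hlen : L.length + 1 = N := by
      have : (root :: L).Perm (List.range N) :=
        (List.perm_ext_iff_of_nodup j3 List.nodup_range).2 fun x => by simp [hmem x]
      simpa using this.length_eq
    obtain ⟨f, f1, f2, f3, f4⟩ := j2.exists_fun
    rw [hlen] at f2 f4
    have flt : ∀ i < N, f i < N := by
      intro i hi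
      rw [← hmem, ← f4]
      simp only [List.mem_map, List.mem_range]
      exact ⟨i, hi, rfl⟩
    refine ⟨by omega, trivial, ?_⟩
    refine wp_loop (fun s' k => s'.reg 3 ≤ N ∧ s'.reg 4 = f (s'.reg 3) ∧ k ≤ 30 * s'.reg 3 ∧
      ∀ i < s'.reg 3, s'.mem 5 i = f i) (fun s' => N - s'.reg 3) ?_ ?_
    · simp [r2', f1]
    rintro s4 k4 hFr4 ⟨n1, n2, n3, n4⟩
    have r1'' : s4.reg 1 = N := (hFr4.reg 1 rfl).trans (by simp [r1'])
    have m1' : s4.mem 1 = s2.mem 1 := hFr4.mem 1 rfl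
    have m2' : s4.mem 2 = s2.mem 2 := hFr4.mem 2 rfl
    have m4' : s4.mem 4 = s2.mem 4 := hFr4.mem 4 rfl
    refine ⟨by simp, ?_, ?_⟩
    · intro hlt
      simp only [Test.holds, Expr.val, r1'', n2] at hlt
      have hiN : s4.reg 3 < N := by
        by_contra hc
        rw [show s4.reg 3 = N by omega, f2] at hlt
        omega
      simp [m2', n2, Test.cost]
      refine ⟨by omega, ⟨by omega, (f3 _ (by omega)).1, by omega, ?_⟩, by omega⟩
      intro i hi
      rcases hi.lt_or_eq with hi | rfl
      · rw [Function.update_of_ne hi.ne, n4 i hi]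
      · simp
    · intro hge'
      simp only [Test.holds, Expr.val, r1'', n2] at hge'
      have hiN : s4.reg 3 = N := by
        by_contra hc
        exact hge' (flt _ (by omega))
      rw [hiN] at n3 n4
      rw [wp_block_nil]
      refine ⟨isPreorder_of_seg j2 j3 hmem ?_, fun v hv => by rw [m1']; exact m1 v hv,
        fun v hv => by rw [m4']; exact m4 v hv, ?_⟩
      · intro i hi
        rw [n4 i (by omega)]
        clear hge'
        induction i with
        | zero => exact f1
        | succ i ih => rw [Function.iterate_succ_apply', ← ih (by omega), (f3 i (by omega)).1]
      · simp only [Test.cost, Expr.cost]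
        omega

end OrderPhase

/-! ### Heights and the amortized bound -/

section Heights

/-- `ht` is the height function of the tree `par`. -/
structure IsHeight (N root : ℕ) (par ht : ℕ → ℕ) : Prop where
  le_par : ∀ v < N, v ≠ root → ht v + 1 ≤ ht (par v)
  exists_child : ∀ u < N, ht u ≠ 0 → ∃ v < N, v ≠ root ∧ par v = u ∧ ht u = ht v + 1
  lt : ∀ u < N, ht u < N

/-- If the potential of a node grows by at most one over that of its parent, less the cost of the
node, and if cost and potential of every node are bounded by its height, then the total cost is
linear: along the edges to a child of maximal height the costs telescope, and the heights of the
other nodes sum up to the number of nodes. -/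
theorem IsHeight.sum_le {N root : ℕ} {par ht F pot : ℕ → ℕ} (h : IsHeight N root par ht)
    (hpar : ∀ v < N, par v < N) (h0 : F root = 0)
    (h1 : ∀ v < N, v ≠ root → F v + pot v ≤ pot (par v) + 1)
    (h2 : ∀ v < N, v ≠ root → F v + pot v ≤ ht v + 1) (h3 : ∀ v < N, pot v ≤ ht v) :
    ∑ v ∈ Finset.range N, F v ≤ 3 * N := by
  classical
  have hc : ∀ u, ∃ v, u < N → ht u ≠ 0 → v < N ∧ v ≠ root ∧ par v = u ∧ ht u = ht v + 1 := by
    intro u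
    by_cases hu : u < N ∧ ht u ≠ 0
    · obtain ⟨v, hv⟩ := h.exists_child u hu.1 hu.2
      exact ⟨v, fun _ _ => hv⟩
    · exact ⟨0, fun a b => absurd ⟨a, b⟩ hu⟩
  choose lc hlc using hc
  -- `H` consists of the chosen children of maximal height, `G` of the root and all other nodes.
  set H := (Finset.range N).filter fun v => v ≠ root ∧ lc (par v) = v with hH
  set G := (Finset.range N).filter fun v => ¬ (v ≠ root ∧ lc (par v) = v) with hG
  have split : ∀ g : ℕ → ℕ, ∑ v ∈ Finset.range N, g v = ∑ v ∈ H, g v + ∑ v ∈ G, g v :=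
    fun g => (Finset.sum_filter_add_sum_filter_not _ _ _).symm
  have memH : ∀ v ∈ H, v < N ∧ v ≠ root ∧ lc (par v) = v := fun v hv => by
    simpa [hH] using hv
  have memG : ∀ v ∈ G, v < N := fun v hv => by
    simp only [hG, Finset.mem_filter, Finset.mem_range] at hv
    exact hv.1
  -- Distinct chosen children have distinct parents, so every potential is spent at most once along
  -- chosen edges. After cancelling the potentials of `H`, only those of `G` remain.
  have sumPar : ∑ v ∈ H, pot (par v) ≤ ∑ v ∈ Finset.range N, pot v := by
    rw [← Finset.sum_image (g := par) (f := pot) (s := H)]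
    · refine Finset.sum_le_sum_of_subset fun u hu => ?_
      obtain ⟨v, hv, rfl⟩ := Finset.mem_image.1 hu
      exact Finset.mem_range.2 (hpar v (memH v hv).1)
    · intro v hv v' hv' he
      rw [← (memH v hv).2.2, ← (memH v' hv').2.2, he]
  -- A node of nonzero height passes its height, less one, to its chosen child. Cancelling the
  -- heights over `H` leaves at most `|H|` for the sum of the heights over `G`.
  have sumHt : ∑ v ∈ Finset.range N, ht v ≤ ∑ v ∈ H, (ht v + 1) := by
    have e : ∑ v ∈ (Finset.range N).filter (fun u => ht u ≠ 0), ht v =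
        ∑ v ∈ (Finset.range N).filter (fun u => ht u ≠ 0), (ht (lc v) + 1) := by
      refine Finset.sum_congr rfl fun u hu => ?_
      simp only [Finset.mem_filter, Finset.mem_range] at hu
      exact (hlc u hu.1 hu.2).2.2.2
    rw [← Finset.sum_filter_ne_zero, e,
      ← Finset.sum_image (g := lc) (f := fun v => ht v + 1)]
    · refine Finset.sum_le_sum_of_subset fun u hu => ?_
      obtain ⟨v, hv, rfl⟩ := Finset.mem_image.1 hu
      simp only [Finset.mem_filter, Finset.mem_range] at hv
      obtain ⟨a1, a2, a3, a4⟩ := hlc v hv.1 hv.2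
      simp only [hH, Finset.mem_filter, Finset.mem_range]
      exact ⟨a1, a2, by rw [a3]⟩
    · intro v hv v' hv' he
      simp only [Finset.mem_coe, Finset.mem_filter, Finset.mem_range] at hv hv'
      rw [← (hlc v hv.1 hv.2).2.2.1, ← (hlc v' hv'.1 hv'.2).2.2.1, he]
  have cH : ∑ v ∈ H, (F v + pot v) ≤ ∑ v ∈ H, (pot (par v) + 1) :=
    Finset.sum_le_sum fun v hv => h1 v (memH v hv).1 (memH v hv).2.1
  have cG : ∑ v ∈ G, F v ≤ ∑ v ∈ G, (ht v + 1) := by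
    refine Finset.sum_le_sum fun v hv => ?_
    by_cases hvr : v = root
    · rw [hvr, h0]
      exact Nat.zero_le _
    · exact (Nat.le_add_right _ _).trans (h2 v (memG v hv) hvr)
  have pG : ∑ v ∈ G, pot v ≤ ∑ v ∈ G, ht v :=
    Finset.sum_le_sum fun v hv => h3 v (memG v hv)
  have card : ∑ v ∈ H, 1 + ∑ v ∈ G, 1 = N := by
    rw [← split fun _ => 1]
    simp
  have e1 := split F
  have e2 := split pot
  have e3 := split ht
  simp only [Finset.sum_add_distrib] at cH cG sumHt
  omega

/-- Computation of the heights in the word array `4`. -/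
def heightPhase : Program :=
  block [
    .setReg 3 (.reg 1),
    .loop (.lt (.const 1) (.reg 3)) (block [
      .setReg 3 (.bin .sub (.reg 3) (.const 1)),
      .setReg 4 (.load 5 (.reg 3)),
      .setReg 5 (.load 1 (.reg 4)),
      .setReg 6 (.bin .add (.load 4 (.reg 4)) (.const 1)),
      .ite (.lt (.load 4 (.reg 5)) (.reg 6)) (.setMem 4 (.reg 5) (.reg 6)) .skip])]

variable {α : Type u} [LinearOrder α] {w : ℕ} {code : α → Option ℕ} {s : Store α}

/-- In reverse preorder all children of a node are treated before the node itself, so its height is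
final when it is passed on to the parent. -/
theorem wp_heightPhase {N root : ℕ} {par dep ord : ℕ → ℕ} (hN : s.reg 1 = N)
    (hT : TreeShape N root par dep) (hO : IsPreorder N root par ord)
    (hord : ∀ i < N, s.mem 5 i = ord i)
    (hpar : ∀ v < N, s.mem 1 v = par v) (h0 : ∀ v < N, s.mem 4 v = 0)
    (hw : N + 2 < wordBound w) :
    WP w code heightPhase s fun s' l => IsHeight N root par (s'.mem 4) ∧ l ≤ 50 * N + 50 := by
  have hroot := hT.root_lt
  simp only [heightPhase, wp_block_cons, wp_setReg, Expr.ok, Expr.val, Expr.cost]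
  -- The loop stops at index `1` because the root, at index `0`, has no parent. The last clause,
  -- height plus index below `N`, yields the upper bound on heights and keeps the additions within a
  -- word.
  refine ⟨trivial, wp_loop (fun s' k => 1 ≤ s'.reg 3 ∧ s'.reg 3 ≤ N ∧
    k + 40 * s'.reg 3 ≤ 40 * N ∧
    (∀ j, s'.reg 3 ≤ j → j < N → s'.mem 4 (ord j) + 1 ≤ s'.mem 4 (par (ord j))) ∧
    (∀ j < N, s'.mem 4 (ord j) = 0 ∨ ∃ j', s'.reg 3 ≤ j' ∧ j' < N ∧ par (ord j') = ord j ∧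
      s'.mem 4 (ord j) = s'.mem 4 (ord j') + 1) ∧
    (∀ j < N, s'.mem 4 (ord j) + j < N)) (fun s' => s'.reg 3) ?_ ?_⟩
  · simp only [setReg_reg, if_true, setReg_mem, hN]
    refine ⟨by omega, le_rfl, by omega, fun j _ _ => by omega, fun j hj => Or.inl (h0 _ (hO.lt j hj)),
      fun j hj => by rw [h0 _ (hO.lt j hj)]; omega⟩
  rintro s1 k1 hFr1 ⟨i1, i2, i3, i4, i5, i6⟩
  have m1 : s1.mem 1 = s.mem 1 := hFr1.mem 1 rfl
  have m5 : s1.mem 5 = s.mem 5 := hFr1.mem 5 rfl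
  refine ⟨by simp; omega, ?_, ?_⟩
  · intro hlt
    simp only [Test.holds, Expr.val] at hlt
    obtain ⟨i, hi⟩ : ∃ i, s1.reg 3 = i + 1 + 1 := ⟨s1.reg 3 - 2, by omega⟩
    rw [hi] at i1 i2 i3 i4 i5
    have hiN : i + 1 < N := by omega
    obtain ⟨jj, hjj, hjp⟩ := hO.exists_par hT hiN
    have hne : ∀ j, i + 1 ≤ j → j < N → ord j ≠ ord jj := by
      intro j hj hjN he
      have := hO.inj j hjN jj (by omega) he
      omega
    have hb := i6 (i + 1) hiN
    have hb' := i6 jj (by omega)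
    simp [hi, m5, m1, hord _ hiN, hpar _ (hO.lt _ hiN), Test.cost]
    refine ⟨by omega, ⟨by omega, by omega⟩, ?_, ?_⟩
    · intro hlt'
      rw [← hjp] at hlt' ⊢
      refine ⟨by omega, by omega, ?_, ?_, ?_⟩
      · intro j hj hjN
        rw [Function.update_of_ne (hne j hj hjN)]
        rcases Nat.lt_or_eq_of_le (show i + 1 ≤ j from hj) with hj | rfl
        · have := i4 j hj hjN
          by_cases hpj : par (ord j) = ord jj
          · rw [hpj] at this ⊢
            rw [Function.update_self]
            omega
          · rwa [Function.update_of_ne hpj]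
        · rw [← hjp, Function.update_self]
          exact Nat.lt_succ_self _
      · intro j hj
        by_cases hjj' : ord j = ord jj
        · right
          refine ⟨i + 1, Nat.lt_succ_self i, hiN, by rw [hjj', hjp], ?_⟩
          rw [hjj', Function.update_self, Function.update_of_ne (hne _ le_rfl hiN)]
        · rw [Function.update_of_ne hjj']
          refine (i5 j hj).imp_right ?_
          rintro ⟨j', q1, q2, q3, q4⟩
          exact ⟨j', by omega, q2, q3, by rwa [Function.update_of_ne (hne j' (by omega) q2)]⟩
      · intro j hj
        by_cases hjj' : ord j = ord jj
        · have := hO.inj j hj jj (by omega) hjj'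
          rw [hjj', Function.update_self]
          omega
        · rw [Function.update_of_ne hjj']
          exact i6 j hj
    · intro hge
      refine ⟨by omega, by omega, ?_, ?_, i6⟩
      · intro j hj hjN
        rcases Nat.lt_or_eq_of_le (show i + 1 ≤ j from hj) with hj | rfl
        · exact i4 j hj hjN
        · exact hge
      · intro j hj
        refine (i5 j hj).imp_right ?_
        rintro ⟨j', q1, q2⟩
        exact ⟨j', by omega, q2⟩
  · intro hge
    simp only [Test.holds, Expr.val, not_lt] at hge
    have h3 : s1.reg 3 = 1 := by omega
    rw [h3] at i3 i4 i5
    rw [wp_block_nil]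
    refine ⟨⟨fun v hv hvr => ?_, fun u hu hu0 => ?_, fun u hu => ?_⟩, ?_⟩
    · obtain ⟨i, hi, rfl⟩ := hO.surj v hv
      refine i4 i (Nat.pos_of_ne_zero ?_) hi
      rintro rfl
      exact hvr hO.zero
    · obtain ⟨i, hi, rfl⟩ := hO.surj u hu
      obtain ⟨j, q1, q2, q3, q4⟩ := (i5 i hi).resolve_left hu0
      refine ⟨ord j, hO.lt j q2, ?_, q3, q4⟩
      obtain ⟨j, rfl⟩ : ∃ j', j = j' + 1 := ⟨j - 1, by omega⟩
      exact hO.ne_root q2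
    · obtain ⟨i, hi, rfl⟩ := hO.surj u hu
      have := i6 i hi
      omega
    · simp only [Test.cost, Expr.cost]
      omega

end Heights

/-! ### The matching loop -/

section Matching

variable {α : Type u} [LinearOrder α]

/-- `X v` gives the labels on the path from the root to `v`, at the indices below the depth of
`v`. -/
def IsPathLabels {α : Type u} (N root : ℕ) (par dep : ℕ → ℕ) (X : ℕ → ℕ → α) : Prop :=
  ∀ v < N, v ≠ root → ∀ i < dep (par v), X v i = X (par v) i

/-- The pattern of length `m` is order-isomorphic to the label of a path that ends in `v`. -/
def MatchesAt (p : ℕ → α) (m : ℕ) (dep : ℕ → ℕ) (X : ℕ → ℕ → α) (v : ℕ) : Prop :=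
  m ≤ dep v ∧ OI p (X v) (dep v - m) m

/-- A prefix of length `q` of the pattern is order-isomorphic to the label of a path that ends in
`v`, and every longer prefix with this property is too short to be extended to a match in the
subtree of `v`, whose height is `h`. -/
structure IsState (p : ℕ → α) (m h d q : ℕ) (x : ℕ → α) : Prop where
  le : q ≤ m
  le_dep : q ≤ d
  oi : OI p x (d - q) q
  max : ∀ k ≤ m, k ≤ d → m ≤ k + h → OI p x (d - k) k → k ≤ q

/-- The cut loses no match: the length `m` satisfies `m ≤ k + h` for every height, so it is always
among the candidates over which the state is maximal. -/
theorem IsState.eq_iff {p : ℕ → α} {m h q v : ℕ} {dep : ℕ → ℕ} {X : ℕ → ℕ → α}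
    (hs : IsState p m h (dep v) q (X v)) : q = m ↔ MatchesAt p m dep X v := by
  constructor
  · rintro rfl
    exact ⟨hs.le_dep, hs.oi⟩
  · rintro ⟨h1, h2⟩
    exact le_antisymm hs.le (hs.max m le_rfl h1 (Nat.le_add_right _ _) h2)

/-- The labels of an ancestor are an initial part of those of its descendant. This lets a single
array indexed by depth serve all nodes. -/
theorem anc_labels {α : Type u} {N root : ℕ} {par dep : ℕ → ℕ} {X : ℕ → ℕ → α}
    (hT : TreeShape N root par dep) (hX : IsPathLabels N root par dep X) {a v : ℕ} (hv : v < N)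
    (h : Anc par a v) : dep a ≤ dep v ∧ ∀ i < dep a, X v i = X a i := by
  obtain ⟨j, rfl⟩ := h
  induction j generalizing v with
  | zero => exact ⟨le_rfl, fun _ _ => rfl⟩
  | succ j ih =>
    rw [Function.iterate_succ_apply]
    by_cases hvr : v = root
    · subst hvr
      rw [hT.par_root, Function.iterate_fixed hT.par_root]
      exact ⟨le_rfl, fun _ _ => rfl⟩
    · obtain ⟨h1, h2⟩ := ih (hT.par_lt v hv)
      refine ⟨h1.trans (by rw [hT.dep_par v hv hvr]; omega), fun i hi => ?_⟩
      rw [hX v hv hvr i (by omega), h2 i hi]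

theorem IsPreorder.dep_le {N root : ℕ} {par dep ord : ℕ → ℕ} (hT : TreeShape N root par dep)
    (hO : IsPreorder N root par ord) {i : ℕ} (hi : i < N) : dep (ord i) ≤ i := by
  induction i with
  | zero => rw [hO.zero, hT.dep_root]
  | succ i ih =>
    -- Trivial labels, since only the inequality between the depths is wanted from `anc_labels`.
    have hX : IsPathLabels N root par dep (fun _ _ => ()) := fun _ _ _ _ _ => rfl
    have := (anc_labels hT hX (hO.lt i (by omega)) (hO.anc i hi)).1
    have := ih (by omega)
    rw [hT.dep_par _ (hO.lt _ hi) (hO.ne_root hi)]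
    omega

/-- The start of the failure chain at a child of a node with state `q`. -/
def restart (f : ℕ → ℕ) (m q : ℕ) : ℕ := if q = m then f m else q

/-- A prefix ending at the child becomes, without its last character, one ending at the parent,
where the larger height still admits it. A full match cannot be extended, so there the chain starts
from the longest proper border instead. -/
theorem IsState.restart {p x y : ℕ → α} {m h h' d q : ℕ} {f : ℕ → ℕ} (hf : IsFailure p f m)
    (hm : 1 ≤ m) (hs : IsState p m h d q x) (hh : h' + 1 ≤ h) (hxy : ∀ i < d, y i = x i) :
    restart f m q < m ∧ restart f m q ≤ q ∧
      OI p y (d - restart f m q) (restart f m q) ∧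
      ∀ k < m, k ≤ d → m ≤ k + 1 + h' → OI p y (d - k) (k + 1) → k ≤ restart f m q := by
  have hle := hs.le
  have hld := hs.le_dep
  have key : ∀ k < m, k ≤ d → m ≤ k + 1 + h' → OI p y (d - k) (k + 1) → k ≤ q :=
    fun k hk hkd hkh ho => hs.max k hk.le hkd (by omega)
      ((ho.mono (Nat.le_succ k)).congr fun i _ hi => hxy i (by omega))
  have hoi : OI p y (d - q) q := hs.oi.congr fun i _ hi => (hxy i (by omega)).symm
  unfold OPTree.restart
  split
  · rename_i hq
    subst hq
    obtain ⟨f1, f2, f3⟩ := hf q hm le_rfl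
    refine ⟨f1, f1.le, ?_, fun k hk hkd hkh ho => f3 k hk ?_⟩
    · have := hoi.trans_border f2 (by omega)
      rwa [show d - q + (q - f q) = d - f q by omega] at this
    · refine hoi.border (d := q - k) ?_ (by omega)
      rw [show d - q + (q - k) = d - k by omega]
      exact ho.mono (Nat.le_succ k)
  · exact ⟨by omega, le_rfl, hoi, key⟩

/-- Computation of the state of the node in register `7` from the start of the failure chain in
register `3`; the node is reported if the state is the length of the pattern. -/
def advance : Program :=
  block [
    .setReg 5 (.load 4 (.reg 7)),
    chain 2,
    .setReg 3 (.bin .add (.reg 3) (.const 1)),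
    .setMem 7 (.reg 7) (.reg 3),
    .ite (.eq (.reg 3) (.reg 0)) (block [
      .setMem 0 (.reg 10) (.reg 7),
      .setReg 10 (.bin .add (.reg 10) (.const 1))]) .skip,
    .setReg 6 (.bin .add (.reg 6) (.const 1))]

/-- The matching loop over the nodes in preorder. -/
def matchPhase : Program :=
  block [
    .setMem 6 (.reg 2) (.const 0),
    .setMem 7 (.reg 2) (.const 0),
    .setReg 6 (.const 1),
    .setReg 10 (.const 0),
    .loop (.lt (.reg 6) (.reg 1)) (block [
      .setReg 7 (.load 5 (.reg 6)),
      .setReg 8 (.load 1 (.reg 7)),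
      .setReg 4 (.load 6 (.reg 8)),
      .copyChr 2 (.reg 4) 1 (.reg 7),
      .setMem 6 (.reg 7) (.bin .add (.reg 4) (.const 1)),
      .setReg 3 (.load 7 (.reg 8)),
      .ite (.eq (.reg 3) (.reg 0)) (.setReg 3 (.load 13 (.reg 3))) .skip,
      advance]),
    .setReg 0 (.reg 10)]

theorem nodup_map_update {f : ℕ → ℕ} {c v : ℕ} (h : ((List.range c).map f).Nodup)
    (hv : v ∉ (List.range c).map f) :
    ((List.range (c + 1)).map (Function.update f c v)).Nodup ∧
      ∀ k, k ∈ (List.range (c + 1)).map (Function.update f c v) ↔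
        k ∈ (List.range c).map f ∨ k = v := by
  have e : (List.range (c + 1)).map (Function.update f c v) = (List.range c).map f ++ [v] := by
    rw [List.range_succ, List.map_append]
    congr 1
    · refine List.map_congr_left fun i hi => ?_
      rw [Function.update_of_ne (List.mem_range.1 hi).ne]
    · simp
  rw [e]
  refine ⟨?_, fun k => by simp⟩
  rw [List.nodup_append]
  refine ⟨h, by simp, ?_⟩
  rintro a ha b hb rfl
  exact hv (List.mem_singleton.1 hb ▸ ha)

variable {w : ℕ} {code : α → Option ℕ} {s : Store α}

-- Depths and states are stored per node, so returning to an ancestor in preorder needs no undoing.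
-- The reports overwrite the word array `0`, whose parent pointers have been copied to the array
-- `1`.
set_option maxHeartbeats 1000000 in
theorem wp_matchPhase {N root m : ℕ} {par dep ord ht f : ℕ → ℕ} {p : ℕ → α} {X : ℕ → ℕ → α}
    (hm : s.reg 0 = m) (hN : s.reg 1 = N) (hr : s.reg 2 = root) (hm1 : 1 ≤ m)
    (hT : TreeShape N root par dep) (hO : IsPreorder N root par ord)
    (hH : IsHeight N root par ht) (hX : IsPathLabels N root par dep X)
    (hlab : ∀ v < N, v ≠ root → s.chr 1 v = some (X v (dep (par v))))
    (hp : ∀ i < m, s.chr 0 i = some (p i))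
    (hnb : Neighbours p m (s.mem 11) (s.mem 12)) (hf : IsFailure p f m)
    (hf13 : s.mem 13 = f) (hord : ∀ i < N, s.mem 5 i = ord i)
    (hpar : ∀ v < N, s.mem 1 v = par v) (hht : ∀ v < N, s.mem 4 v = ht v)
    (hw : 2 * N + m + 4 < wordBound w) :
    WP w code matchPhase s fun s' l =>
      ((List.range (s'.reg 0)).map (s'.mem 0)).Nodup ∧
      (∀ k, k ∈ (List.range (s'.reg 0)).map (s'.mem 0) ↔ k < N ∧ MatchesAt p m dep X k) ∧
      l ≤ 3000 * N := by
  have hroot := hT.root_lt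
  have ord0 := hO.zero
  simp only [matchPhase, wp_block_cons, wp_setReg, wp_setMem, Expr.ok, Expr.val, Expr.cost,
    setMem_reg, hr]
  refine ⟨trivial, by omega, trivial, by omega, by omega, by omega, ?_⟩
  -- The ghost function `F` records the failure steps per node with the two inequalities that
  -- `IsHeight.sum_le` asks for. The `700` contributed by the root is kept in reserve for the end of
  -- the loop.
  refine wp_loop (fun s' k => 1 ≤ s'.reg 6 ∧ s'.reg 6 ≤ N ∧ s'.reg 10 < s'.reg 6 ∧
    (∀ j < s'.reg 6, s'.mem 6 (ord j) = dep (ord j) ∧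
      IsState p m (ht (ord j)) (dep (ord j)) (s'.mem 7 (ord j)) (X (ord j))) ∧
    (∀ e < dep (ord (s'.reg 6 - 1)), s'.chr 2 e = some (X (ord (s'.reg 6 - 1)) e)) ∧
    ((List.range (s'.reg 10)).map (s'.mem 0)).Nodup ∧
    (∀ k, k ∈ (List.range (s'.reg 10)).map (s'.mem 0) ↔
      ∃ j < s'.reg 6, ord j = k ∧ MatchesAt p m dep X k) ∧
    ∃ F : ℕ → ℕ, F root = 0 ∧ k + 700 ≤ ∑ j ∈ Finset.range (s'.reg 6), (400 * F (ord j) + 700) ∧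
      ∀ j, 1 ≤ j → j < s'.reg 6 →
        F (ord j) + (s'.mem 7 (ord j) + ht (ord j) - m) ≤
          (s'.mem 7 (par (ord j)) + ht (par (ord j)) - m) + 1 ∧
        F (ord j) + (s'.mem 7 (ord j) + ht (ord j) - m) ≤ ht (ord j) + 1)
    (fun s' => N - s'.reg 6) ?_ ?_
  · simp only [setReg_reg, if_true, setReg_mem, setMem_mem, show (6 : ℕ) ≠ 10 by decide, if_false]
    have hd0 : dep (ord 0) = 0 := by rw [ord0, hT.dep_root]
    refine ⟨le_rfl, by omega, by simp, ?_, ?_, by simp, ?_, fun _ => 0, rfl, by simp, ?_⟩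
    · intro j hj
      obtain rfl : j = 0 := by omega
      rw [hd0, ord0]
      simp only [show (6 : ℕ) ≠ 7 by decide, if_false, Function.update_self, true_and]
      exact ⟨Nat.zero_le _, le_rfl, OI.zero, fun k _ hk _ _ => hk⟩
    · intro e he
      simp [hd0] at he
    · intro k
      constructor
      · simp
      · rintro ⟨j, hj, rfl, h1, -⟩
        obtain rfl : j = 0 := by simpa using hj
        omega
    · intro j hj1 hj2
      omega
  rintro s1 k1 hFr1 ⟨i1, i2, i3, i4, i5, i6, i7, F, i8, i9, i10⟩
  have r0 : s1.reg 0 = m := (hFr1.reg 0 rfl).trans (by simp [hm])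
  have r1 : s1.reg 1 = N := (hFr1.reg 1 rfl).trans (by simp [hN])
  have c0 : s1.chr 0 = s.chr 0 := hFr1.chr 0 rfl
  have c1 : s1.chr 1 = s.chr 1 := hFr1.chr 1 rfl
  have m1 : s1.mem 1 = s.mem 1 := hFr1.mem 1 rfl
  have m4 : s1.mem 4 = s.mem 4 := hFr1.mem 4 rfl
  have m5 : s1.mem 5 = s.mem 5 := hFr1.mem 5 rfl
  have m11 : s1.mem 11 = s.mem 11 := hFr1.mem 11 rfl
  have m12 : s1.mem 12 = s.mem 12 := hFr1.mem 12 rfl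
  have m13 : s1.mem 13 = f := (hFr1.mem 13 rfl).trans hf13
  refine ⟨by simp, ?_, ?_⟩
  · intro hlt
    simp only [Test.holds, Expr.val, r1] at hlt
    obtain ⟨i, hi⟩ : ∃ i, s1.reg 6 = i + 1 := ⟨s1.reg 6 - 1, by omega⟩
    rw [hi] at i1 i2 i3 i4 i5 i7 i9 i10 hlt
    rw [Nat.add_sub_cancel] at i5
    have hvN := hO.lt (i + 1) hlt
    have hvr := hO.ne_root hlt
    obtain ⟨jj, hjj, hjp⟩ := hO.exists_par hT hlt
    have hdep := hT.dep_par _ hvN hvr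
    have hdle := hO.dep_le hT hlt
    obtain ⟨hanc1, hanc2⟩ := anc_labels hT hX (hO.lt i (by omega)) (hO.anc i hlt)
    obtain ⟨g1, g2⟩ := i4 jj (by omega)
    rw [hjp] at g1 g2
    have hhp := hH.le_par _ hvN hvr
    have hhlt := hH.lt _ hvN
    set v := ord (i + 1) with hv
    set u := par v with hu
    have huN : u < N := hT.par_lt _ hvN
    have hvu : u ≠ v := by
      intro h
      rw [h] at hdep
      omega
    obtain ⟨t1, t2, t3, t4⟩ := g2.restart hf hm1 hhp (hX v hvN hvr)
    -- The array holds the path to the previously listed node. The parent `u` is an ancestor of that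
    -- node or the node itself, so all cells below the depth of `u` are already right and only one
    -- has to be written.
    have hpath : ∀ e ≤ dep u, Function.update (s1.chr 2) (dep u) (some (X v (dep u))) e =
        some (X v e) := by
      intro e he
      rcases he.lt_or_eq with he | rfl
      · rw [Function.update_of_ne he.ne, i5 e (by omega), hanc2 e he, ← hX v hvN hvr e he]
      · simp
    set q0 := restart f m (s1.mem 7 u) with hq0
    have hvout : v ∉ (List.range (s1.reg 10)).map (s1.mem 0) := by
      intro h
      obtain ⟨j, hj, hje, -⟩ := (i7 v).1 h
      have := hO.inj j (by omega) (i + 1) hlt hje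
      omega
    have hnev : ∀ j < i + 1, ord j ≠ v := by
      intro j hj hje
      have := hO.inj j (by omega) (i + 1) hlt hje
      omega
    let Post : Store α → ℕ → Prop := fun s' l =>
        s'.reg 6 = i + 2 ∧ s'.reg 10 < i + 2 ∧
        (∀ j < i + 2, s'.mem 6 (ord j) = dep (ord j) ∧
          IsState p m (ht (ord j)) (dep (ord j)) (s'.mem 7 (ord j)) (X (ord j))) ∧
        (∀ e < dep v, s'.chr 2 e = some (X v e)) ∧
        ((List.range (s'.reg 10)).map (s'.mem 0)).Nodup ∧
        (∀ k, k ∈ (List.range (s'.reg 10)).map (s'.mem 0) ↔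
          ∃ j < i + 2, ord j = k ∧ MatchesAt p m dep X k) ∧
        s'.mem 7 = Function.update (s1.mem 7) v (s'.mem 7 v) ∧
        ∃ Fv, l ≤ 400 * Fv + 500 ∧
          Fv + (s'.mem 7 v + ht v - m) ≤ (s1.mem 7 u + ht u - m) + 1 ∧
          Fv + (s'.mem 7 v + ht v - m) ≤ ht v + 1
    have main : ∀ (s2 : Store α), s2.reg 0 = m → s2.reg 1 = N → s2.reg 3 = q0 →
        s2.reg 4 = dep u → s2.reg 6 = i + 1 → s2.reg 7 = v → s2.reg 10 = s1.reg 10 →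
        s2.chr 0 = s.chr 0 →
        s2.chr 2 = Function.update (s1.chr 2) (dep u) (some (X v (dep u))) →
        s2.mem 0 = s1.mem 0 → s2.mem 4 = s.mem 4 →
        s2.mem 6 = Function.update (s1.mem 6) v (dep u + 1) → s2.mem 7 = s1.mem 7 →
        s2.mem 11 = s.mem 11 → s2.mem 12 = s.mem 12 → s2.mem 13 = f →
        WP w code advance s2 Post := by
      -- Formulated for any store with these contents, so that both outcomes of the test for a full
      -- match at the parent can use it.
      intro s2 a0 a1 a3 a4 a6 a7 a10 b0 b2 d0 d4 d6 d7 d11 d12 d13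
      rw [advance, wp_block_cons, wp_setReg, wp_block_cons]
      simp only [Expr.ok, Expr.val, a7, d4, hht _ hvN]
      refine ⟨trivial, (wp_chain (p := p) (x := X v) (q := q0) (pos := dep u) (m := m)
        (h := ht v) (B := dep u) le_rfl ?_ ?_ ?_ ?_ ?_ ?_ t1 (t2.trans g2.le_dep) ?_ ?_ t3 t4
          (by omega)).mono ?_⟩
      · simp [a0]
      · simp [a3]
      · simp [a4]
      · simp
      · simpa [b0] using hp
      · simpa [b2] using hpath
      · simpa [d11, d12] using hnb
      · simpa [d13] using hf.mono t1.le
      · rintro s3 l hFr3 ⟨z1, z2, z3, Fv, z4, z5⟩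
        have a0' : s3.reg 0 = m := (hFr3.reg 0 rfl).trans (by simp [a0])
        have a6' : s3.reg 6 = i + 1 := (hFr3.reg 6 rfl).trans (by simp [a6])
        have a7' : s3.reg 7 = v := (hFr3.reg 7 rfl).trans (by simp [a7])
        have a10' : s3.reg 10 = s1.reg 10 := (hFr3.reg 10 rfl).trans (by simp [a10])
        have b2' : s3.chr 2 = _ := (hFr3.chr 2 rfl).trans b2
        have d0' : s3.mem 0 = s1.mem 0 := (hFr3.mem 0 rfl).trans d0
        have d6' : s3.mem 6 = _ := (hFr3.mem 6 rfl).trans d6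
        have d7' : s3.mem 7 = s1.mem 7 := (hFr3.mem 7 rfl).trans d7
        have hstv : IsState p m (ht v) (dep v) (s3.reg 3 + 1) (X v) := by
          have := g2.le_dep
          rw [hdep]
          refine ⟨by omega, by omega, by rwa [Nat.add_sub_add_right], fun k hk hkd hkh ho => ?_⟩
          rcases k with _ | k
          · omega
          · rw [Nat.add_sub_add_right] at ho
            have := z3 k (by omega) (by omega) (by omega) ho
            omega
        have hst : ∀ j < i + 2, (Function.update (s1.mem 6) v (dep u + 1)) (ord j) = dep (ord j) ∧
            IsState p m (ht (ord j)) (dep (ord j))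
              (Function.update (s1.mem 7) v (s3.reg 3 + 1) (ord j)) (X (ord j)) := by
          intro j hj
          rcases Nat.lt_succ_iff_lt_or_eq.1 hj with hj | rfl
          · rw [Function.update_of_ne (hnev j hj), Function.update_of_ne (hnev j hj)]
            exact i4 j hj
          · rw [← hv, Function.update_self, Function.update_self]
            exact ⟨hdep.symm, hstv⟩
        -- The state grows by at most one while the height drops by at least one, so the starting
        -- potential does not exceed that of the parent; it is at most `ht v` because `q0 < m`.
        have hfin : Fv + (s3.reg 3 + 1 + ht v - m) ≤ (s1.mem 7 u + ht u - m) + 1 ∧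
            Fv + (s3.reg 3 + 1 + ht v - m) ≤ ht v + 1 := by
          constructor <;> omega
        have hpath' : ∀ e < dep v, s3.chr 2 e = some (X v e) := by
          intro e he
          rw [b2']
          exact hpath e (by omega)
        obtain ⟨y1, y2⟩ := nodup_map_update i6 hvout
        simp [Post, a0', a6', a7', a10', d0', d6', d7', Test.cost, Test.holds]
        refine ⟨by omega, ?_, ?_⟩
        · intro hmm
          refine ⟨by omega, by omega, by omega, hst, hpath', y1, ?_, Fv, by omega, hfin⟩
          intro k
          have := y2 k
          simp only [List.mem_map, List.mem_range, Order.lt_add_one_iff] at this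
          rw [this]
          have := i7 k
          simp only [List.mem_map, List.mem_range] at this
          rw [this]
          constructor
          · rintro (⟨j, q1, q2⟩ | rfl)
            · exact ⟨j, by omega, q2⟩
            · exact ⟨i + 1, by omega, hv.symm, hstv.eq_iff.1 hmm⟩
          · rintro ⟨j, q1, q2, q3⟩
            rcases Nat.lt_succ_iff_lt_or_eq.1 q1 with q1 | rfl
            · exact Or.inl ⟨j, q1, q2, q3⟩
            · exact Or.inr q2.symm
        · intro hmm
          refine ⟨by omega, by omega, hst, hpath', i6, ?_, Fv, by omega, hfin⟩
          intro k
          have := i7 k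
          simp only [List.mem_map, List.mem_range] at this
          rw [this]
          constructor
          · rintro ⟨j, q1, q2⟩
            exact ⟨j, by omega, q2⟩
          · rintro ⟨j, q1, q2, q3⟩
            rcases Nat.lt_succ_iff_lt_or_eq.1 q1 with q1 | rfl
            · exact ⟨j, q1, q2, q3⟩
            · rw [← q2, ← hv] at q3
              exact absurd (hstv.eq_iff.2 q3) hmm
    have fin : ∀ (s' : Store α) (l : ℕ), Post s' l → ∀ l' ≤ l + 200,
        (1 ≤ s'.reg 6 ∧ s'.reg 6 ≤ N ∧ s'.reg 10 < s'.reg 6 ∧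
        (∀ j < s'.reg 6, s'.mem 6 (ord j) = dep (ord j) ∧
          IsState p m (ht (ord j)) (dep (ord j)) (s'.mem 7 (ord j)) (X (ord j))) ∧
        (∀ e < dep (ord (s'.reg 6 - 1)), s'.chr 2 e = some (X (ord (s'.reg 6 - 1)) e)) ∧
        ((List.range (s'.reg 10)).map (s'.mem 0)).Nodup ∧
        (∀ k, k ∈ (List.range (s'.reg 10)).map (s'.mem 0) ↔
          ∃ j < s'.reg 6, ord j = k ∧ MatchesAt p m dep X k) ∧
        ∃ F : ℕ → ℕ, F root = 0 ∧
          k1 + l' + 700 ≤ ∑ j ∈ Finset.range (s'.reg 6), (400 * F (ord j) + 700) ∧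
          ∀ j, 1 ≤ j → j < s'.reg 6 →
            F (ord j) + (s'.mem 7 (ord j) + ht (ord j) - m) ≤
              (s'.mem 7 (par (ord j)) + ht (par (ord j)) - m) + 1 ∧
            F (ord j) + (s'.mem 7 (ord j) + ht (ord j) - m) ≤ ht (ord j) + 1) ∧
        N - s'.reg 6 < N - s1.reg 6 := by
      rintro s' l ⟨y1, y2, y3, y4, y5, y6, y7, Fv, y8, y9, y10⟩ l' hl'
      rw [y1, show i + 2 - 1 = i + 1 from rfl, ← hv]
      refine ⟨⟨by omega, by omega, y2, y3, y4, y5, y6, Function.update F v Fv, ?_, ?_, ?_⟩,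
        by omega⟩
      · rw [Function.update_of_ne (Ne.symm hvr), i8]
      · rw [Finset.sum_range_succ, ← hv, Function.update_self]
        have : ∑ j ∈ Finset.range (i + 1), (400 * Function.update F v Fv (ord j) + 700) =
            ∑ j ∈ Finset.range (i + 1), (400 * F (ord j) + 700) := by
          refine Finset.sum_congr rfl fun j hj => ?_
          rw [Function.update_of_ne (hnev j (Finset.mem_range.1 hj))]
        rw [this]
        omega
      · intro j hj1 hj2
        rcases Nat.lt_succ_iff_lt_or_eq.1 hj2 with hj2 | rfl
        · obtain ⟨j, rfl⟩ : ∃ j', j = j' + 1 := ⟨j - 1, by omega⟩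
          obtain ⟨j', hj', hj'p⟩ := hO.exists_par hT (show j + 1 < N by omega)
          have e1 := hnev _ hj2
          have e2 := hnev j' (by omega)
          rw [hj'p] at e2
          rw [y7, Function.update_of_ne e1, Function.update_of_ne e1, Function.update_of_ne e2]
          exact i10 _ hj1 hj2
        · rw [← hv, ← hu, Function.update_self]
          have : s'.mem 7 u = s1.mem 7 u := by
            rw [y7, Function.update_of_ne hvu]
          rw [this]
          exact ⟨y9, y10⟩
    clear_value Post
    refine WP.mono (Q' := fun s' l => ∃ l0, Post s' l0 ∧ l + 4 ≤ l0 + 200) ?_ ?_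
    · simp [hi, m5, m1, hord _ hlt, ← hv, hpar _ hvN, ← hu, g1, c1, hlab v hvN hvr, r0, m13]
      refine ⟨by omega, ?_, ?_⟩
      · intro hq
        refine (main _ ?_ ?_ ?_ ?_ ?_ ?_ ?_ ?_ ?_ ?_ ?_ ?_ ?_ ?_ ?_ ?_).mono
          fun s' l _ h => ⟨l, h, by omega⟩ <;>
          simp [hi, r0, r1, hq0, restart, hq, c0, m4, m11, m12, m13]
      · intro hq
        refine (main _ ?_ ?_ ?_ ?_ ?_ ?_ ?_ ?_ ?_ ?_ ?_ ?_ ?_ ?_ ?_ ?_).mono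
          fun s' l _ h => ⟨l, h, by omega⟩ <;>
          simp [hi, r0, r1, hq0, restart, hq, c0, m4, m11, m12, m13]
    · rintro s' l _ ⟨l0, h, hl⟩
      exact fin s' l0 h _ (by simp only [Test.cost, Expr.cost]; omega)
  · intro hge
    simp only [Test.holds, Expr.val, r1, not_lt] at hge
    have h6 : s1.reg 6 = N := by omega
    rw [h6] at i4 i7 i9 i10
    rw [wp_block_nil]
    simp only [setReg_reg, setReg_mem, if_true]
    refine ⟨trivial, i6, fun k => ?_, ?_⟩
    · rw [i7]
      constructor
      · rintro ⟨j, q1, rfl, q2⟩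
        exact ⟨hO.lt j q1, q2⟩
      · rintro ⟨q1, q2⟩
        obtain ⟨j, hj, rfl⟩ := hO.surj k q1
        exact ⟨j, hj, rfl, q2⟩
    · have hsum : ∑ j ∈ Finset.range N, F (ord j) = ∑ v ∈ Finset.range N, F v := by
        refine Finset.sum_nbij ord ?_ ?_ ?_ fun _ _ => rfl
        · intro j hj
          exact Finset.mem_range.2 (hO.lt j (Finset.mem_range.1 hj))
        · intro j hj j' hj' he
          exact hO.inj j (by simpa using hj) j' (by simpa using hj') he
        · intro v hv
          obtain ⟨j, hj, rfl⟩ := hO.surj v (by simpa using hv)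
          exact ⟨j, by simpa using hj, rfl⟩
      have hbound := hH.sum_le (F := F) (pot := fun v => s1.mem 7 v + ht v - m) hT.par_lt i8
        (fun v hv hvr => by
          obtain ⟨j, hj, rfl⟩ := hO.surj v hv
          refine (i10 j (Nat.pos_of_ne_zero ?_) hj).1
          rintro rfl
          exact hvr ord0)
        (fun v hv hvr => by
          obtain ⟨j, hj, rfl⟩ := hO.surj v hv
          refine (i10 j (Nat.pos_of_ne_zero ?_) hj).2
          rintro rfl
          exact hvr ord0)
        (fun v hv => by
          obtain ⟨j, hj, rfl⟩ := hO.surj v hv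
          have := (i4 j hj).2.le
          omega)
      rw [Finset.sum_add_distrib, ← Finset.mul_sum, hsum] at i9
      simp only [Finset.sum_const, Finset.card_range, smul_eq_mul] at i9
      simp only [Test.cost, Expr.cost]
      omega

end Matching

/-! ### The matching program -/

section Trees

variable {α : Type u}

theorem DownPath.append {n : ℕ} {edge : Fin n → Option (Fin n × α)} {a b v : Fin n}
    {x y : List α} (h : DownPath edge a x b) (h' : DownPath edge b y v) :
    DownPath edge a (x ++ y) v := by
  induction h' with
  | nil => simpa using h
  | snoc _ he ih =>
    rw [← List.append_assoc]
    exact ih.snoc he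

theorem DownPath.split {n : ℕ} {edge : Fin n → Option (Fin n × α)} {a : Fin n} {x : List α}
    (y : List α) : ∀ {v : Fin n}, DownPath edge a (x ++ y) v →
      ∃ b, DownPath edge a x b ∧ DownPath edge b y v := by
  induction y using List.reverseRecOn with
  | nil =>
    intro v h
    exact ⟨v, by simpa using h, .nil v⟩
  | append_singleton y c ih =>
    intro v h
    rw [← List.append_assoc] at h
    generalize hz : x ++ y ++ [c] = z at h
    cases h with
    | nil => simp at hz
    | snoc h he =>
      obtain ⟨h1, h2⟩ := List.append_inj' hz rfl
      subst h1
      obtain rfl : c = _ := by simpa using h2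
      obtain ⟨b, hb, hb'⟩ := ih h
      exact ⟨b, hb, hb'.snoc he⟩

/-- Each node has at most one incoming edge and the start has none, so both paths can be peeled off
from the lower end in parallel. -/
theorem DownPath.unique {n : ℕ} {edge : Fin n → Option (Fin n × α)} {a v : Fin n}
    (ha : edge a = none) {x y : List α} (h : DownPath edge a x v) (h' : DownPath edge a y v) :
    x = y := by
  induction h generalizing y with
  | nil =>
    cases h' with
    | nil => rfl
    | snoc _ he => simp [ha] at he
  | snoc _ he ih =>
    cases h' with
    | nil => simp [ha] at he
    | snoc h1 he' =>
      rw [he] at he'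
      obtain ⟨rfl, rfl⟩ : _ = _ ∧ _ = _ := by simpa using he'
      rw [ih h1]

namespace LabelledTree

variable (T : LabelledTree α)

/-- The label of the path from the root to `v`. -/
noncomputable def pathLabel (v : Fin T.size) : List α := (T.reachable v).choose

theorem downPath_pathLabel (v : Fin T.size) : DownPath T.edge T.root (T.pathLabel v) v :=
  (T.reachable v).choose_spec

theorem eq_pathLabel {v : Fin T.size} {x : List α} (h : DownPath T.edge T.root x v) :
    x = T.pathLabel v :=
  h.unique T.edge_root (T.downPath_pathLabel v)

theorem pathLabel_root : T.pathLabel T.root = [] := (T.eq_pathLabel (.nil _)).symm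

theorem pathLabel_of_edge {v u : Fin T.size} {c : α} (h : T.edge v = some (u, c)) :
    T.pathLabel v = T.pathLabel u ++ [c] :=
  (T.eq_pathLabel ((T.downPath_pathLabel u).snoc h)).symm

theorem exists_edge {v : Fin T.size} (hv : v ≠ T.root) : ∃ u c, T.edge v = some (u, c) := by
  have := T.downPath_pathLabel v
  generalize T.pathLabel v = x at this
  cases this with
  | nil => exact absurd rfl hv
  | snoc _ he => exact ⟨_, _, he⟩

/-- The parent pointers of the tree, as in the input of the matching problem. -/
def parent (v : ℕ) : ℕ :=
  if h : v < T.size then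
    match T.edge ⟨v, h⟩ with
    | some (u, _) => u
    | none => v
  else 0

/-- The depths of the nodes. -/
noncomputable def depth (v : ℕ) : ℕ :=
  if h : v < T.size then (T.pathLabel ⟨v, h⟩).length else 0

/-- The labels on the path from the root to `v`. -/
noncomputable def label (c : α) (v i : ℕ) : α :=
  if h : v < T.size then ((T.pathLabel ⟨v, h⟩)[i]?).getD c else c

theorem parent_of_edge {v : ℕ} (hv : v < T.size) {u : Fin T.size} {c : α}
    (h : T.edge ⟨v, hv⟩ = some (u, c)) : T.parent v = u := by
  simp [parent, hv, h]

theorem treeShape : TreeShape T.size T.root T.parent T.depth where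
  root_lt := T.root.2
  par_root := by simp [parent, T.edge_root]
  dep_root := by simp [depth, T.pathLabel_root]
  par_lt v hv := by
    rcases h : T.edge ⟨v, hv⟩ with _ | ⟨u, c⟩
    · simp [parent, hv, h]
    · rw [T.parent_of_edge hv h]
      exact u.2
  dep_par v hv hvr := by
    obtain ⟨u, c, h⟩ := T.exists_edge (v := ⟨v, hv⟩) fun he => hvr (by simp [← he])
    rw [T.parent_of_edge hv h]
    simp [depth, hv, T.pathLabel_of_edge h]

theorem isPathLabels (c : α) : IsPathLabels T.size T.root T.parent T.depth (T.label c) := by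
  intro v hv hvr i hi
  obtain ⟨u, d, h⟩ := T.exists_edge (v := ⟨v, hv⟩) fun he => hvr (by simp [← he])
  rw [T.parent_of_edge hv h] at hi ⊢
  simp only [depth, u.2, dif_pos] at hi
  simp [label, hv, T.pathLabel_of_edge h, List.getElem?_append_left hi]

theorem edge_label (c : α) {v : ℕ} (hv : v < T.size) (hvr : v ≠ T.root) :
    (T.edge ⟨v, hv⟩).map Prod.snd = some (T.label c v (T.depth (T.parent v))) := by
  obtain ⟨u, d, h⟩ := T.exists_edge (v := ⟨v, hv⟩) fun he => hvr (by simp [← he])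
  rw [T.parent_of_edge hv h]
  simp [label, depth, hv, h, T.pathLabel_of_edge h]

end LabelledTree

variable [LinearOrder α]

theorem orderIsomorphic_drop_iff (c : α) {p l : List α} (h : p.length ≤ l.length) :
    OrderIsomorphic p (l.drop (l.length - p.length)) ↔
      OI (fun i => (p[i]?).getD c) (fun i => (l[i]?).getD c) (l.length - p.length) p.length := by
  have e : ∀ i, ∀ hi : i < p.length, (p[i]?).getD c = p[i] ∧
      ∀ hi' : i < (l.drop (l.length - p.length)).length,
        (l[l.length - p.length + i]?).getD c = (l.drop (l.length - p.length))[i] := by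
    intro i hi
    refine ⟨by simp [hi], fun hi' => ?_⟩
    rw [List.getElem_drop, List.getElem?_eq_getElem (by omega), Option.getD_some]
  have hlen : (l.drop (l.length - p.length)).length = p.length := by simp; omega
  constructor
  · rintro ⟨-, h2⟩ i hi j hj
    have := h2 i j hi hj (by omega) (by omega)
    simp only
    rwa [(e i hi).1, (e j hj).1, (e i hi).2 (by omega), (e j hj).2 (by omega)]
  · intro h2
    refine ⟨hlen.symm, fun i j hi hj hi' hj' => ?_⟩
    have := h2 i hi j hj
    simp only at this
    rwa [(e i hi).1, (e j hj).1, (e i hi).2 (by omega), (e j hj).2 (by omega)] at this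

/-- Extended upwards to the root, a path ending in `v` becomes the unique root path, so its label is
a suffix of that label; conversely every suffix is the label of a path. The character `c` only fills
the indices out of range. -/
theorem matchesAt_iff (c : α) (p : List α) (T : LabelledTree α) (v : Fin T.size) :
    MatchesAt (fun i => (p[i]?).getD c) p.length T.depth (T.label c) v ↔ IsMatchEnd p T v := by
  have e1 : T.depth v = (T.pathLabel v).length := by simp [LabelledTree.depth]
  have e2 : T.label c v = fun i => ((T.pathLabel v)[i]?).getD c := by
    funext i
    simp [LabelledTree.label]
  unfold MatchesAt
  rw [e1, e2]
  constructor
  · rintro ⟨h1, h2⟩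
    rw [← orderIsomorphic_drop_iff c h1] at h2
    have h3 := T.downPath_pathLabel v
    rw [← List.take_append_drop ((T.pathLabel v).length - p.length) (T.pathLabel v)] at h3
    obtain ⟨b, -, h4⟩ := h3.split
    exact ⟨b, _, h4, h2⟩
  · rintro ⟨a, x, h1, h2⟩
    have h3 := T.eq_pathLabel ((T.downPath_pathLabel a).append h1)
    have hlen := h2.1
    have hle : p.length ≤ (T.pathLabel v).length := by
      rw [← h3, List.length_append]
      omega
    refine ⟨hle, (orderIsomorphic_drop_iff c hle).1 ?_⟩
    rwa [← h3, List.length_append, hlen, Nat.add_sub_cancel, List.drop_left]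

/-- The matching program after the pattern has been sorted: the sorted positions of the pattern
are in the word array `100`. -/
def matchSorted : Program :=
  block [neighbourPhase, failurePhase, orderPhase, heightPhase, matchPhase]

/-- The store holds the input of the matching problem in the places that `matchSorted` reads. -/
structure HasInput (p : List α) (T : LabelledTree α) (s : Store α) : Prop where
  reg0 : s.reg 0 = p.length
  reg1 : s.reg 1 = T.size
  reg2 : s.reg 2 = T.root
  mem0 : s.mem 0 = (matchInput p T).mem 0
  chr0 : s.chr 0 = (matchInput p T).chr 0
  chr1 : s.chr 1 = (matchInput p T).chr 1

variable {w : ℕ} {code : α → Option ℕ} {s : Store α}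

theorem wp_matchSorted {p : List α} {T : LabelledTree α} {c : α} (hp : p ≠ [])
    (hs : HasInput p T s) (hsort : IsSorting (fun i => (p[i]?).getD c) p.length (s.mem 100))
    (hw : 4 * (p.length + T.size) + 4 < wordBound w) :
    WP w code matchSorted s fun s' l =>
      IsMatchOutput p T s' ∧ l ≤ 6000 * (p.length + T.size) := by
  have hm1 : 1 ≤ p.length := List.length_pos_iff.2 hp
  have hN1 : 0 < T.size := T.root.pos
  have hT := T.treeShape
  have hpc : ∀ i < p.length, (matchInput p T).chr 0 i = some ((p[i]?).getD c) := by
    intro i hi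
    simp [matchInput, hi]
  have hpar : ∀ v < T.size, (matchInput p T).mem 0 v = T.parent v := fun v hv => rfl
  have hlab : ∀ v < T.size, v ≠ T.root →
      (matchInput p T).chr 1 v = some (T.label c v (T.depth (T.parent v))) := by
    intro v hv hvr
    rw [← T.edge_label c hv hvr]
    simp [matchInput, hv]
  simp only [matchSorted, wp_block_cons, wp_block_nil]
  refine (wp_neighbourPhase hs.reg0 hsort (by omega)).mono ?_
  rintro s1 l1 F1 ⟨a1, a2⟩
  refine (wp_failurePhase (p := fun i => (p[i]?).getD c) (m := p.length)
    ((F1.reg 0 rfl).trans hs.reg0) hm1 (by rw [F1.chr 0 rfl, hs.chr0]; exact hpc) a1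
    (by omega)).mono ?_
  rintro s2 l2 F2 ⟨b1, b2⟩
  refine (wp_orderPhase (((F2.reg 1 rfl).trans (F1.reg 1 rfl)).trans hs.reg1)
    (((F2.reg 2 rfl).trans (F1.reg 2 rfl)).trans hs.reg2) hT
    (by rw [F2.mem 0 rfl, F1.mem 0 rfl, hs.mem0]; exact hpar) (by omega)).mono ?_
  rintro s3 l3 F3 ⟨c1, c2, c3, c4⟩
  have F13 := fun r h h' h'' => (F3.reg r h).trans ((F2.reg r h').trans (F1.reg r h''))
  refine (wp_heightPhase ((F13 1 rfl rfl rfl).trans hs.reg1) hT c1 (fun _ _ => rfl) c2 c3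
    (by omega)).mono ?_
  rintro s4 l4 F4 ⟨d1, d2⟩
  have G : ∀ a, _ → _ → s4.mem a = s2.mem a := fun a h h' => (F4.mem a h).trans (F3.mem a h')
  have G' : ∀ a, _ → _ → _ → _ → s4.chr a = s.chr a := fun a h h' h'' h''' =>
    (F4.chr a h).trans ((F3.chr a h').trans ((F2.chr a h'').trans (F1.chr a h''')))
  refine (wp_matchPhase (X := T.label c) (f := s2.mem 13) (ord := s3.mem 5)
    (((F4.reg 0 rfl).trans (F13 0 rfl rfl rfl)).trans hs.reg0)
    (((F4.reg 1 rfl).trans (F13 1 rfl rfl rfl)).trans hs.reg1)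
    (((F4.reg 2 rfl).trans (F13 2 rfl rfl rfl)).trans hs.reg2) hm1 hT c1 d1
    (T.isPathLabels c) ?_ ?_ ?_ b1 (G 13 rfl rfl) ?_ ?_ (fun _ _ => rfl) (by omega)).mono ?_
  · rw [G' 1 rfl rfl rfl rfl, hs.chr1]
    exact hlab
  · rw [G' 0 rfl rfl rfl rfl, hs.chr0]
    exact hpc
  · rw [G 11 rfl rfl, G 12 rfl rfl, F2.mem 11 rfl, F2.mem 12 rfl]
    exact a1
  · rw [F4.mem 5 rfl]
    exact fun _ _ => rfl
  · rw [F4.mem 1 rfl]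
    exact c2
  · rintro s5 l5 - ⟨e1, e2, e3⟩
    refine ⟨⟨e1, fun k => ?_⟩, by omega⟩
    rw [e2]
    constructor
    · rintro ⟨h1, h2⟩
      exact ⟨⟨k, h1⟩, rfl, (matchesAt_iff c p T ⟨k, h1⟩).1 h2⟩
    · rintro ⟨v, rfl, h2⟩
      exact ⟨v.2, (matchesAt_iff c p T v).2 h2⟩

end Trees

/-! ### Sorting as a subroutine -/

section Shift

/-- The expression with all registers and arrays renumbered. -/
def Expr.shift (d : ℕ) : Expr → Expr
  | .const c => .const c
  | .reg x => .reg (x + d)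
  | .bin o e f => .bin o (e.shift d) (f.shift d)
  | .load a e => .load (a + d) (e.shift d)
  | .code a e => .code (a + d) (e.shift d)

/-- The test with all registers and arrays renumbered. -/
def Test.shift (d : ℕ) : Test → Test
  | .lt e f => .lt (e.shift d) (f.shift d)
  | .eq e f => .eq (e.shift d) (f.shift d)
  | .chrLe a e b f => .chrLe (a + d) (e.shift d) (b + d) (f.shift d)
  | .not t => .not (t.shift d)
  | .and t t' => .and (t.shift d) (t'.shift d)

/-- The program with all registers and arrays renumbered. -/
def Program.shift (d : ℕ) : Program → Program
  | .skip => .skip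
  | .setReg x e => .setReg (x + d) (e.shift d)
  | .setMem a e f => .setMem (a + d) (e.shift d) (f.shift d)
  | .copyChr a e b f => .copyChr (a + d) (e.shift d) (b + d) (f.shift d)
  | .seq P Q => .seq (P.shift d) (Q.shift d)
  | .ite t P Q => .ite (t.shift d) (P.shift d) (Q.shift d)
  | .loop t P => .loop (t.shift d) (P.shift d)

/-- The registers and arrays of `t` from number `d` on are those of `s`. -/
structure Embeds {α : Type u} (d : ℕ) (s t : Store α) : Prop where
  reg : ∀ x, t.reg (x + d) = s.reg x
  mem : ∀ a, t.mem (a + d) = s.mem a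
  chr : ∀ a, t.chr (a + d) = s.chr a

theorem Expr.cost_shift (d : ℕ) (e : Expr) : (e.shift d).cost = e.cost := by
  induction e <;> simp_all [Expr.shift]

theorem Test.cost_shift (d : ℕ) (t : Test) : (t.shift d).cost = t.cost := by
  induction t <;> simp_all [Test.shift, Expr.cost_shift]

theorem Program.wReg_shift {d r : ℕ} (h : r < d) (P : Program) : (P.shift d).wReg r = false := by
  induction P <;> simp_all [Program.shift, Program.wReg]
  omega

theorem Program.wMem_shift {d r : ℕ} (h : r < d) (P : Program) : (P.shift d).wMem r = false := by
  induction P <;> simp_all [Program.shift, Program.wMem]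
  omega

theorem Program.wChr_shift {d r : ℕ} (h : r < d) (P : Program) : (P.shift d).wChr r = false := by
  induction P <;> simp_all [Program.shift, Program.wChr]
  omega

variable {α : Type u} {w d : ℕ} {code : α → Option ℕ} {s t : Store α}

theorem Embeds.eval_expr (h : Embeds d s t) (e : Expr) :
    (e.shift d).eval w code t = e.eval w code s := by
  induction e <;> simp_all [Expr.shift, Expr.eval, h.reg, h.mem, h.chr]

theorem Embeds.eval_test [LinearOrder α] (h : Embeds d s t) (b : Test) :
    (b.shift d).eval w code t = b.eval w code s := by
  induction b <;> simp_all [Test.shift, Test.eval, h.eval_expr, h.chr]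

/-- Lets an unknown program work on a private part of the store at unchanged cost; the names below
`d` stay untouched by `Program.wReg_shift` and its analogues. -/
theorem Run.shift [LinearOrder α] {P : Program} {s' : Store α} {k : ℕ}
    (hr : Run w code P s s' k) :
    ∀ {t : Store α}, Embeds d s t → ∃ t', Run w code (P.shift d) t t' k ∧ Embeds d s' t' := by
  induction hr with
  | skip s => exact fun h => ⟨_, Run.skip _, h⟩
  | @setReg s x e v he =>
    intro t h
    refine ⟨t.setReg (x + d) v, ?_, fun y => ?_, h.mem, h.chr⟩
    · rw [← Expr.cost_shift d e]
      exact Run.setReg ((h.eval_expr e).trans he)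
    · simp [h.reg]
  | @setMem s a e f i v he hf =>
    intro t h
    refine ⟨t.setMem (a + d) i v, ?_, h.reg, fun b => ?_, h.chr⟩
    · rw [← Expr.cost_shift d e, ← Expr.cost_shift d f]
      exact Run.setMem ((h.eval_expr e).trans he) ((h.eval_expr f).trans hf)
    · simp [h.mem]
  | @copyChr s a b e f i j c he hf hc =>
    intro t h
    refine ⟨t.setChr (a + d) i c, ?_, h.reg, h.mem, fun b => ?_⟩
    · rw [← Expr.cost_shift d e, ← Expr.cost_shift d f]
      exact Run.copyChr ((h.eval_expr e).trans he) ((h.eval_expr f).trans hf) (by rw [h.chr, hc])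
    · simp [h.chr]
  | seq _ _ ih ih' =>
    intro t h
    obtain ⟨t1, r1, h1⟩ := ih h
    obtain ⟨t2, r2, h2⟩ := ih' h1
    exact ⟨t2, Run.seq r1 r2, h2⟩
  | @ite_true s s' b P Q k hb _ ih =>
    intro t h
    obtain ⟨t1, r1, h1⟩ := ih h
    rw [← Test.cost_shift d b]
    exact ⟨t1, Run.ite_true ((h.eval_test b).trans hb) r1, h1⟩
  | @ite_false s s' b P Q k hb _ ih =>
    intro t h
    obtain ⟨t1, r1, h1⟩ := ih h
    rw [← Test.cost_shift d b]
    exact ⟨t1, Run.ite_false ((h.eval_test b).trans hb) r1, h1⟩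
  | @loop_true s s' s'' b P k l hb _ _ ih ih' =>
    intro t h
    obtain ⟨t1, r1, h1⟩ := ih h
    obtain ⟨t2, r2, h2⟩ := ih' h1
    rw [← Test.cost_shift d b]
    exact ⟨t2, Run.loop_true ((h.eval_test b).trans hb) r1 r2, h2⟩
  | @loop_false s b P hb =>
    intro t h
    rw [← Test.cost_shift d b]
    exact ⟨t, Run.loop_false ((h.eval_test b).trans hb), h⟩

/-- A program changes at most one memory cell in each step. -/
theorem Run.exists_changed [LinearOrder α] {P : Program} {s' : Store α} {k : ℕ}
    (hr : Run w code P s s' k) : ∃ D : Finset (ℕ × ℕ), D.card ≤ k ∧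
      ∀ a i, (a, i) ∉ D → s'.mem a i = s.mem a i := by
  induction hr with
  | skip s => exact ⟨∅, by simp, fun _ _ _ => rfl⟩
  | setReg _ => exact ⟨∅, by simp, fun _ _ _ => rfl⟩
  | @setMem s a e f i v he hf =>
    refine ⟨{(a, i)}, by simp, fun b j hb => ?_⟩
    simp only [Finset.mem_singleton, Prod.mk.injEq, not_and] at hb
    rw [setMem_mem]
    split
    · rename_i hba
      subst hba
      rw [Function.update_of_ne (hb rfl)]
    · rfl
  | copyChr _ _ _ => exact ⟨∅, by simp, fun _ _ _ => rfl⟩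
  | seq _ _ ih ih' =>
    obtain ⟨D, h1, h2⟩ := ih
    obtain ⟨D', h1', h2'⟩ := ih'
    refine ⟨D ∪ D', (Finset.card_union_le _ _).trans (by omega), fun a i h => ?_⟩
    rw [Finset.notMem_union] at h
    rw [h2' a i h.2, h2 a i h.1]
  | ite_true _ _ ih =>
    obtain ⟨D, h1, h2⟩ := ih
    exact ⟨D, by omega, h2⟩
  | ite_false _ _ ih =>
    obtain ⟨D, h1, h2⟩ := ih
    exact ⟨D, by omega, h2⟩
  | loop_true _ _ _ ih ih' =>
    obtain ⟨D, h1, h2⟩ := ih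
    obtain ⟨D', h1', h2'⟩ := ih'
    refine ⟨D ∪ D', (Finset.card_union_le _ _).trans (by omega), fun a i h => ?_⟩
    rw [Finset.notMem_union] at h
    rw [h2' a i h.2, h2 a i h.1]
  | loop_false _ => exact ⟨∅, by simp, fun _ _ _ => rfl⟩

/-- Sorting takes at least linear time. -/
theorem SortsIn.length_le [LinearOrder α] {A : Program} {p : List α} {k : ℕ}
    (h : SortsIn w code A p k) : p.length ≤ k + 1 := by
  obtain ⟨s', hr, σ, h1, -⟩ := h
  obtain ⟨D, h2, h3⟩ := hr.exists_changed
  -- Memory starts at zero, so every cell whose final value is nonzero has been written. As the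
  -- values form a permutation, at most one of them is zero.
  have hsub : ((Finset.univ.filter fun i : Fin p.length => ¬ (σ i : ℕ) = 0).image
      fun i : Fin p.length => ((0 : ℕ), (i : ℕ))) ⊆ D := by
    intro x hx
    simp only [Finset.mem_image, Finset.mem_filter, Finset.mem_univ, true_and] at hx
    obtain ⟨i, hi, rfl⟩ := hx
    by_contra hD
    have := h3 _ _ hD
    rw [h1 i] at this
    exact hi this
  have hcard := Finset.card_le_card hsub
  rw [Finset.card_image_of_injective _ fun i j hij => by
    simp only [Prod.mk.injEq, true_and] at hij
    exact Fin.ext hij] at hcard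
  have hsplit := Finset.card_filter_add_card_filter_not
    (s := (Finset.univ : Finset (Fin p.length))) fun i => (σ i : ℕ) = 0
  have hone : (Finset.univ.filter fun i : Fin p.length => (σ i : ℕ) = 0).card ≤ 1 := by
    rw [Finset.card_le_one]
    intro i hi j hj
    simp only [Finset.mem_filter, Finset.mem_univ, true_and] at hi hj
    exact σ.injective (Fin.ext (hi.trans hj.symm))
  rw [Finset.card_univ, Fintype.card_fin] at hsplit
  omega

end Shift

/-! ### Matching with an arbitrary sorting program -/

section Subroutine

variable {α : Type u} [LinearOrder α] {w : ℕ} {code : α → Option ℕ} {s : Store α}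

theorem IsSortOutput.isSorting {p : List α} (h : IsSortOutput p s) (c : α) :
    IsSorting (fun i => (p[i]?).getD c) p.length (s.mem 0) := by
  obtain ⟨σ, h1, h2⟩ := h
  have e : ∀ r (hr : r < p.length), s.mem 0 r = σ ⟨r, hr⟩ := fun r hr => h1 ⟨r, hr⟩
  refine ⟨fun r hr => ?_, fun r hr r' hr' he => ?_, fun k hk => ?_, fun r r' hrr hr' => ?_⟩
  · rw [e r hr]
    exact (σ _).2
  · rw [e r hr, e r' hr'] at he
    simpa using σ.injective (Fin.ext he)
  · refine ⟨σ.symm ⟨k, hk⟩, (σ.symm _).2, ?_⟩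
    rw [h1, σ.apply_symm_apply]
  · have hr : r < p.length := hrr.trans_lt hr'
    have := h2 (show (⟨r, hr⟩ : Fin p.length) ≤ ⟨r', hr'⟩ from hrr)
    simp only [e r hr, e r' hr']
    simpa using this

theorem wordBound_of_pow {K n w : ℕ} (h : K * n ^ K ≤ 2 ^ w) : K * n ≤ wordBound w := by
  rcases Nat.eq_zero_or_pos K with rfl | hK
  · simp
  · exact (Nat.mul_le_mul_left K (Nat.le_self_pow hK.ne' n)).trans h

/-- The matching program that sorts the pattern by the program `A`. -/
def matchUsing (A : Program) : Program :=
  block [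
    .setReg 3 (.const 0),
    .loop (.lt (.reg 3) (.reg 0)) (block [
      .copyChr 100 (.reg 3) 0 (.reg 3),
      .setReg 3 (.bin .add (.reg 3) (.const 1))]),
    .setReg 100 (.reg 0),
    A.shift 100,
    matchSorted]

/-- Copying the pattern and matching cost `O(m + N)`; as `m ≤ t + 1` and `1 ≤ N`, this is `O(t +
N)`. -/
theorem solvesWithin_matchUsing {A : Program} {p : List α} {T : LabelledTree α} {t : ℕ}
    (hp : p ≠ []) (hw : 100 * (p.length + T.size) ^ 100 ≤ 2 ^ w)
    (hA : SortsIn w code A p t) :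
    SolvesWithin w code (matchUsing A) p T (20000 * (t + T.size)) := by
  have hlen := hA.length_le
  obtain ⟨sA, hrA, hsA⟩ := hA
  -- A character of the pattern serves as the default value that turns strings into functions on
  -- `ℕ`.
  obtain ⟨c, -⟩ := List.exists_mem_of_ne_nil p hp
  have hb := wordBound_of_pow hw
  have hm1 : 1 ≤ p.length := List.length_pos_iff.2 hp
  have hN1 : 0 < T.size := T.root.pos
  suffices h : WP w code (matchUsing A) (matchInput p T) fun s' l =>
      l ≤ 20000 * (t + T.size) ∧ IsMatchOutput p T s' by
    obtain ⟨s', l, h1, h2⟩ := h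
    exact ⟨s', l, h1, h2⟩
  simp only [matchUsing, wp_block_cons, wp_block_nil, wp_setReg, Expr.ok, Expr.val, Expr.cost]
  refine ⟨by omega, wp_loop (fun s' k => s'.reg 3 ≤ p.length ∧ k ≤ 20 * s'.reg 3 ∧
    (∀ i < s'.reg 3, s'.chr 100 i = p[i]?) ∧ ∀ i, s'.reg 3 ≤ i → s'.chr 100 i = none)
    (fun s' => p.length - s'.reg 3) (by simp [matchInput]) ?_⟩
  rintro s1 k1 F1 ⟨i1, i2, i3, i4⟩
  have r0 : s1.reg 0 = p.length := (F1.reg 0 rfl).trans (by simp [matchInput])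
  have c0 : s1.chr 0 = fun i => p[i]? := (F1.chr 0 rfl).trans (by funext i; simp [matchInput])
  refine ⟨by simp, ?_, ?_⟩
  · intro hlt
    simp only [Test.holds, Expr.val, r0] at hlt
    simp [c0, hlt, Test.cost]
    refine ⟨⟨by omega, by omega⟩, ⟨by omega, fun i hi => ?_, fun i hi => ?_⟩, by omega⟩
    · rcases hi.lt_or_eq with hi | rfl
      · rw [Function.update_of_ne hi.ne, i3 i hi]
      · simp [hlt]
    · rw [Function.update_of_ne (by omega), i4 i (by omega)]
  · intro hge
    simp only [Test.holds, Expr.val, r0, not_lt] at hge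
    have h3 : s1.reg 3 = p.length := by omega
    -- The matching input is blank from number `100` on, so with the copied pattern and its length
    -- this region is precisely a fresh sorting input.
    have hemb : Embeds 100 (sortInput p) (s1.setReg 100 (s1.reg 0)) := by
      refine ⟨fun x => ?_, fun a => ?_, fun a => ?_⟩
      · rcases x with _ | x
        · simp [sortInput, r0]
        · rw [setReg_reg, if_neg (by omega), F1.reg _ (by
            simp [Program.wReg, block])]
          simp [sortInput, matchInput]
      · rw [setReg_mem, F1.mem _ (by simp [Program.wMem, block])]
        simp [sortInput, matchInput]
      · rw [setReg_chr]
        rcases a with _ | a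
        · funext i
          simp only [sortInput, if_true, Nat.zero_add]
          by_cases hi : i < p.length
          · exact i3 i (by omega)
          · rw [i4 i (by omega), List.getElem?_eq_none (by omega)]
        · rw [F1.chr _ (by simp [Program.wChr, block])]
          simp [sortInput, matchInput]
    obtain ⟨s2, r2, e2⟩ := hrA.shift hemb
    refine ⟨trivial, WP.mono (Q' := fun s' l => s' = s2 ∧ l = t) ⟨s2, t, r2, rfl, rfl⟩ ?_⟩
    rintro _ _ F2 ⟨rfl, rfl⟩
    refine (wp_matchSorted (T := T) (c := c) hp ⟨?_, ?_, ?_, ?_, ?_, ?_⟩ ?_ (by omega)).mono ?_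
    · rw [F2.reg 0 (Program.wReg_shift (by decide) A)]
      simpa using r0
    · rw [F2.reg 1 (Program.wReg_shift (by decide) A)]
      simp [F1.reg 1 rfl, matchInput]
    · rw [F2.reg 2 (Program.wReg_shift (by decide) A)]
      simp [F1.reg 2 rfl, matchInput]
    · rw [F2.mem 0 (Program.wMem_shift (by decide) A)]
      simp [F1.mem 0 rfl]
    · rw [F2.chr 0 (Program.wChr_shift (by decide) A)]
      simp [F1.chr 0 rfl]
    · rw [F2.chr 1 (Program.wChr_shift (by decide) A)]
      simp [F1.chr 1 rfl]
    · rw [show 100 = 0 + 100 from rfl, e2.mem 0]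
      exact hsA.isSorting c
    · rintro s3 l3 - ⟨g1, g2⟩
      refine ⟨?_, g1⟩
      simp only [Test.cost, Expr.cost]
      omega

end Subroutine

/-! ### Merge sort -/

section MergeSort

/-- Merge the sorted factors of the word array `0` from register `4` to register `5` and from
register `7` to register `6` into the word array `1`, from register `3` on. -/
def merge : Program :=
  .loop (.lt (.reg 3) (.reg 6)) (block [
    .setReg 9 (.const 0),
    .ite (.lt (.reg 7) (.reg 6))
      (.ite (.lt (.reg 4) (.reg 5))
        (.ite (.chrLe 0 (.load 0 (.reg 4)) 0 (.load 0 (.reg 7))) .skip (.setReg 9 (.const 1)))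
        (.setReg 9 (.const 1)))
      .skip,
    .ite (.eq (.reg 9) (.const 0))
      (block [.setMem 1 (.reg 3) (.load 0 (.reg 4)), .setReg 4 (.bin .add (.reg 4) (.const 1))])
      (block [.setMem 1 (.reg 3) (.load 0 (.reg 7)), .setReg 7 (.bin .add (.reg 7) (.const 1))]),
    .setReg 3 (.bin .add (.reg 3) (.const 1))])

/-- Merge all pairs of neighbouring blocks whose width is in register `2`, and copy the result
back to the word array `0`. -/
def mergePass : Program :=
  block [
    .setReg 3 (.const 0),
    .loop (.lt (.reg 3) (.reg 0)) (block [
      .setReg 4 (.reg 3),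
      .setReg 5 (.bin .add (.reg 3) (.reg 2)),
      .ite (.lt (.reg 0) (.reg 5)) (.setReg 5 (.reg 0)) .skip,
      .setReg 6 (.bin .add (.reg 5) (.reg 2)),
      .ite (.lt (.reg 0) (.reg 6)) (.setReg 6 (.reg 0)) .skip,
      .setReg 7 (.reg 5),
      merge]),
    .setReg 3 (.const 0),
    .loop (.lt (.reg 3) (.reg 0)) (block [
      .setMem 0 (.reg 3) (.load 1 (.reg 3)),
      .setReg 3 (.bin .add (.reg 3) (.const 1))])]

/-- Bottom-up merge sort. -/
def mergeSort : Program :=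
  block [
    .setReg 1 (.const 0),
    .loop (.lt (.reg 1) (.reg 0)) (block [
      .setMem 0 (.reg 1) (.reg 1),
      .setReg 1 (.bin .add (.reg 1) (.const 1))]),
    .setReg 2 (.const 1),
    .loop (.lt (.reg 2) (.reg 0)) (block [
      mergePass,
      .setReg 2 (.bin .add (.reg 2) (.reg 2))])]

variable {α : Type u} [LinearOrder α] {w : ℕ} {code : α → Option ℕ} {s : Store α}

/-- The values of `A` at `0, …, n - 1` are sorted within blocks of width `W`. -/
def BlockSorted (p : ℕ → α) (W n : ℕ) (A : ℕ → ℕ) : Prop :=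
  ∀ a b, a ≤ b → b < n → a / W = b / W → p (A a) ≤ p (A b)

/-- The values of `B` at `0, …, n - 1` are below `m` and include those of `A` at the indices that
satisfy `I`. -/
structure Covers (m n : ℕ) (I : ℕ → Prop) (A B : ℕ → ℕ) : Prop where
  lt : ∀ o < n, B o < m
  cover : ∀ x, I x → ∃ o < n, B o = A x

theorem Covers.push {m n x : ℕ} {I I' : ℕ → Prop} {A B : ℕ → ℕ} (h : Covers m n I A B)
    (hx : A x < m) (hI : ∀ y, I' y → y = x ∨ I y) :
    Covers m (n + 1) I' A (Function.update B n (A x)) := by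
  refine ⟨fun o ho => ?_, fun y hy => ?_⟩
  · rcases Nat.lt_succ_iff_lt_or_eq.1 ho with ho | rfl
    · rw [Function.update_of_ne ho.ne]
      exact h.lt o ho
    · rwa [Function.update_self]
  · rcases hI y hy with rfl | hy
    · exact ⟨n, by omega, by rw [Function.update_self]⟩
    · obtain ⟨o, ho, e⟩ := h.cover y hy
      exact ⟨o, by omega, by rw [Function.update_of_ne ho.ne, e]⟩

theorem BlockSorted.push {p : ℕ → α} {W n e : ℕ} {B : ℕ → ℕ} (h : BlockSorted p W n B)
    (he : ∀ a < n, a / W = n / W → p (B a) ≤ p e) :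
    BlockSorted p W (n + 1) (Function.update B n e) := by
  intro a b hab hb hW
  rcases Nat.lt_succ_iff_lt_or_eq.1 hb with hb | rfl
  · rw [Function.update_of_ne (by omega), Function.update_of_ne hb.ne]
    exact h a b hab hb hW
  · rcases hab.lt_or_eq with hab | rfl
    · rw [Function.update_of_ne hab.ne, Function.update_self]
      exact he a hab hW
    · exact le_rfl

/-- Each character written since `lo` is at most every character not yet merged, so appending the
smaller head keeps the block sorted. By `hW`, earlier output belongs to other blocks of width `W`
and imposes no condition. -/
theorem wp_merge {p : ℕ → α} {m lo mid hi W : ℕ} {A : ℕ → ℕ} (hA : s.mem 0 = A)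
    (h3 : s.reg 3 = lo) (h4 : s.reg 4 = lo) (h5 : s.reg 5 = mid) (h6 : s.reg 6 = hi)
    (h7 : s.reg 7 = mid) (hlo : lo ≤ mid) (hmid : mid ≤ hi) (him : hi ≤ m)
    (hp : ∀ i < m, s.chr 0 i = some (p i)) (hAm : ∀ i < m, A i < m)
    (hl : ∀ x y, lo ≤ x → x ≤ y → y < mid → p (A x) ≤ p (A y))
    (hr : ∀ x y, mid ≤ x → x ≤ y → y < hi → p (A x) ≤ p (A y))
    (hW : ∀ a b, a < lo → lo ≤ b → b < hi → a / W ≠ b / W)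
    (hB : BlockSorted p W lo (s.mem 1)) (hC : Covers m lo (· < lo) A (s.mem 1))
    (hw : m + 1 < wordBound w) :
    WP w code merge s fun s' l => s'.reg 3 = hi ∧ BlockSorted p W hi (s'.mem 1) ∧
      Covers m hi (· < hi) A (s'.mem 1) ∧ l ≤ 60 * (hi - lo) + 60 := by
  refine wp_loop (fun s' k => lo ≤ s'.reg 4 ∧ s'.reg 4 ≤ mid ∧ mid ≤ s'.reg 7 ∧ s'.reg 7 ≤ hi ∧
    s'.reg 3 + mid = s'.reg 4 + s'.reg 7 ∧ BlockSorted p W (s'.reg 3) (s'.mem 1) ∧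
    Covers m (s'.reg 3) (fun x => x < s'.reg 4 ∨ (mid ≤ x ∧ x < s'.reg 7)) A (s'.mem 1) ∧
    (∀ a, lo ≤ a → a < s'.reg 3 → (∀ x, s'.reg 4 ≤ x → x < mid → p (s'.mem 1 a) ≤ p (A x)) ∧
      ∀ x, s'.reg 7 ≤ x → x < hi → p (s'.mem 1 a) ≤ p (A x)) ∧
    k ≤ 60 * (s'.reg 3 - lo)) (fun s' => hi - s'.reg 3) ?_ ?_
  · rw [h3, h4, h7]
    refine ⟨le_rfl, hlo, le_rfl, hmid, Nat.add_comm _ _ ▸ rfl, hB, ⟨hC.lt, fun x hx => ?_⟩,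
      fun a _ _ => by omega, by omega⟩
    exact hC.cover x (by omega)
  rintro s1 k ⟨F1, F2, F3⟩ ⟨i1, i2, i3, i4, i5, i6, i7, i8, i9⟩
  have r5 : s1.reg 5 = mid := (F1 5 rfl).trans h5
  have r6 : s1.reg 6 = hi := (F1 6 rfl).trans h6
  have m0 : s1.mem 0 = A := (F2 0 rfl).trans hA
  have c0 : s1.chr 0 = s.chr 0 := F3 0 rfl
  refine ⟨by simp, ?_, ?_⟩
  · intro hlt
    simp only [Test.holds, Expr.val, r6] at hlt
    have hlo3 : ∀ a < s1.reg 3, a / W = s1.reg 3 / W → lo ≤ a := by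
      intro a ha he
      by_contra hc
      exact hW a (s1.reg 3) (by omega) (by omega) hlt he
    have left : s1.reg 4 < mid → (∀ x, s1.reg 7 ≤ x → x < hi → p (A (s1.reg 4)) ≤ p (A x)) →
        BlockSorted p W (s1.reg 3 + 1) (Function.update (s1.mem 1) (s1.reg 3) (A (s1.reg 4))) ∧
        Covers m (s1.reg 3 + 1) (fun x => x < s1.reg 4 + 1 ∨ (mid ≤ x ∧ x < s1.reg 7)) A
          (Function.update (s1.mem 1) (s1.reg 3) (A (s1.reg 4))) ∧
        ∀ a, lo ≤ a → a < s1.reg 3 + 1 →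
          (∀ x, s1.reg 4 + 1 ≤ x → x < mid →
            p (Function.update (s1.mem 1) (s1.reg 3) (A (s1.reg 4)) a) ≤ p (A x)) ∧
          ∀ x, s1.reg 7 ≤ x → x < hi →
            p (Function.update (s1.mem 1) (s1.reg 3) (A (s1.reg 4)) a) ≤ p (A x) := by
      intro h1 h2
      refine ⟨i6.push fun a ha he => (i8 a (hlo3 a ha he) ha).1 _ le_rfl h1,
        i7.push (hAm _ (by omega)) fun y hy => by omega, fun a ha ha' => ?_⟩
      rcases Nat.lt_succ_iff_lt_or_eq.1 ha' with ha' | rfl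
      · rw [Function.update_of_ne ha'.ne]
        exact ⟨fun x hx => (i8 a ha ha').1 x (by omega), (i8 a ha ha').2⟩
      · rw [Function.update_self]
        exact ⟨fun x hx hx' => hl _ _ i1 (by omega) hx', h2⟩
    have right : s1.reg 7 < hi → (∀ x, s1.reg 4 ≤ x → x < mid → p (A (s1.reg 7)) ≤ p (A x)) →
        BlockSorted p W (s1.reg 3 + 1) (Function.update (s1.mem 1) (s1.reg 3) (A (s1.reg 7))) ∧
        Covers m (s1.reg 3 + 1) (fun x => x < s1.reg 4 ∨ (mid ≤ x ∧ x < s1.reg 7 + 1)) A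
          (Function.update (s1.mem 1) (s1.reg 3) (A (s1.reg 7))) ∧
        ∀ a, lo ≤ a → a < s1.reg 3 + 1 →
          (∀ x, s1.reg 4 ≤ x → x < mid →
            p (Function.update (s1.mem 1) (s1.reg 3) (A (s1.reg 7)) a) ≤ p (A x)) ∧
          ∀ x, s1.reg 7 + 1 ≤ x → x < hi →
            p (Function.update (s1.mem 1) (s1.reg 3) (A (s1.reg 7)) a) ≤ p (A x) := by
      intro h1 h2
      refine ⟨i6.push fun a ha he => (i8 a (hlo3 a ha he) ha).2 _ le_rfl h1,
        i7.push (hAm _ (by omega)) fun y hy => by omega, fun a ha ha' => ?_⟩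
      rcases Nat.lt_succ_iff_lt_or_eq.1 ha' with ha' | rfl
      · rw [Function.update_of_ne ha'.ne]
        exact ⟨(i8 a ha ha').1, fun x hx => (i8 a ha ha').2 x (by omega)⟩
      · rw [Function.update_self]
        exact ⟨h2, fun x hx hx' => hr _ _ i3 (by omega) hx'⟩
    refine WP.mono (Q' := fun s' l => s'.reg 3 = s1.reg 3 + 1 ∧ l ≤ 50 ∧
      ((s'.mem 1 = Function.update (s1.mem 1) (s1.reg 3) (A (s1.reg 4)) ∧
        s'.reg 4 = s1.reg 4 + 1 ∧ s'.reg 7 = s1.reg 7 ∧ s1.reg 4 < mid ∧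
        ∀ x, s1.reg 7 ≤ x → x < hi → p (A (s1.reg 4)) ≤ p (A x)) ∨
      (s'.mem 1 = Function.update (s1.mem 1) (s1.reg 3) (A (s1.reg 7)) ∧
        s'.reg 4 = s1.reg 4 ∧ s'.reg 7 = s1.reg 7 + 1 ∧ s1.reg 7 < hi ∧
        ∀ x, s1.reg 4 ≤ x → x < mid → p (A (s1.reg 7)) ≤ p (A x)))) ?_ ?_
    · have c4 : s1.reg 4 < mid → s.chr 0 (A (s1.reg 4)) = some (p (A (s1.reg 4))) := fun h =>
        hp _ (hAm _ (by omega))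
      have c7 : s1.reg 7 < hi → s.chr 0 (A (s1.reg 7)) = some (p (A (s1.reg 7))) := fun h =>
        hp _ (hAm _ (by omega))
      simp [r5, r6, m0, c0]
      refine ⟨by omega, fun h7 => ⟨fun h4 => ?_, fun h4 => ?_⟩, fun h7 => ?_⟩
      · simp [c4 h4, c7 h7]
        refine ⟨fun hle => ⟨by omega, by omega, by omega, h4, fun x hx hx' => ?_⟩,
          fun hle => ⟨by omega, by omega, by omega, by omega, h7, fun x hx hx' => ?_⟩⟩
        · exact hle.trans (hr _ _ i3 hx hx')
        · exact hle.le.trans (hl _ _ i1 hx hx')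
      · exact ⟨by omega, by omega, by omega, by omega, h7, fun x hx hx' => by omega⟩
      · exact ⟨by omega, by omega, by omega, by omega, fun x hx hx' => by omega⟩
    · rintro s' l - ⟨a1, a2, ⟨a3, a4, a5, a6, a7⟩ | ⟨a3, a4, a5, a6, a7⟩⟩
      · obtain ⟨b1, b2, b3⟩ := left a6 a7
        rw [a1, a3, a4, a5]
        refine ⟨⟨by omega, by omega, i3, i4, by omega, b1, b2, b3, ?_⟩, by omega⟩
        simp only [Test.cost, Expr.cost]
        omega
      · obtain ⟨b1, b2, b3⟩ := right a6 a7
        rw [a1, a3, a4, a5]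
        refine ⟨⟨by omega, by omega, by omega, by omega, by omega, b1, b2, b3, ?_⟩, by omega⟩
        simp only [Test.cost, Expr.cost]
        omega
  · intro hge
    simp only [Test.holds, Expr.val, r6, not_lt] at hge
    have h3' : s1.reg 3 = hi := by omega
    rw [h3'] at i6 i7 i9
    refine ⟨h3', i6, ⟨i7.lt, fun x hx => i7.cover x ?_⟩, ?_⟩
    · omega
    · simp only [Test.cost, Expr.cost]
      omega

theorem wp_mergePass {p : ℕ → α} {m W : ℕ} (hm : s.reg 0 = m) (hW : s.reg 2 = W) (hW1 : 1 ≤ W)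
    (hWm : W < m) (hp : ∀ i < m, s.chr 0 i = some (p i)) (hA : BlockSorted p W m (s.mem 0))
    (hC : Covers m m (· < m) id (s.mem 0)) (hw : 3 * m + 1 < wordBound w) :
    WP w code mergePass s fun s' l => BlockSorted p (2 * W) m (s'.mem 0) ∧
      Covers m m (· < m) id (s'.mem 0) ∧ l ≤ 300 * m := by
  simp only [mergePass, wp_block_cons, wp_setReg, Expr.ok, Expr.val, Expr.cost]
  refine ⟨by omega, wp_loop (fun s' k => s'.reg 3 ≤ m ∧
    (s'.reg 3 = m ∨ ∃ c, s'.reg 3 = c * (2 * W)) ∧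
    BlockSorted p (2 * W) (s'.reg 3) (s'.mem 1) ∧
    Covers m (s'.reg 3) (· < s'.reg 3) (s.mem 0) (s'.mem 1) ∧ k ≤ 200 * s'.reg 3)
    (fun s' => m - s'.reg 3) ?_ ?_⟩
  · simp only [setReg_reg, if_true]
    exact ⟨by omega, Or.inr ⟨0, by simp⟩, fun a b _ _ => by omega, ⟨fun o _ => by omega,
      fun x hx => by omega⟩, by omega⟩
  rintro s1 k1 F1 ⟨i1, i2, i3, i4, i5⟩
  have r0 : s1.reg 0 = m := (F1.reg 0 rfl).trans (by simp [hm])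
  have r2 : s1.reg 2 = W := (F1.reg 2 rfl).trans (by simp [hW])
  have m0 : s1.mem 0 = s.mem 0 := F1.mem 0 rfl
  have c0 : s1.chr 0 = s.chr 0 := F1.chr 0 rfl
  refine ⟨by simp, ?_, ?_⟩
  · intro hlt
    simp only [Test.holds, Expr.val, r0] at hlt
    obtain ⟨c, hc⟩ := i2.resolve_left hlt.ne
    have hc2 : c * (2 * W) = 2 * c * W := by ring
    have hc3 : (2 * c + 1) * W = 2 * c * W + W := by ring
    have hc4 : (2 * c + 1 + 1) * W = 2 * c * W + 2 * W := by ring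
    have hc5 : (c + 1) * (2 * W) = 2 * c * W + 2 * W := by ring
    have dl : ∀ x, s1.reg 3 ≤ x → x < s1.reg 3 + W → x / W = 2 * c := fun x h1 h2 =>
      Nat.div_eq_of_lt_le (by omega) (by omega)
    have dr : ∀ x, s1.reg 3 + W ≤ x → x < s1.reg 3 + 2 * W → x / W = 2 * c + 1 := fun x h1 h2 =>
      Nat.div_eq_of_lt_le (by omega) (by omega)
    have db : ∀ x, s1.reg 3 ≤ x → x < s1.reg 3 + 2 * W → x / (2 * W) = c := fun x h1 h2 =>
      Nat.div_eq_of_lt_le (by omega) (by omega)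
    have da : ∀ x, x < s1.reg 3 → x / (2 * W) < c := fun x h1 =>
      (Nat.div_lt_iff_lt_mul (by omega)).2 (by omega)
    have key : ∀ (s2 : Store α) (mid hi : ℕ), s2.reg 3 = s1.reg 3 → s2.reg 4 = s1.reg 3 →
        s2.reg 5 = mid → s2.reg 6 = hi → s2.reg 7 = mid → s2.mem 0 = s.mem 0 →
        s2.mem 1 = s1.mem 1 → s2.chr 0 = s.chr 0 → mid = min (s1.reg 3 + W) m →
        hi = min (s1.reg 3 + 2 * W) m →
        WP w code merge s2 fun s' l => s'.reg 3 = hi ∧ BlockSorted p (2 * W) hi (s'.mem 1) ∧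
          Covers m hi (· < hi) (s.mem 0) (s'.mem 1) ∧
          l ≤ 60 * (hi - s1.reg 3) + 60 := by
      intro s2 mid hi e3 e4 e5 e6 e7 e0 e1 ec hmid hhi
      refine wp_merge e0 e3 e4 e5 e6 e7 (by omega) (by omega) (by omega) (by rwa [ec]) hC.lt
        ?_ ?_ ?_ (by rwa [e1]) (by rwa [e1]) (by omega)
      · intro x y hx hxy hy
        exact hA x y hxy (by omega) (by rw [dl x hx (by omega), dl y (by omega) (by omega)])
      · intro x y hx hxy hy
        exact hA x y hxy (by omega) (by rw [dr x (by omega) (by omega),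
          dr y (by omega) (by omega)])
      · intro a b ha hb hb'
        rw [db b hb (by omega)]
        exact (da a ha).ne
    have fin : ∀ (s' : Store α) (l l' hi : ℕ), hi = min (s1.reg 3 + 2 * W) m →
        (s'.reg 3 = hi ∧ BlockSorted p (2 * W) hi (s'.mem 1) ∧
          Covers m hi (· < hi) (s.mem 0) (s'.mem 1) ∧ l ≤ 60 * (hi - s1.reg 3) + 60) →
        l' ≤ l + 80 →
        (s'.reg 3 ≤ m ∧ (s'.reg 3 = m ∨ ∃ c, s'.reg 3 = c * (2 * W)) ∧
          BlockSorted p (2 * W) (s'.reg 3) (s'.mem 1) ∧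
          Covers m (s'.reg 3) (· < s'.reg 3) (s.mem 0) (s'.mem 1) ∧
          k1 + l' ≤ 200 * s'.reg 3) ∧ m - s'.reg 3 < m - s1.reg 3 := by
      rintro s' l l' hi hhi ⟨h1, h2, h3, h4⟩ hl'
      rw [h1]
      refine ⟨⟨by omega, ?_, h2, h3, by omega⟩, by omega⟩
      rcases le_total m (s1.reg 3 + 2 * W) with h | h
      · exact Or.inl (by omega)
      · exact Or.inr ⟨c + 1, by omega⟩
    simp [r0, r2, Test.cost]
    refine ⟨by omega, fun h5 => ⟨by omega, fun h6 => ?_, fun h6 => ?_⟩,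
      fun h5 => ⟨by omega, fun h6 => ?_, fun h6 => ?_⟩⟩
    · refine (key _ m m ?_ ?_ ?_ ?_ ?_ ?_ ?_ ?_ (by omega) (by omega)).mono
        fun s' l _ h => by simpa using fin s' l _ m (by omega) h (by omega)
      all_goals simp [m0, c0]
    -- Impossible: the left block was cut off at `m`, so the tentative end `m + W` of the right
    -- block exceeds `m`.
    · exfalso
      omega
    · refine (key _ (s1.reg 3 + W) m ?_ ?_ ?_ ?_ ?_ ?_ ?_ ?_ (by omega) (by omega)).mono
        fun s' l _ h => by simpa using fin s' l _ m (by omega) h (by omega)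
      all_goals simp [m0, c0]
    · refine (key _ (s1.reg 3 + W) (s1.reg 3 + W + W) ?_ ?_ ?_ ?_ ?_ ?_ ?_ ?_ (by omega)
        (by omega)).mono
        fun s' l _ h => by simpa using fin s' l _ _ (by omega) h (by omega)
      all_goals simp [m0, c0]
  · intro hge
    simp only [Test.holds, Expr.val, r0, not_lt] at hge
    have h3 : s1.reg 3 = m := by omega
    rw [h3] at i3 i4 i5
    refine ⟨by omega, wp_loop (fun s' k => s'.reg 3 ≤ m ∧
      (∀ i < s'.reg 3, s'.mem 0 i = s1.mem 1 i) ∧ k ≤ 50 * s'.reg 3)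
      (fun s' => m - s'.reg 3) (by simp) ?_⟩
    rintro s2 k2 F2 ⟨j1, j2, j3⟩
    have r0' : s2.reg 0 = m := (F2.reg 0 rfl).trans (by simp [r0])
    have m1' : s2.mem 1 = s1.mem 1 := F2.mem 1 rfl
    refine ⟨by simp, ?_, ?_⟩
    · intro hlt
      simp only [Test.holds, Expr.val, r0'] at hlt
      simp [m1', Test.cost]
      refine ⟨⟨by omega, by omega⟩, ⟨by omega, fun i hi => ?_, by omega⟩, by omega⟩
      rcases hi.lt_or_eq with hi | rfl
      · rw [Function.update_of_ne hi.ne, j2 i hi]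
      · simp
    · intro hge'
      simp only [Test.holds, Expr.val, r0', not_lt] at hge'
      have h3' : s2.reg 3 = m := by omega
      rw [h3'] at j2 j3
      rw [wp_block_nil]
      refine ⟨fun a b hab hb hW => ?_, ⟨fun o ho => ?_, fun x hx => ?_⟩, ?_⟩
      · rw [j2 a (by omega), j2 b hb]
        exact i3 a b hab hb hW
      · rw [j2 o ho]
        exact i4.lt o ho
      · obtain ⟨o, ho, rfl⟩ := hC.cover x hx
        obtain ⟨o', ho', e⟩ := i4.cover o ho
        exact ⟨o', ho', by rw [j2 o' ho', e, id]⟩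
      · simp only [Test.cost, Expr.cost]
        omega

/-- It suffices to track that no position gets lost: a surjective self-map of a finite set is a
permutation. -/
theorem isSortOutput_of_covers {p : List α} {c : α}
    (hC : Covers p.length p.length (· < p.length) id (s.mem 0))
    (hs : ∀ a b, a ≤ b → b < p.length →
      (p[s.mem 0 a]?).getD c ≤ (p[s.mem 0 b]?).getD c) : IsSortOutput p s := by
  have hsurj : Function.Surjective fun i : Fin p.length =>
      (⟨s.mem 0 i, hC.lt i i.2⟩ : Fin p.length) := by
    intro k
    obtain ⟨o, ho, h⟩ := hC.cover k k.2
    exact ⟨⟨o, ho⟩, Fin.ext h⟩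
  refine ⟨Equiv.ofBijective _ ⟨Finite.injective_iff_surjective.2 hsurj, hsurj⟩,
    fun i => rfl, fun i j hij => ?_⟩
  have := hs i j hij j.2
  have hi := hC.lt i i.2
  have hj := hC.lt j j.2
  simpa [Equiv.ofBijective, hi, hj] using this

theorem sortsIn_mergeSort {p : List α} (hp : p ≠ []) (hw : 100 * p.length ≤ wordBound w) :
    ∃ t, SortsIn w code mergeSort p t ∧ t ≤ 2000 * (p.length * Nat.log 2 p.length + 1) := by
  obtain ⟨c, -⟩ := List.exists_mem_of_ne_nil p hp
  have hm1 : 1 ≤ p.length := List.length_pos_iff.2 hp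
  have hpc : ∀ i < p.length, (sortInput p).chr 0 i = some ((p[i]?).getD c) := by
    intro i hi
    simp [sortInput, hi]
  suffices h : WP w code mergeSort (sortInput p) fun s' l =>
      IsSortOutput p s' ∧ l ≤ 2000 * (p.length * Nat.log 2 p.length + 1) by
    obtain ⟨s', l, h1, h2, h3⟩ := h
    exact ⟨l, ⟨s', h1, h2⟩, h3⟩
  set m := p.length with hm
  simp only [mergeSort, wp_block_cons, wp_setReg, Expr.ok, Expr.val, Expr.cost]
  refine ⟨by omega, wp_loop (fun s' k => s'.reg 1 ≤ m ∧ (∀ i < s'.reg 1, s'.mem 0 i = i) ∧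
    k ≤ 50 * s'.reg 1) (fun s' => m - s'.reg 1) (by simp) ?_⟩
  rintro s1 k1 F1 ⟨i1, i2, i3⟩
  have r0 : s1.reg 0 = m := (F1.reg 0 rfl).trans (by simp [sortInput, hm])
  have c0 : s1.chr 0 = (sortInput p).chr 0 := F1.chr 0 rfl
  refine ⟨by simp, ?_, ?_⟩
  · intro hlt
    simp only [Test.holds, Expr.val, r0] at hlt
    simp [Test.cost]
    refine ⟨⟨by omega, by omega⟩, ⟨by omega, fun i hi => ?_, by omega⟩, by omega⟩
    rcases hi.lt_or_eq with hi | rfl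
    · rw [Function.update_of_ne hi.ne, i2 i hi]
    · simp
  intro hge
  simp only [Test.holds, Expr.val, r0, not_lt] at hge
  have h1 : s1.reg 1 = m := by omega
  rw [h1] at i2 i3
  refine ⟨by omega, wp_loop (fun s' k => BlockSorted (fun i => (p[i]?).getD c) (s'.reg 2) m
    (s'.mem 0) ∧ Covers m m (· < m) id (s'.mem 0) ∧ ∃ e, s'.reg 2 = 2 ^ e ∧
    (e = 0 ∨ 2 ^ (e - 1) < m) ∧ k ≤ 400 * (e * m)) (fun s' => m - s'.reg 2) ?_ ?_⟩
  · refine ⟨fun a b _ _ hW => ?_, ⟨fun o ho => ?_, fun x hx => ⟨x, hx, ?_⟩⟩, 0, by simp, by simp,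
      by simp⟩
    · obtain rfl : a = b := by simpa using hW
      exact le_rfl
    · simpa [i2 o ho] using ho
    · simp [i2 x hx]
  rintro s2 k2 F2 ⟨j1, j2, e, j3, j4, j5⟩
  have r0' : s2.reg 0 = m := (F2.reg 0 rfl).trans (by simp [r0])
  have c0' : s2.chr 0 = (sortInput p).chr 0 := (F2.chr 0 rfl).trans c0
  have hpos : 1 ≤ s2.reg 2 := by
    rw [j3]
    exact Nat.one_le_two_pow
  refine ⟨by simp, ?_, ?_⟩
  · intro hlt
    simp only [Test.holds, Expr.val, r0'] at hlt
    rw [wp_block_cons]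
    refine (wp_mergePass (p := fun i => (p[i]?).getD c) r0' rfl hpos hlt (by rwa [c0']) j1 j2
      (by omega)).mono ?_
    rintro s3 l3 F3 ⟨g1, g2, g3⟩
    have r2' : s3.reg 2 = s2.reg 2 := F3.reg 2 rfl
    simp [r2', Test.cost]
    refine ⟨by omega, ⟨by rwa [← two_mul], g2, e + 1, by rw [j3]; ring, Or.inr ?_, ?_⟩, by omega⟩
    · rwa [Nat.add_sub_cancel, ← j3]
    · rw [Nat.add_mul]
      omega
  · intro hge'
    simp only [Test.holds, Expr.val, r0', not_lt] at hge'
    rw [wp_block_nil]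
    refine ⟨isSortOutput_of_covers j2 fun a b hab hb => j1 a b hab hb ?_, ?_⟩
    · rw [Nat.div_eq_of_lt (by omega), Nat.div_eq_of_lt (by omega)]
    · have hlog : e * m ≤ 2 * (m * Nat.log 2 m) := by
        rcases j4 with rfl | h
        · simp
        · have h2 : e - 1 ≤ Nat.log 2 m := Nat.le_log_of_pow_le (by decide) h.le
          rcases Nat.eq_zero_or_pos e with rfl | he
          · simp
          · rcases Nat.lt_or_ge e 2 with he2 | he2
            · obtain rfl : e = 1 := by omega
              have : 1 ≤ Nat.log 2 m := by
                refine Nat.le_log_of_pow_le (by decide) ?_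
                simp at h
                omega
              nlinarith
            · have : e ≤ 2 * Nat.log 2 m := by omega
              nlinarith
      have hmm : m ≤ m * Nat.log 2 m + 1 := by
        rcases Nat.lt_or_ge m 2 with h | h
        · omega
        · have : 1 ≤ Nat.log 2 m := Nat.le_log_of_pow_le (by decide) (by simpa using h)
          nlinarith
      simp only [Test.cost, Expr.cost]
      omega

end MergeSort

/-! ### Radix sort -/

section RadixSort

/-- The list `l` is linked by `nxt`, with first element `h` and end marker `m`. -/
def Chained (m : ℕ) (nxt : ℕ → ℕ) : ℕ → List ℕ → Prop
  | h, [] => h = m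
  | h, x :: l => h = x ∧ Chained m nxt (nxt x) l

theorem Chained.update {m : ℕ} {nxt : ℕ → ℕ} {y v : ℕ} : ∀ {h : ℕ} {l : List ℕ},
    Chained m nxt h l → y ∉ l → Chained m (Function.update nxt y v) h l
  | _, [], h, _ => h
  | _, x :: l, h, hy => by
    refine ⟨h.1, ?_⟩
    rw [Function.update_of_ne fun e => hy (by simp [e])]
    exact h.2.update fun e => hy (List.mem_cons_of_mem _ e)

/-- The cells of `f` from `0` on hold the list `l`. -/
def Holds (f : ℕ → ℕ) (l : List ℕ) : Prop := ∀ i (h : i < l.length), f i = l[i]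

theorem Holds.push {f : ℕ → ℕ} {l : List ℕ} {x : ℕ} (h : Holds f l) :
    Holds (Function.update f l.length x) (l ++ [x]) := by
  intro i hi
  rw [List.length_append, List.length_singleton] at hi
  rcases Nat.lt_succ_iff_lt_or_eq.1 hi with hi | rfl
  · rw [Function.update_of_ne hi.ne, h i hi, List.getElem_append_left]
  · simp

/-- Stable distribution of the list `L` by the digits `g` below `b`. -/
def distribute (b : ℕ) (g : ℕ → ℕ) (L : List ℕ) : List ℕ :=
  (List.range b).flatMap fun d => L.filter fun x => g x = d

theorem distribute_succ (b : ℕ) (g : ℕ → ℕ) (L : List ℕ) :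
    distribute (b + 1) g L = distribute b g L ++ L.filter fun x => g x = b := by
  simp [distribute, List.range_succ, List.flatMap_append]

theorem distribute_length_mono {d b : ℕ} {g : ℕ → ℕ} {L : List ℕ} (h : d ≤ b) :
    (distribute d g L).length ≤ (distribute b g L).length := by
  induction h with
  | refl => exact le_rfl
  | step _ ih =>
    rw [distribute_succ, List.length_append]
    exact ih.trans (Nat.le_add_right _ _)

theorem distribute_perm {b : ℕ} {g : ℕ → ℕ} {L : List ℕ} (hL : L.Nodup) (hg : ∀ x ∈ L, g x < b) :
    (distribute b g L).Perm L := by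
  refine (List.perm_ext_iff_of_nodup ?_ hL).2 fun x => ?_
  · refine List.nodup_flatMap.2 ⟨fun d _ => hL.filter _, ?_⟩
    refine List.nodup_range.imp fun {d d'} hne => ?_
    intro x hx hx'
    simp only [List.mem_filter, decide_eq_true_eq] at hx hx'
    exact hne (hx.2.symm.trans hx'.2)
  · simp only [distribute, List.mem_flatMap, List.mem_range, List.mem_filter, decide_eq_true_eq]
    constructor
    · rintro ⟨d, -, h, -⟩
      exact h
    · exact fun h => ⟨g x, hg x h, h, rfl⟩

/-- The residue modulo `b ^ (j + 1)` is the old residue plus `b ^ j` times the new digit: within a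
bucket stability keeps the old order, and across buckets the digit outweighs the residue. -/
theorem distribute_sorted {b j : ℕ} {key : ℕ → ℕ} {L : List ℕ} (hb : 0 < b)
    (hL : L.Pairwise fun x y => key x % b ^ j ≤ key y % b ^ j) :
    (distribute b (fun x => key x / b ^ j % b) L).Pairwise
      fun x y => key x % b ^ (j + 1) ≤ key y % b ^ (j + 1) := by
  refine List.pairwise_flatMap.2 ⟨fun d _ => ?_, ?_⟩
  · rw [List.pairwise_filter]
    refine hL.imp fun {x y} h hx hy => ?_
    simp only [decide_eq_true_eq] at hx hy
    rw [Nat.mod_pow_succ, Nat.mod_pow_succ, hx, hy]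
    exact Nat.add_le_add_right h _
  · refine List.pairwise_lt_range.imp fun {d d'} hlt x hx y hy => ?_
    simp only [List.mem_filter, decide_eq_true_eq] at hx hy
    rw [Nat.mod_pow_succ, Nat.mod_pow_succ, hx.2, hy.2]
    have h1 := Nat.mod_lt (key x) (Nat.pow_pos (n := j) hb)
    have h2 : b ^ j * (d + 1) ≤ b ^ j * d' := Nat.mul_le_mul_left _ hlt
    rw [Nat.mul_add, Nat.mul_one] at h2
    exact (by omega : _ ≤ b ^ j * d').trans (Nat.le_add_left _ _)

/-- Stable distribution of the positions in the word array `100` by the digits of the characters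
at the place value in register `4`; the base is in register `5`. -/
def radixPass : Program :=
  block [
    .setReg 3 (.const 0),
    .loop (.lt (.reg 3) (.reg 5)) (block [
      .setMem 101 (.reg 3) (.reg 0),
      .setReg 3 (.bin .add (.reg 3) (.const 1))]),
    .setReg 3 (.reg 0),
    .loop (.lt (.const 0) (.reg 3)) (block [
      .setReg 3 (.bin .sub (.reg 3) (.const 1)),
      .setReg 6 (.load 100 (.reg 3)),
      .setReg 7 (.bin .mod (.bin .div (.code 0 (.reg 6)) (.reg 4)) (.reg 5)),
      .setMem 102 (.reg 6) (.load 101 (.reg 7)),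
      .setMem 101 (.reg 7) (.reg 6)]),
    .setReg 8 (.const 0),
    .loop (.lt (.reg 3) (.reg 5)) (block [
      .setReg 6 (.load 101 (.reg 3)),
      .loop (.lt (.reg 6) (.reg 0)) (block [
        .setMem 100 (.reg 8) (.reg 6),
        .setReg 8 (.bin .add (.reg 8) (.const 1)),
        .setReg 6 (.load 102 (.reg 6))]),
      .setReg 3 (.bin .add (.reg 3) (.const 1))]),
    .setReg 4 (.bin .mul (.reg 4) (.reg 5))]

variable {w : ℕ} {s : Store ℕ}

/-- Buckets are linked lists with heads in the array `101` and links in `102`; the value `m`, which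
is no position, marks the end. Scanning backwards and inserting at the front makes the distribution
stable. -/
theorem wp_radixPass {m b D : ℕ} {key : ℕ → ℕ} {L : List ℕ} (hm : s.reg 0 = m) (hb : s.reg 5 = b)
    (hD : s.reg 4 = D) (hb0 : 0 < b) (hp : ∀ i < m, s.chr 0 i = some (key i))
    (hkey : ∀ i < m, key i < wordBound w) (hL : L.Perm (List.range m)) (hs : Holds (s.mem 100) L)
    (hw : m + b + 1 < wordBound w) (hDw : D * b < wordBound w) :
    WP w some radixPass s fun s' l =>
      Holds (s'.mem 100) (distribute b (fun x => key x / D % b) L) ∧ s'.reg 4 = D * b ∧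
        l ≤ 200 * (m + b) + 200 := by
  have hlen : L.length = m := by simpa using hL.length_eq
  have hmem : ∀ x, x ∈ L ↔ x < m := fun x => by simpa using hL.mem_iff (a := x)
  have hnd : L.Nodup := hL.nodup_iff.2 List.nodup_range
  set g : ℕ → ℕ := fun x => key x / D % b with hg
  have hgb : ∀ x, g x < b := fun x => Nat.mod_lt _ hb0
  simp only [radixPass, wp_block_cons, wp_setReg, Expr.ok, Expr.val, Expr.cost]
  refine ⟨by omega, wp_loop (fun s' k => s'.reg 3 ≤ b ∧ (∀ d < s'.reg 3, s'.mem 101 d = m) ∧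
    k ≤ 50 * s'.reg 3) (fun s' => b - s'.reg 3) (by simp) ?_⟩
  rintro s1 k1 F1 ⟨i1, i2, i3⟩
  have r0 : s1.reg 0 = m := (F1.reg 0 rfl).trans (by simp [hm])
  have r4 : s1.reg 4 = D := (F1.reg 4 rfl).trans (by simp [hD])
  have r5 : s1.reg 5 = b := (F1.reg 5 rfl).trans (by simp [hb])
  have c0 : s1.chr 0 = s.chr 0 := F1.chr 0 rfl
  have m100 : s1.mem 100 = s.mem 100 := F1.mem 100 rfl
  refine ⟨by simp, ?_, ?_⟩
  · intro hlt
    simp only [Test.holds, Expr.val, r5] at hlt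
    simp [r0, Test.cost]
    refine ⟨⟨by omega, by omega⟩, ⟨by omega, fun d hd => ?_, by omega⟩, by omega⟩
    rcases hd.lt_or_eq with hd | rfl
    · rw [Function.update_of_ne hd.ne, i2 d hd]
    · simp
  intro hge
  simp only [Test.holds, Expr.val, r5, not_lt] at hge
  have h3 : s1.reg 3 = b := by omega
  rw [h3] at i2 i3
  refine ⟨trivial, wp_loop (fun s' k => s'.reg 3 ≤ m ∧ (∀ d < b, Chained m (s'.mem 102)
    (s'.mem 101 d) ((L.drop (s'.reg 3)).filter fun x => g x = d)) ∧ k + 50 * s'.reg 3 ≤ 50 * m)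
    (fun s' => s'.reg 3) ?_ ?_⟩
  · simp only [setReg_reg, if_true, r0, setReg_mem]
    refine ⟨le_rfl, fun d hd => ?_, by omega⟩
    rw [List.drop_of_length_le (by omega)]
    exact i2 d hd
  rintro s2 k2 F2 ⟨j1, j2, j3⟩
  have r0' : s2.reg 0 = m := (F2.reg 0 rfl).trans (by simp [r0])
  have r4' : s2.reg 4 = D := (F2.reg 4 rfl).trans (by simp [r4])
  have r5' : s2.reg 5 = b := (F2.reg 5 rfl).trans (by simp [r5])
  have c0' : s2.chr 0 = s.chr 0 := (F2.chr 0 rfl).trans c0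
  have m100' : s2.mem 100 = s.mem 100 := (F2.mem 100 rfl).trans m100
  refine ⟨by simp; omega, ?_, ?_⟩
  · intro hlt
    simp only [Test.holds, Expr.val] at hlt
    obtain ⟨i, hi⟩ : ∃ i, s2.reg 3 = i + 1 := ⟨s2.reg 3 - 1, by omega⟩
    rw [hi] at j1 j2 j3
    have hiL : i < L.length := by omega
    have hx : s.mem 100 i = L[i] := hs i hiL
    have hxm : L[i] < m := (hmem _).1 (List.getElem_mem hiL)
    have hgx : key L[i] / D % b = g L[i] := rfl
    have hgx' := hgb L[i]
    have hkx := hkey _ hxm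
    have hdiv : key L[i] / D ≤ key L[i] := Nat.div_le_self _ _
    have hdrop : L.drop i = L[i] :: L.drop (i + 1) := List.drop_eq_getElem_cons hiL
    have hnot : L[i] ∉ L.drop (i + 1) := by
      have := hnd.sublist (List.drop_sublist i L)
      rw [hdrop] at this
      exact (List.nodup_cons.1 this).1
    simp [hi, m100', hx, c0', hp _ hxm, r4', r5', hgx, Test.cost]
    refine ⟨⟨by omega, by omega⟩, ⟨⟨hkx, by omega⟩, by omega⟩, by omega, fun d hd => ?_, by omega⟩
    rw [hdrop, List.filter_cons]
    by_cases hgd : g L[i] = d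
    · subst hgd
      simp only [decide_true, if_true, Function.update_self]
      exact ⟨rfl, by
        rw [Function.update_self]
        exact (j2 _ hd).update fun h => hnot (List.mem_filter.1 h).1⟩
    · rw [Function.update_of_ne (Ne.symm hgd)]
      simp only [hgd, decide_false, if_false, Bool.false_eq_true]
      exact (j2 _ hd).update fun h => hnot (List.mem_filter.1 h).1
  intro hge
  simp only [Test.holds, Expr.val, not_lt] at hge
  have h3 : s2.reg 3 = 0 := by omega
  rw [h3] at j2 j3
  rw [List.drop_zero] at j2
  have hpermD := distribute_perm (b := b) (g := g) hnd fun x _ => hgb x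
  have hlenD : ∀ d ≤ b, (distribute d g L).length ≤ m := by
    intro d hd
    have := distribute_length_mono (g := g) (L := L) hd
    rw [hpermD.length_eq, hlen] at this
    exact this
  refine ⟨by omega, wp_loop (fun s' k => s'.reg 3 ≤ b ∧ Holds (s'.mem 100)
    (distribute (s'.reg 3) g L) ∧ s'.reg 8 = (distribute (s'.reg 3) g L).length ∧
    k ≤ 50 * s'.reg 3 + 50 * s'.reg 8) (fun s' => b - s'.reg 3) ?_ ?_⟩
  · simp [h3, distribute, Holds]
  rintro s3 k3 F3 ⟨l1, l2, l3, l4⟩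
  have r0'' : s3.reg 0 = m := (F3.reg 0 rfl).trans (by simp [r0'])
  have r4'' : s3.reg 4 = D := (F3.reg 4 rfl).trans (by simp [r4'])
  have r5'' : s3.reg 5 = b := (F3.reg 5 rfl).trans (by simp [r5'])
  have m101 : s3.mem 101 = s2.mem 101 := F3.mem 101 rfl
  have m102 : s3.mem 102 = s2.mem 102 := F3.mem 102 rfl
  refine ⟨by simp, ?_, ?_⟩
  · intro hlt
    simp only [Test.holds, Expr.val, r5''] at hlt
    simp only [wp_block_cons, wp_setReg, Expr.ok, Expr.val, Expr.cost, m101]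
    have hsucc := distribute_succ (s3.reg 3) g L
    have hlenS := hlenD (s3.reg 3 + 1) hlt
    rw [hsucc, List.length_append] at hlenS
    -- The bucket is split into the part already emitted and the part still linked. Overwriting the
    -- array `100` is safe, as its old contents now live in the links.
    refine ⟨trivial, wp_loop (fun s' k => ∃ done rest : List ℕ,
      (L.filter fun x => g x = s3.reg 3) = done ++ rest ∧ Chained m (s2.mem 102) (s'.reg 6) rest ∧
      s'.reg 8 = (distribute (s3.reg 3) g L ++ done).length ∧
      Holds (s'.mem 100) (distribute (s3.reg 3) g L ++ done) ∧ k ≤ 50 * done.length)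
      (fun s' => m - s'.reg 8) ?_ ?_⟩
    · refine ⟨[], L.filter fun x => g x = s3.reg 3, rfl, ?_, by simpa using l3, by simpa using l2,
        by simp⟩
      simpa using j2 _ hlt
    rintro s4 k4 F4 ⟨done, rest, n1, n2, n3, n4, n5⟩
    have q0 : s4.reg 0 = m := (F4.reg 0 rfl).trans (by simp [r0''])
    have q3 : s4.reg 3 = s3.reg 3 := (F4.reg 3 rfl).trans (by simp)
    have q102 : s4.mem 102 = s2.mem 102 := (F4.mem 102 rfl).trans m102
    rw [n1, List.length_append] at hlenS
    rw [List.length_append] at n3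
    refine ⟨by simp, ?_, ?_⟩
    · intro hlt'
      simp only [Test.holds, Expr.val, q0] at hlt'
      rcases rest with _ | ⟨x, rest⟩
      · exact absurd n2 hlt'.ne
      obtain ⟨e1, e2⟩ := n2
      rw [List.length_cons] at hlenS
      simp only [wp_block_cons, wp_setMem, wp_setReg, wp_block_nil, Expr.ok, Expr.val, Expr.cost,
        BinOp.eval, setMem_reg, setReg_reg, setMem_mem, setReg_mem, e1, q102, Test.cost]
      simp only [show (102 : ℕ) ≠ 100 by decide, show (6 : ℕ) ≠ 8 by decide,
        show (8 : ℕ) ≠ 6 by decide, if_true, if_false]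
      refine ⟨trivial, trivial, ⟨trivial, by omega, by omega⟩, trivial,
        ⟨done ++ [x], rest, by simp [n1], e2, ?_, ?_, ?_⟩, by omega⟩
      · simp only [List.length_append, List.length_singleton]
        omega
      · rw [← List.append_assoc, n3, ← List.length_append]
        exact n4.push
      · simp only [List.length_append, List.length_singleton]
        omega
    · intro hge'
      simp only [Test.holds, Expr.val, q0, not_lt] at hge'
      rcases rest with _ | ⟨x, rest⟩
      · rw [List.append_nil] at n1
        simp only [wp_block_nil, Expr.cost, BinOp.eval, setReg_reg,
          setReg_mem, q3, Test.cost]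
        simp only [show (8 : ℕ) ≠ 3 by decide, if_true, if_false]
        rw [hsucc, n1]
        refine ⟨⟨trivial, by omega, by omega⟩, ⟨by omega, n4, ?_, ?_⟩, by omega⟩
        · rw [List.length_append, n3]
        · omega
      · have : x ∈ L.filter fun x => g x = s3.reg 3 := by
          rw [n1]
          simp
        have := (hmem x).1 (List.mem_filter.1 this).1
        have := n2.1
        omega
  · intro hge'
    simp only [Test.holds, Expr.val, r5'', not_lt] at hge'
    have h3' : s3.reg 3 = b := by omega
    rw [h3'] at l2 l3 l4
    have := hlenD b le_rfl
    simp only [wp_block_nil, Expr.cost, BinOp.eval, setReg_reg,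
      setReg_mem, r4'', r5'', Test.cost, if_true]
    refine ⟨⟨trivial, trivial, hDw⟩, l2, trivial, by omega⟩

/-- Radix sort of the positions of the pattern by `c` digits in base `m + N`. -/
def radixSort (c : ℕ) : Program :=
  block [
    .setReg 3 (.const 0),
    .loop (.lt (.reg 3) (.reg 0)) (block [
      .setMem 100 (.reg 3) (.reg 3),
      .setReg 3 (.bin .add (.reg 3) (.const 1))]),
    .setReg 4 (.const 1),
    .setReg 5 (.bin .add (.reg 0) (.reg 1)),
    block (List.replicate c radixPass)]

/-- The number of passes is a variable, so the write set of the repetition does not reduce by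
computation and needs an induction. -/
theorem frame_replicate (c : ℕ) (P : Program) :
    (∀ r, P.wReg r = false → (block (List.replicate c P)).wReg r = false) ∧
    (∀ r, P.wMem r = false → (block (List.replicate c P)).wMem r = false) ∧
    ∀ r, P.wChr r = false → (block (List.replicate c P)).wChr r = false := by
  induction c with
  | zero => exact ⟨fun _ _ => rfl, fun _ _ => rfl, fun _ _ => rfl⟩
  | succ c ih =>
    refine ⟨fun r h => ?_, fun r h => ?_, fun r h => ?_⟩
    · simp [List.replicate_succ, block, Program.wReg, h, ih.1 r h]
    · simp [List.replicate_succ, block, Program.wMem, h, ih.2.1 r h]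
    · simp [List.replicate_succ, block, Program.wChr, h, ih.2.2 r h]

theorem wp_radixPasses {m b : ℕ} {key : ℕ → ℕ} (hb0 : 0 < b)
    (hkey : ∀ i < m, key i < wordBound w) (hw : m + b + 1 < wordBound w) (c : ℕ) :
    ∀ (j : ℕ) (s : Store ℕ) (L : List ℕ), s.reg 0 = m → s.reg 5 = b → s.reg 4 = b ^ j →
      (∀ i < m, s.chr 0 i = some (key i)) → L.Perm (List.range m) → Holds (s.mem 100) L →
      L.Pairwise (fun x y => key x % b ^ j ≤ key y % b ^ j) → b ^ (j + c) < wordBound w →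
      WP w some (block (List.replicate c radixPass)) s fun s' l =>
        ∃ L' : List ℕ, L'.Perm (List.range m) ∧ Holds (s'.mem 100) L' ∧
          L'.Pairwise (fun x y => key x % b ^ (j + c) ≤ key y % b ^ (j + c)) ∧
          l ≤ c * (200 * (m + b) + 200) + 1 := by
  induction c with
  | zero =>
    intro j s L _ _ _ _ hL hs hp _
    rw [List.replicate_zero, wp_block_nil]
    exact ⟨L, hL, hs, by simpa using hp, by simp⟩
  | succ c ih =>
    intro j s L hm hb hD hp hL hs hsort hw'
    rw [List.replicate_succ, wp_block_cons]
    have hDw : b ^ j * b < wordBound w := by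
      rw [← pow_succ]
      exact (Nat.pow_le_pow_right hb0 (by omega)).trans_lt hw'
    refine (wp_radixPass hm hb hD hb0 hp hkey hL hs hw hDw).mono ?_
    rintro s1 l1 F1 ⟨h1, h2, h3⟩
    have hnd : L.Nodup := hL.nodup_iff.2 List.nodup_range
    refine (ih (j + 1) s1 _ ((F1.reg 0 rfl).trans hm) ((F1.reg 5 rfl).trans hb)
      (h2.trans (pow_succ b j).symm) (by rwa [F1.chr 0 rfl])
      ((distribute_perm hnd fun x _ => Nat.mod_lt _ hb0).trans hL) h1
      (distribute_sorted hb0 hsort) (by rwa [show j + 1 + c = j + (c + 1) by ring])).mono ?_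
    rintro s2 l2 - ⟨L', g1, g2, g3, g4⟩
    refine ⟨L', g1, g2, by rwa [show j + (c + 1) = j + 1 + c by ring], ?_⟩
    rw [Nat.add_mul, Nat.one_mul]
    omega

theorem isSorting_of_holds {m : ℕ} {key : ℕ → ℕ} {L : List ℕ} {f : ℕ → ℕ}
    (hL : L.Perm (List.range m)) (hf : Holds f L) (hs : L.Pairwise fun x y => key x ≤ key y) :
    IsSorting key m f := by
  have hlen : L.length = m := by simpa using hL.length_eq
  have hmem : ∀ x, x ∈ L ↔ x < m := fun x => by simpa using hL.mem_iff (a := x)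
  have hnd : L.Nodup := hL.nodup_iff.2 List.nodup_range
  refine ⟨fun r hr => ?_, fun r hr r' hr' h => ?_, fun k hk => ?_, fun r r' hrr hr' => ?_⟩
  · rw [hf r (by omega)]
    exact (hmem _).1 (List.getElem_mem _)
  · rw [hf r (by omega), hf r' (by omega)] at h
    exact (hnd.getElem_inj_iff).1 h
  · obtain ⟨i, hi, rfl⟩ := List.getElem_of_mem ((hmem k).2 hk)
    exact ⟨i, by omega, hf i hi⟩
  · rcases hrr.lt_or_eq with hlt | rfl
    · rw [hf r (by omega), hf r' (by omega)]
      exact List.pairwise_iff_getElem.1 hs r r' (by omega) (by omega) hlt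
    · exact le_rfl

/-- The matching program that sorts the pattern by radix sort. -/
def matchRadix (c : ℕ) : Program := block [radixSort c, matchSorted]

/-- In base `m + N` the characters of the pattern have `c` digits, and each pass is linear in `m +
N`. Tree labels are only compared, never read as integers, so no bound on them is needed. -/
theorem solvesWithin_matchRadix {p : List ℕ} {T : LabelledTree ℕ} {c : ℕ}
    (hp : p ≠ []) (hpc : ∀ x ∈ p, x < (p.length + T.size) ^ c)
    (hw : (c + 100) * (p.length + T.size) ^ (c + 100) ≤ 2 ^ w) :
    SolvesWithin w some (matchRadix c) p T ((1000 * c + 10000) * (p.length + T.size)) := by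
  have hm1 : 1 ≤ p.length := List.length_pos_iff.2 hp
  have hN1 : 0 < T.size := T.root.pos
  have hb := wordBound_of_pow hw
  have hb' : 100 * (p.length + T.size) ≤ wordBound w :=
    (Nat.mul_le_mul_right _ (by omega)).trans hb
  have hpow : (p.length + T.size) ^ c < wordBound w := by
    have h1 : (p.length + T.size) ^ c ≤ (p.length + T.size) ^ (c + 100) :=
      Nat.pow_le_pow_right (by omega) (by omega)
    have h2 : 0 < (p.length + T.size) ^ c := Nat.pow_pos (by omega)
    have h3 : 2 * (p.length + T.size) ^ (c + 100) ≤
        (c + 100) * (p.length + T.size) ^ (c + 100) := Nat.mul_le_mul_right _ (by omega)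
    unfold wordBound
    omega
  suffices h : WP w some (matchRadix c) (matchInput p T) fun s' l =>
      l ≤ (1000 * c + 10000) * (p.length + T.size) ∧ IsMatchOutput p T s' by
    obtain ⟨s', l, h1, h2⟩ := h
    exact ⟨s', l, h1, h2⟩
  have hkeylt : ∀ i < p.length, (p[i]?).getD 0 < (p.length + T.size) ^ c := by
    intro i hi
    simpa [hi] using hpc _ (List.getElem_mem hi)
  have hfr := frame_replicate c radixPass
  have hfrR : ∀ r, (block (List.replicate c radixPass)).wReg r = false → r ≠ 3 → r ≠ 4 → r ≠ 5 →
      (radixSort c).wReg r = false := by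
    intro r h h3 h4 h5
    simp [radixSort, block, Program.wReg, h, h3, h4, h5]
  have hfrM : ∀ r, (block (List.replicate c radixPass)).wMem r = false → r ≠ 100 →
      (radixSort c).wMem r = false := by
    intro r h h3
    simp [radixSort, block, Program.wMem, h, h3]
  have hfrC : ∀ r, (block (List.replicate c radixPass)).wChr r = false →
      (radixSort c).wChr r = false := by
    intro r h
    simp [radixSort, block, Program.wChr, h]
  rw [matchRadix, wp_block_cons]
  refine WP.mono (Q' := fun s' l =>
    IsSorting (fun i => (p[i]?).getD 0) p.length (s'.mem 100) ∧
      l ≤ c * (200 * (p.length + (p.length + T.size)) + 200) + 50 * p.length + 50) ?_ ?_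
  · simp only [radixSort, wp_block_cons, wp_setReg, Expr.ok, Expr.val, Expr.cost]
    refine ⟨by omega, wp_loop (fun s' k => s'.reg 3 ≤ p.length ∧
      (∀ i < s'.reg 3, s'.mem 100 i = i) ∧ k ≤ 50 * s'.reg 3) (fun s' => p.length - s'.reg 3)
      (by simp) ?_⟩
    rintro s1 k1 F1 ⟨i1, i2, i3⟩
    have r0 : s1.reg 0 = p.length := (F1.reg 0 rfl).trans (by simp [matchInput])
    have r1 : s1.reg 1 = T.size := (F1.reg 1 rfl).trans (by simp [matchInput])
    have c0 : s1.chr 0 = (matchInput p T).chr 0 := F1.chr 0 rfl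
    refine ⟨by simp, ?_, ?_⟩
    · intro hlt
      simp only [Test.holds, Expr.val, r0] at hlt
      simp [Test.cost]
      refine ⟨⟨by omega, by omega⟩, ⟨by omega, fun d hd => ?_, by omega⟩, by omega⟩
      rcases hd.lt_or_eq with hd | rfl
      · rw [Function.update_of_ne hd.ne, i2 d hd]
      · simp
    intro hge
    simp only [Test.holds, Expr.val, r0, not_lt] at hge
    have h3 : s1.reg 3 = p.length := by omega
    rw [h3] at i2 i3
    simp only [setReg_reg, show (0 : ℕ) ≠ 4 by decide, show (1 : ℕ) ≠ 4 by decide, if_false, r0, r1,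
      BinOp.eval]
    refine ⟨by omega, ⟨trivial, trivial, by omega⟩, (wp_radixPasses (m := p.length)
      (b := p.length + T.size) (key := fun i => (p[i]?).getD 0) (by omega)
      (fun i hi => (hkeylt i hi).trans hpow) (by omega) c 0 _ (List.range p.length)
      (by simp [r0]) (by simp) (by simp) ?_ (List.Perm.refl _) ?_ ?_ (by simpa using hpow)).mono ?_⟩
    · intro i hi
      simp [c0, matchInput, hi]
    · intro i hi
      simpa using i2 i (by simpa using hi)
    · simp [Nat.mod_one, List.pairwise_iff_getElem]
    · rintro s2 l2 - ⟨L, g1, g2, g3, g4⟩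
      rw [Nat.zero_add] at g3
      rw [wp_block_nil]
      refine ⟨isSorting_of_holds g1 g2 (g3.imp_of_mem fun {x y} hx hy hxy => ?_), ?_⟩
      · rwa [Nat.mod_eq_of_lt (hkeylt x (by simpa using g1.mem_iff.1 hx)),
          Nat.mod_eq_of_lt (hkeylt y (by simpa using g1.mem_iff.1 hy))] at hxy
      · simp only [Test.cost, Expr.cost]
        omega
  · rintro s1 l1 F1 ⟨h1, h2⟩
    rw [wp_block_cons]
    refine (wp_matchSorted (T := T) (c := 0) hp ⟨?_, ?_, ?_, ?_, ?_, ?_⟩ h1 (by omega)).mono ?_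
    · rw [F1.reg 0 (hfrR 0 (hfr.1 0 rfl) (by decide) (by decide) (by decide))]
      simp [matchInput]
    · rw [F1.reg 1 (hfrR 1 (hfr.1 1 rfl) (by decide) (by decide) (by decide))]
      simp [matchInput]
    · rw [F1.reg 2 (hfrR 2 (hfr.1 2 rfl) (by decide) (by decide) (by decide))]
      simp [matchInput]
    · rw [F1.mem 0 (hfrM 0 (hfr.2.1 0 rfl) (by decide))]
    · rw [F1.chr 0 (hfrC 0 (hfr.2.2 0 rfl))]
    · rw [F1.chr 1 (hfrC 1 (hfr.2.2 1 rfl))]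
    · rintro s2 l2 - ⟨g1, g2⟩
      rw [wp_block_nil]
      refine ⟨?_, g1⟩
      have : c * (200 * (p.length + (p.length + T.size)) + 200) ≤
          c * (1000 * (p.length + T.size)) := Nat.mul_le_mul_left c (by omega)
      have e : (1000 * c + 10000) * (p.length + T.size) =
          c * (1000 * (p.length + T.size)) + 10000 * (p.length + T.size) := by ring
      omega

end RadixSort

end OPTree

/-! ### The three time bounds -/

theorem theorem1 :
    -- O(sort(p) + N): `t` is the time that the sorting program `A` takes on `p`
    (∀ A : OPTree.Program, ∃ (B : OPTree.Program) (C K : ℕ),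
      ∀ (α : Type u) [LinearOrder α] (code : α → Option ℕ) (p : List α)
        (T : OPTree.LabelledTree α) (w t : ℕ),
        p ≠ [] → K * (p.length + T.size) ^ K ≤ 2 ^ w →
        OPTree.SortsIn w code A p t →
        OPTree.SolvesWithin w code B p T (C * (t + T.size))) ∧
    -- O(m log m + N) for general ordered alphabets: characters can only be compared
    (∃ (B : OPTree.Program) (C K : ℕ),
      ∀ (α : Type u) [LinearOrder α] (p : List α) (T : OPTree.LabelledTree α) (w : ℕ),
        p ≠ [] → K * (p.length + T.size) ^ K ≤ 2 ^ w →
        OPTree.SolvesWithin w (fun _ => none) B p T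
          (C * (p.length * Nat.log 2 p.length + T.size))) ∧
    -- O(m + N) for integer alphabets of polynomial size
    (∀ c : ℕ, ∃ (B : OPTree.Program) (C K : ℕ),
      ∀ (p : List ℕ) (T : OPTree.LabelledTree ℕ) (w : ℕ),
        p ≠ [] → (∀ x ∈ p, x < (p.length + T.size) ^ c) →
        K * (p.length + T.size) ^ K ≤ 2 ^ w →
        OPTree.SolvesWithin w some B p T (C * (p.length + T.size))) := by

  refine ⟨fun A => ⟨OPTree.matchUsing A, 20000, 100, fun α _ code p T w t hp hw hA =>
    OPTree.solvesWithin_matchUsing hp hw hA⟩,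
    ⟨OPTree.matchUsing OPTree.mergeSort, 100000000, 100, fun α _ p T w hp hw => ?_⟩,
    fun c => ⟨OPTree.matchRadix c, 1000 * c + 10000, c + 100, fun p T w hp hpc hw =>
      OPTree.solvesWithin_matchRadix hp hpc hw⟩⟩
  have hwb := OPTree.wordBound_of_pow hw
  obtain ⟨t, ht, htle⟩ := OPTree.sortsIn_mergeSort (code := fun _ : α => none) hp
    ((Nat.mul_le_mul_left 100 (Nat.le_add_right _ _)).trans hwb)
  obtain ⟨s, k, hrun, hk, hout⟩ := OPTree.solvesWithin_matchUsing hp hw ht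
  -- The additive constant in the merge sort bound, needed where the logarithm vanishes, is absorbed
  -- by the number of nodes.
  have hN : 0 < T.size := T.root.pos
  exact ⟨s, k, hrun, by omega, hout⟩
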